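/- \textbf{Setting.} Let $\Omega=\{x\in\mathbb R^2:\|x\|<R\}$, $R>0$, with polar coordinates $(r,\theta)$. Consider the bulk-surface system $U_t=D_u\Delta U-\sigma_uU$, $V_t=D_v\Delta V-\sigma_vV$ in $\Omega$, with $D_u\partial_rU=K_u(u-U)$, $D_v\partial_rV=K_v(v-V)$ at $r=R$, and on the circle $u_t=\frac{d_u}{R^2}u_{\theta\theta}-K_u(u-U|_{r=R})+f(u,v)$, $v_t=\frac{d_v}{R^2}v_{\theta\theta}-K_v(v-V|_{r=R})+g(u,v)$, where $D_u,D_v,\sigma_u,\sigma_v,K_u,K_v>0$ and $d_u,d_v\ge0$. The bifurcation parameters are $\mu=(K_v,D_v)$, and $\mu=\mu_0+\varepsilon^2\mu_1$ with $\|\mu_1\|=1$; below $K_v,D_v$ denote the components of $\mu_0$. For $n\in\mathbb Z$ let $I_n$ be the modified Bessel functions of the first kind, $\Omega_u=\sqrt{(\lambda+\sigma_u)/D_u}$, $\Omega_v=\sqrt{(\lambda+\sigma_v)/D_v}$ (principal branch), $\omega_u,\omega_v$ their values at $\lambda=0$, $$A_n(\lambda)=\frac{K_uI_n(\Omega_uR)}{D_u\Omega_uI_n'(\Omega_uR)+K_uI_n(\Omega_uR)},\quad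 B_n(\lambda)=\frac{K_vI_n(\Omega_vR)}{D_v\Omega_vI_n'(\Omega_vR)+K_vI_n(\Omega_vR)},\quad p_n=1-A_n,\ q_n=1-B_n .$$ Let $\boldsymbol u_e=(u_e,v_e)\in\mathbb R^2$ satisfy $K_up_0(0)u_e=f(u_e,v_e)$, $K_vq_0(0)v_e=g(u_e,v_e)$, let $f,g$ be $C^3$ near $\boldsymbol u_e$, let $J_e$ be the Jacobian of $(f,g)$ at $\boldsymbol u_e$, and let $B(x,y)$ and $C(x,y,z)$ be $\frac12$ of the second and $\frac16$ of the third differential of $(f,g)$ at $\boldsymbol u_e$, extended complex-multilinearly. Put $E_i=e_ie_i^T$, $$\Phi_n(\lambda)=J_e-\lambda I-\Big(K_up_n(\lambda)+\tfrac{n^2d_u}{R^2}\Big)E_1-\Big(K_vq_n(\lambda)+\tfrac{n^2d_v}{R^2}\Big)E_2 .$$ For states $W=(U,V,u,v)$ let $$\mathcal L(W)=\Big(D_u\Delta U-\sigma_uU,\ D_v\Delta V-\sigma_vV,\ \tfrac{d_u}{R^2}u_{\theta\theta}-K_u(u-U|_{r=R})+f_uu+f_vv,\ \tfrac{d_v}{R^2}v_{\theta\theta}-K_v(v-V|_{r=R})+g_uu+g_vv\Big)$$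 (partial derivatives of $f,g$ at $\boldsymbol u_e$); $\mathcal L^\star$ is the same with $J_e$ replaced by $J_e^T$. Let $\mathcal B(W,W')=(0,0,B(\boldsymbol u,\boldsymbol u'))$, $\mathcal C(W,W',W'')=(0,0,C(\boldsymbol u,\boldsymbol u',\boldsymbol u''))$ with $\boldsymbol u=(u,v)$, and $$\langle W^\star,W\rangle=\int_0^{2\pi}\!\!\int_0^R(\overline{U^\star}U+\overline{V^\star}V)\,r\,dr\,d\theta+\int_0^{2\pi}(\overline{u^\star}u+\overline{v^\star}v)\,R\,d\theta .$$ For $\varphi\in\mathbb C^2$ let $\mathcal W_n=\big(A_n(\lambda)\frac{I_n(\Omega_ur)}{I_n(\Omega_uR)}\varphi_1,\ B_n(\lambda)\frac{I_n(\Omega_vr)}{I_n(\Omega_vR)}\varphi_2,\ \varphi\big)e^{in\theta}$ and, for $\varphi^\star\in\mathbb C^2$, $\mathcal W_n^\star=\big(\overline{A_n(\lambda)}\frac{I_n(\overline{\Omega_u}r)}{I_n(\overline{\Omega_u}R)}\varphi^\star_1,\ \overline{B_n(\lambda)}\frac{I_n(\overline{\Omega_v}r)}{I_n(\overline{\Omega_v}R)}\varphi^\star_2,\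 \varphi^\star\big)e^{in\theta}$. The base state $W_e$ is $\mathcal W_0$ at $\lambda=0$, $\varphi=\boldsymbol u_e$. Critical vectors at $(n,\lambda)$ are $\varphi,\varphi^\star$ with $\Phi_n(\lambda)\varphi=0$, $\overline{\Phi_n(\lambda)}^T\varphi^\star=0$, $\langle\mathcal W_n^\star,\mathcal W_n\rangle=1$. Let $\beta=(1,-K_v/D_v)^T$ and $$\alpha=q_0(0)^2e_1+\frac{\omega_vK_v^2}{(D_v\omega_vI_1+K_vI_0)^2}\Big(I_0I_1+\tfrac{\omega_vR}2(I_1^2-I_0^2)\Big)e_2,\qquad I_j=I_j(\omega_vR).$$ ``$X$ solves $\lambda X-\mathcal LX=F$ with flux $\eta$'' means: $X=(x_1,x_2,x_3,x_4)$ is a classical solution (bulk components $C^2$ inside and $C^1$ up to the boundary, surface components $C^2$ and $2\pi$-periodic) satisfying at $r=R$ $D_u\partial_rx_1=K_u(x_3-x_1)$ and $D_v\partial_rx_2=K_v(x_4-x_2)+\eta$. If no flux is mentioned, $\eta=0$. \textbf{Second order.} Assume $\det\Phi_0(0)\ne0$. Let $W_{0000}$ solve $-\mathcal LW_{0000}=(0,\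 \omega_v^2V_e\,e_2^T\mu_1,\ 0,\ -q_0(0)v_e\,e_1^T\mu_1)$ with flux $q_0(0)v_e\,\beta^T\mu_1$. \textbf{Third order.} With slow time $\tau=\varepsilon^2t$ and $W_1=(U_1,V_1,u_1,v_1)$, the third-order problem is $$\partial_tW_3-\mathcal LW_3=N_3:=-\partial_\tau W_1+2\mathcal B(W_1,W_2)+\mathcal C(W_1,W_1,W_1)+\Big(0,\ e_2^T\mu_1\tfrac{(\partial_t+\sigma_v)V_1}{D_v},\ 0,\ -e_1^T\mu_1(v_1-V_1|_{r=R})\Big),$$ with flux $\eta_3:=\beta^T\mu_1(v_1-V_1|_{r=R})$. \textbf{Notation for the conclusions.} Put $w_n(\lambda)=B_n^2\Omega_v^2\frac R2\Big(1-\frac{I_{n-1}(\Omega_vR)I_{n+1}(\Omega_vR)}{I_n(\Omega_vR)^2}\Big)$. For critical vectors $\varphi,\varphi^\star$ at $(n,\lambda)$, the \emph{solvability equation} for an amplitude $A$ with cubic part $N$ is $$-2\pi RB_nq_n\overline{\varphi_2^\star}\varphi_2\,\beta^T\mu_1A=-\frac{dA}{d\tau}+2\langle\mathcal W_n^\star,\mathcal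 B(\mathcal W_n,W_{0000})\rangle A+2\pi R\,\overline{\varphi_2^\star}\varphi_2\big(w_n\,e_2^T\mu_1-q_n\,e_1^T\mu_1\big)A+N ,$$ and the \emph{linear coefficient vector} is $$g=2\pi R\,\overline{\varphi_2^\star}\varphi_2\,(B_nq_n\beta+w_ne_2-q_ne_1)+4\pi R\,\overline{\varphi^\star}^TB\big(\varphi,\Phi_0(0)^{-1}E_2\boldsymbol u_e\big)\,\alpha ,$$ all functions being taken at $\lambda$. \textbf{Theorem.} (1) \emph{Hopf.} Let $\lambda_I>0$, let $\phi_0,\phi_0^\star\in\mathbb C^2$ be critical vectors at $n=0$, $\lambda=i\lambda_I$, let $\det\Phi_0(2i\lambda_I)\neq0$, and let $W_{2000},W_{1100}$ solve $2i\lambda_IW_{2000}-\mathcal LW_{2000}=\mathcal B(\mathcal W_0,\mathcal W_0)$ and $-\mathcal LW_{1100}=2\mathcal B(\mathcal W_0,\overline{\mathcal W_0})$. Then $\mathcal W_0^\star$ satisfies the homogeneous boundary conditions and $\mathcal L^\star\mathcal W_0^\star=-i\lambda_I\mathcal W_0^\star$. Take $W_1=\mathcal W_0A_0(\tau)e^{i\lambda_It}+c.c.$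 and $W_2=W_{0000}+A_0^2e^{2i\lambda_It}W_{2000}+|A_0|^2W_{1100}+\overline{A_0}^2e^{-2i\lambda_It}\overline{W_{2000}}$. If $A_0$ is differentiable at $\tau$ and $i\lambda_IX-\mathcal LX=F$ with flux $\eta$ has a solution $X$, where $F,\eta$ are the coefficients of $e^{i\lambda_It}$ in $N_3,\eta_3$ at $\tau$, then at $\tau$ the solvability equation holds for $A_0$ with $N=g_{2100}|A_0|^2A_0$; equivalently $$\frac{dA_0}{d\tau}=g_{1000}^T\mu_1A_0+g_{2100}|A_0|^2A_0 .$$ Here $g_{1000}$ is the linear coefficient vector at $(0,i\lambda_I)$ and $$g_{2100}=\langle\mathcal W_0^\star,2\mathcal B(\mathcal W_0,W_{1100})+2\mathcal B(\overline{\mathcal W_0},W_{2000})+3\mathcal C(\mathcal W_0,\mathcal W_0,\overline{\mathcal W_0})\rangle=2\pi R\,\overline{\phi_0^\star}^T\big[2B(\phi_0,u_{1100})+2B(\overline{\phi_0},u_{2000})+3C(\phi_0,\phi_0,\overline{\phi_0})\big],$$ with $u_{2000}=-\Phi_0(2i\lambda_I)^{-1}B(\phi_0,\phi_0)$ and $u_{1100}=-2\Phi_0(0)^{-1}B(\phi_0,\overline{\phi_0})$.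 (2) \emph{Pitchfork.} Let $n\in\mathbb Z\setminus\{0\}$, let $\phi_n,\phi_n^\star\in\mathbb R^2$ be critical vectors at $n$, $\lambda=0$ (and $\phi_{-n}=\phi_n$), let $\det\Phi_{2n}(0)\ne0$, and let $W_{0020},W_{0011}$ solve $-\mathcal LW_{0020}=\mathcal B(\mathcal W_n,\mathcal W_n)$ and $-\mathcal LW_{0011}=2\mathcal B(\mathcal W_n,\mathcal W_{-n})$. Then $\mathcal W_n^\star$ satisfies the homogeneous boundary conditions and $\mathcal L^\star\mathcal W_n^\star=0$. Take $W_1=\mathcal W_nA_n(\tau)+\mathcal W_{-n}\overline{A_n(\tau)}$ and $W_2=W_{0000}+A_n^2W_{0020}+|A_n|^2W_{0011}+\overline{A_n}^2\,\overline{W_{0020}}$. If $A_n$ is differentiable at $\tau$ and $-\mathcal LY=N_3$ with flux $\eta_3$ has a solution $Y$, then at $\tau$ the solvability equation holds for $A_n$ with $N=g_{0021}|A_n|^2A_n$; equivalently $$\frac{dA_n}{d\tau}=g_{0010}^T\mu_1A_n+g_{0021}|A_n|^2A_n .$$ Here $g_{0010}\in\mathbb R^2$ is the linear coefficient vector at $(n,0)$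 and $$g_{0021}=\langle\mathcal W_n^\star,2\mathcal B(\mathcal W_n,W_{0011})+2\mathcal B(\mathcal W_{-n},W_{0020})+3\mathcal C(\mathcal W_n,\mathcal W_n,\mathcal W_{-n})\rangle=2\pi R\,{\phi_n^\star}^T\big[2B(\phi_n,u_{0011})+2B(\phi_n,u_{0020})+3C(\phi_n,\phi_n,\phi_n)\big]\in\mathbb R,$$ with $u_{0020}=-\Phi_{2n}(0)^{-1}B(\phi_n,\phi_n)$ and $u_{0011}=-2\Phi_0(0)^{-1}B(\phi_n,\phi_n)$. (3) \emph{Pitchfork-Hopf.} Let the hypotheses on the critical vectors, determinants and second-order fields of (1) and (2) hold together, let $\det\Phi_n(i\lambda_I)\ne0$, and let $W_{1010},W_{1001}$ solve $i\lambda_IW_{1010}-\mathcal LW_{1010}=2\mathcal B(\mathcal W_0,\mathcal W_n)$ and $i\lambda_IW_{1001}-\mathcal LW_{1001}=2\mathcal B(\mathcal W_0,\mathcal W_{-n})$. Then the adjoint relations in (1) and (2) hold. Put $W_{0110}=\overline{W_{1001}}$, $W_{0101}=\overline{W_{1010}}$. Take $W_1$ to be the sum of those in (1) and (2), and $W_2$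 the sum of $W_{0000}$, of the amplitude-dependent parts of $W_2$ in (1) and (2), and of $A_0A_ne^{i\lambda_It}W_{1010}+A_0\overline{A_n}e^{i\lambda_It}W_{1001}+\overline{A_0}A_ne^{-i\lambda_It}W_{0110}+\overline{A_0}\,\overline{A_n}e^{-i\lambda_It}W_{0101}$. If $A_0,A_n$ are differentiable at $\tau$, and both $i\lambda_IX-\mathcal LX=F$ with flux $\eta$ (with $F,\eta$ the coefficients of $e^{i\lambda_It}$ in $N_3,\eta_3$ at $\tau$) and $-\mathcal LY=G$ with flux $\zeta$ (with $G,\zeta$ the coefficients of $e^{0}$, i.e. the time averages, of $N_3,\eta_3$ at $\tau$) have solutions $X$ and $Y$, then at $\tau$ the solvability equations hold for $A_0$ with $N=g_{2100}|A_0|^2A_0+g_{1011}|A_n|^2A_0$ and for $A_n$ with $N=g_{0021}|A_n|^2A_n+g_{1110}|A_0|^2A_n$; equivalently $$\frac{dA_0}{d\tau}=g_{1000}^T\mu_1A_0+g_{2100}|A_0|^2A_0+g_{1011}|A_n|^2A_0,\qquad\frac{dA_n}{d\tau}=g_{0010}^T\mu_1A_n+g_{0021}|A_n|^2A_n+g_{1110}|A_0|^2A_n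 .$$ Here $g_{1000},g_{2100},g_{0010},g_{0021}$ are as in (1) and (2) and, with $u_{1010}=-2\Phi_n(i\lambda_I)^{-1}B(\phi_0,\phi_n)$, $$g_{1011}=\langle\mathcal W_0^\star,2\mathcal B(\mathcal W_0,W_{0011})+2\mathcal B(\mathcal W_n,W_{1001})+2\mathcal B(\mathcal W_{-n},W_{1010})+6\mathcal C(\mathcal W_0,\mathcal W_n,\mathcal W_{-n})\rangle=2\pi R\,\overline{\phi_0^\star}^T\big[2B(\phi_0,u_{0011})+4B(\phi_n,u_{1010})+6C(\phi_0,\phi_n,\phi_n)\big],$$ $$g_{1110}=\langle\mathcal W_n^\star,2\mathcal B(\mathcal W_n,W_{1100})+2\mathcal B(\mathcal W_0,W_{0110})+2\mathcal B(\overline{\mathcal W_0},W_{1010})+6\mathcal C(\mathcal W_0,\overline{\mathcal W_0},\mathcal W_n)\rangle=2\pi R\,{\phi_n^\star}^T\big[2B(\phi_n,u_{1100})+2B(\phi_0,\overline{u_{1010}})+2B(\overline{\phi_0},u_{1010})+6C(\phi_0,\overline{\phi_0},\phi_n)\big]\in\mathbb R .$$ -/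

import Mathlib

noncomputable section

namespace BulkSurface

open Complex Matrix ComplexConjugate

/-- The data of the coupled bulk-surface system on the disk of radius `R`, at the bifurcation
point `(Kv, Dv)`: bulk diffusion `Du, Dv`, bulk decay `σu, σv`, coupling rates `Ku, Kv`, surface
diffusion `du, dv`, and the surface kinetics `f, g`. -/
structure Params where
  (R Du Dv σu σv Ku Kv du dv : ℝ)
  (f g : ℝ → ℝ → ℝ)
  R_pos : 0 < R
  Du_pos : 0 < Du
  Dv_pos : 0 < Dv
  σu_pos : 0 < σu
  σv_pos : 0 < σv
  Ku_pos : 0 < Ku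
  Kv_pos : 0 < Kv
  du_nonneg : 0 ≤ du
  dv_nonneg : 0 ≤ dv

/-! ### Modified Bessel functions and the dispersion matrix -/

/-- The modified Bessel function of the first kind `I_n(z)` of integer order (`I_{-n} = I_n`). -/
def besselI (n : ℤ) (z : ℂ) : ℂ :=
  ∑' k : ℕ, (z / 2) ^ (2 * k + n.natAbs) / ((k.factorial : ℂ) * ((k + n.natAbs).factorial : ℂ))

variable (P : Params)

/-- `Ω_u = √((λ + σ_u) / D_u)`, principal branch; its value at `λ = 0` is `ω_u`. -/
def Params.Ωu (lam : ℂ) : ℂ := ((lam + P.σu) / P.Du) ^ (1 / 2 : ℂ)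

/-- `Ω_v = √((λ + σ_v) / D_v)`, principal branch; its value at `λ = 0` is `ω_v`. -/
def Params.Ωv (lam : ℂ) : ℂ := ((lam + P.σv) / P.Dv) ^ (1 / 2 : ℂ)

/-- `A_n(λ) = K_u I_n(Ω_u R) / (D_u Ω_u I_n'(Ω_u R) + K_u I_n(Ω_u R))`. -/
def Params.coefA (n : ℤ) (lam : ℂ) : ℂ :=
  P.Ku * besselI n (P.Ωu lam * P.R) /
    (P.Du * P.Ωu lam * deriv (besselI n) (P.Ωu lam * P.R) + P.Ku * besselI n (P.Ωu lam * P.R))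

/-- `B_n(λ) = K_v I_n(Ω_v R) / (D_v Ω_v I_n'(Ω_v R) + K_v I_n(Ω_v R))`. -/
def Params.coefB (n : ℤ) (lam : ℂ) : ℂ :=
  P.Kv * besselI n (P.Ωv lam * P.R) /
    (P.Dv * P.Ωv lam * deriv (besselI n) (P.Ωv lam * P.R) + P.Kv * besselI n (P.Ωv lam * P.R))

/-- `p_n(λ) = D_u Ω_u I_n'(Ω_u R) / (D_u Ω_u I_n'(Ω_u R) + K_u I_n(Ω_u R))`. -/
def Params.p (n : ℤ) (lam : ℂ) : ℂ :=
  P.Du * P.Ωu lam * deriv (besselI n) (P.Ωu lam * P.R) /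
    (P.Du * P.Ωu lam * deriv (besselI n) (P.Ωu lam * P.R) + P.Ku * besselI n (P.Ωu lam * P.R))

/-- `q_n(λ) = D_v Ω_v I_n'(Ω_v R) / (D_v Ω_v I_n'(Ω_v R) + K_v I_n(Ω_v R))`. -/
def Params.q (n : ℤ) (lam : ℂ) : ℂ :=
  P.Dv * P.Ωv lam * deriv (besselI n) (P.Ωv lam * P.R) /
    (P.Dv * P.Ωv lam * deriv (besselI n) (P.Ωv lam * P.R) + P.Kv * besselI n (P.Ωv lam * P.R))

/-- Partial derivative in the first variable. -/
def partialU (h : ℝ → ℝ → ℝ) : ℝ → ℝ → ℝ := fun a b => deriv (fun x => h x b) a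

/-- Partial derivative in the second variable. -/
def partialV (h : ℝ → ℝ → ℝ) : ℝ → ℝ → ℝ := fun a b => deriv (fun y => h a y) b

/-- The Jacobian `J_e` of the kinetics at the surface steady state `e = (u_e, v_e)`. -/
def Params.jac (e : Fin 2 → ℝ) : Matrix (Fin 2) (Fin 2) ℂ :=
  !![(partialU P.f (e 0) (e 1) : ℂ), (partialV P.f (e 0) (e 1) : ℂ);
     (partialU P.g (e 0) (e 1) : ℂ), (partialV P.g (e 0) (e 1) : ℂ)]

/-- `Φ_n(λ) = J_e - λ I - (K_u p_n(λ) + n² d_u / R²) E₁ - (K_v q_n(λ) + n² d_v / R²) E₂`. -/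
def Params.Phi (e : Fin 2 → ℝ) (n : ℤ) (lam : ℂ) : Matrix (Fin 2) (Fin 2) ℂ :=
  P.jac e - lam • (1 : Matrix (Fin 2) (Fin 2) ℂ) -
    Matrix.diagonal ![P.Ku * P.p n lam + (n : ℂ) ^ 2 * P.du / (P.R : ℂ) ^ 2,
      P.Kv * P.q n lam + (n : ℂ) ^ 2 * P.dv / (P.R : ℂ) ^ 2]

/-- `e` is the surface part of the radially symmetric base state:
`K_u p_0(0) u_e = f(u_e, v_e)` and `K_v q_0(0) v_e = g(u_e, v_e)`. -/
def Params.IsSteady (e : Fin 2 → ℝ) : Prop :=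
  P.Ku * P.p 0 0 * e 0 = (P.f (e 0) (e 1) : ℂ) ∧ P.Kv * P.q 0 0 * e 1 = (P.g (e 0) (e 1) : ℂ)

/-! ### The quadratic and cubic forms of the kinetics -/

/-- One component of `½ (I ⊗ yᵀ) H_e x`: half the second differential of `h` at `e`. -/
def quadForm (h : ℝ → ℝ → ℝ) (e : Fin 2 → ℝ) (x y : Fin 2 → ℂ) : ℂ :=
  (1 / 2) * ((partialU (partialU h) (e 0) (e 1) : ℂ) * (x 0 * y 0) +
    (partialV (partialU h) (e 0) (e 1) : ℂ) * (x 0 * y 1 + x 1 * y 0) +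
    (partialV (partialV h) (e 0) (e 1) : ℂ) * (x 1 * y 1))

/-- One component of `(1/6) (I ⊗ zᵀ) T_e (x ⊗ y)`: a sixth of the third differential of `h`. -/
def cubicForm (h : ℝ → ℝ → ℝ) (e : Fin 2 → ℝ) (x y z : Fin 2 → ℂ) : ℂ :=
  (1 / 6) * ((partialU (partialU (partialU h)) (e 0) (e 1) : ℂ) * (x 0 * y 0 * z 0) +
    (partialV (partialU (partialU h)) (e 0) (e 1) : ℂ) *
      (x 0 * y 0 * z 1 + x 0 * y 1 * z 0 + x 1 * y 0 * z 0) +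
    (partialV (partialV (partialU h)) (e 0) (e 1) : ℂ) *
      (x 0 * y 1 * z 1 + x 1 * y 0 * z 1 + x 1 * y 1 * z 0) +
    (partialV (partialV (partialV h)) (e 0) (e 1) : ℂ) * (x 1 * y 1 * z 1))

/-- The bilinear form `B(x, y)`. -/
def Params.B (e : Fin 2 → ℝ) (x y : Fin 2 → ℂ) : Fin 2 → ℂ :=
  ![quadForm P.f e x y, quadForm P.g e x y]

/-- The trilinear form `C(x, y, z)`. -/
def Params.C (e : Fin 2 → ℝ) (x y z : Fin 2 → ℂ) : Fin 2 → ℂ :=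
  ![cubicForm P.f e x y z, cubicForm P.g e x y z]

/-! ### States, the linearized operator and its adjoint -/

/-- A (complex) state `W = (U, V, u, v)`. The bulk components are functions on the plane `ℂ = ℝ²`,
of which only the values on the closed disk matter; the surface components are functions of the
polar angle `θ`. -/
abbrev State := (ℂ → ℂ) × (ℂ → ℂ) × (ℝ → ℂ) × (ℝ → ℂ)

/-- Bulk component `U`. -/
abbrev State.U (W : State) : ℂ → ℂ := W.1

/-- Bulk component `V`. -/
abbrev State.V (W : State) : ℂ → ℂ := W.2.1

/-- Surface component `u`. -/
abbrev State.u (W : State) : ℝ → ℂ := W.2.2.1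

/-- Surface component `v`. -/
abbrev State.v (W : State) : ℝ → ℂ := W.2.2.2

/-- The surface vector `(u(θ), v(θ))`. -/
def State.surf (W : State) (θ : ℝ) : Fin 2 → ℂ := ![W.u θ, W.v θ]

/-- The point with polar coordinates `(r, θ)`. -/
def polar (r θ : ℝ) : ℂ := r * exp (θ * I)

/-- The outward radial derivative `∂_r U` at the boundary point with angle `θ`, taken from inside
the disk. -/
def Params.radialDeriv (U : ℂ → ℂ) (θ : ℝ) : ℂ :=
  derivWithin (fun r : ℝ => U (polar r θ)) (Set.Icc 0 P.R) P.R

/-- Classical regularity: bulk components `C²` inside and `C¹` up to the boundary, surface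
components `C²` and `2π`-periodic. -/
structure Params.Regular (W : State) : Prop where
  U_inside : ContDiffOn ℝ 2 W.U (Metric.ball 0 P.R)
  U_closed : ContDiffOn ℝ 1 W.U (Metric.closedBall 0 P.R)
  V_inside : ContDiffOn ℝ 2 W.V (Metric.ball 0 P.R)
  V_closed : ContDiffOn ℝ 1 W.V (Metric.closedBall 0 P.R)
  u_smooth : ContDiff ℝ 2 W.u
  v_smooth : ContDiff ℝ 2 W.v
  u_periodic : Function.Periodic W.u (2 * Real.pi)
  v_periodic : Function.Periodic W.v (2 * Real.pi)

/-- The linearization `𝓛` at the base state, with Jacobian entries taken from `J`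
(`J = J_e` for `𝓛`, and `J = J_eᵀ` for the adjoint operator `𝓛*`). -/
def Params.linOpOf (J : Matrix (Fin 2) (Fin 2) ℂ) (W : State) : State :=
  (fun z => P.Du * Laplacian.laplacian W.U z - P.σu * W.U z,
   fun z => P.Dv * Laplacian.laplacian W.V z - P.σv * W.V z,
   fun θ => P.du / (P.R : ℂ) ^ 2 * iteratedDeriv 2 W.u θ - P.Ku * (W.u θ - W.U (polar P.R θ))
     + J 0 0 * W.u θ + J 0 1 * W.v θ,
   fun θ => P.dv / (P.R : ℂ) ^ 2 * iteratedDeriv 2 W.v θ - P.Kv * (W.v θ - W.V (polar P.R θ))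
     + J 1 0 * W.u θ + J 1 1 * W.v θ)

/-- The linearized operator `𝓛(μ₀; ·)`. -/
def Params.linOp (e : Fin 2 → ℝ) (W : State) : State := P.linOpOf (P.jac e) W

/-- The adjoint operator `𝓛*(μ₀; ·)`. -/
def Params.adjOp (e : Fin 2 → ℝ) (W : State) : State := P.linOpOf (P.jac e)ᵀ W

/-- Equality of two states as functions on the open disk and on the circle. -/
def Params.EqOnDisk (W W' : State) : Prop :=
  (∀ z ∈ Metric.ball (0 : ℂ) P.R, W.U z = W'.U z ∧ W.V z = W'.V z) ∧
    ∀ θ : ℝ, W.u θ = W'.u θ ∧ W.v θ = W'.v θ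

/-- The inhomogeneous Langmuir boundary conditions
`D_u ∂_r U = K_u (u - U)`, `D_v ∂_r V = K_v (v - V) + η` at `r = R`. -/
def Params.Langmuir (W : State) (η : ℝ → ℂ) : Prop :=
  ∀ θ : ℝ, P.Du * P.radialDeriv W.U θ = P.Ku * (W.u θ - W.U (polar P.R θ)) ∧
    P.Dv * P.radialDeriv W.V θ = P.Kv * (W.v θ - W.V (polar P.R θ)) + η θ

/-- `X` is a classical solution of `λ X - 𝓛(μ₀; X) = F` subject to the Langmuir boundary
conditions with boundary data `(0, η)`. -/
structure Params.Solves (e : Fin 2 → ℝ) (lam : ℂ) (X F : State) (η : ℝ → ℂ) : Prop where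
  regular : P.Regular X
  equation : P.EqOnDisk (lam • X - P.linOp e X) F
  boundary : P.Langmuir X η

/-- `W` is a classical function with `𝓛*(μ₀; W) = ν W` satisfying the (self-adjoint) homogeneous
Langmuir boundary conditions. -/
structure Params.IsAdjointEigen (e : Fin 2 → ℝ) (ν : ℂ) (W : State) : Prop where
  regular : P.Regular W
  equation : P.EqOnDisk (P.adjOp e W) (ν • W)
  boundary : P.Langmuir W 0

/-- The inner product `⟨W*, W⟩`, conjugate-linear in the first argument. -/
def Params.inner (Ws W : State) : ℂ :=
  (∫ θ in (0 : ℝ)..(2 * Real.pi), ∫ r in (0 : ℝ)..P.R,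
    (conj (Ws.U (polar r θ)) * W.U (polar r θ) + conj (Ws.V (polar r θ)) * W.V (polar r θ)) * r) +
  ∫ θ in (0 : ℝ)..(2 * Real.pi), (conj (Ws.u θ) * W.u θ + conj (Ws.v θ) * W.v θ) * P.R

/-- The eigenfunction `𝓦_n` with surface vector `φ e^{inθ}` at the eigenvalue `λ`. -/
def Params.mode (n : ℤ) (lam : ℂ) (φ : Fin 2 → ℂ) : State :=
  (fun z => P.coefA n lam * (besselI n (P.Ωu lam * ‖z‖) / besselI n (P.Ωu lam * P.R)) * φ 0 *
     exp (n * arg z * I),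
   fun z => P.coefB n lam * (besselI n (P.Ωv lam * ‖z‖) / besselI n (P.Ωv lam * P.R)) * φ 1 *
     exp (n * arg z * I),
   fun θ => φ 0 * exp (n * θ * I),
   fun θ => φ 1 * exp (n * θ * I))

/-- The adjoint eigenfunction `𝓦_n*` with surface vector `φ* e^{inθ}`. -/
def Params.adjMode (n : ℤ) (lam : ℂ) (φs : Fin 2 → ℂ) : State :=
  (fun z => conj (P.coefA n lam) *
     (besselI n (conj (P.Ωu lam) * ‖z‖) / besselI n (conj (P.Ωu lam) * P.R)) * φs 0 *
     exp (n * arg z * I),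
   fun z => conj (P.coefB n lam) *
     (besselI n (conj (P.Ωv lam) * ‖z‖) / besselI n (conj (P.Ωv lam) * P.R)) * φs 1 *
     exp (n * arg z * I),
   fun θ => φs 0 * exp (n * θ * I),
   fun θ => φs 1 * exp (n * θ * I))

/-- `φ` spans a kernel direction of `Φ_n(λ)` and `φ*` one of its adjoint, normalized so that
`⟨𝓦_n*, 𝓦_n⟩ = 1`. -/
structure Params.CriticalPair (e : Fin 2 → ℝ) (n : ℤ) (lam : ℂ) (φ φs : Fin 2 → ℂ) : Prop where
  kernel : P.Phi e n lam *ᵥ φ = 0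
  adjoint_kernel : (P.Phi e n lam)ᴴ *ᵥ φs = 0
  normalized : P.inner (P.adjMode n lam φs) (P.mode n lam φ) = 1

/-- The embedding of real vectors into complex vectors. -/
def toC (x : Fin 2 → ℝ) : Fin 2 → ℂ := fun i => (x i : ℂ)

/-- The base state `W_e`; it has the shape of a radial mode at `λ = 0` with surface vector `e`. -/
def Params.baseState (e : Fin 2 → ℝ) : State := P.mode 0 0 (toC e)

/-! ### The problems at second and third order of the expansion -/

/-- The bilinear form `𝓑(W, W') = (0, 0, B(u, u'))` on states. -/
def Params.bilin (e : Fin 2 → ℝ) (W W' : State) : State :=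
  (0, 0, fun θ => P.B e (W.surf θ) (W'.surf θ) 0, fun θ => P.B e (W.surf θ) (W'.surf θ) 1)

/-- The trilinear form `𝓒(W, W', W'') = (0, 0, C(u, u', u''))` on states. -/
def Params.trilin (e : Fin 2 → ℝ) (W W' W'' : State) : State :=
  (0, 0, fun θ => P.C e (W.surf θ) (W'.surf θ) (W''.surf θ) 0,
    fun θ => P.C e (W.surf θ) (W'.surf θ) (W''.surf θ) 1)

/-- The product `aᵀ μ₁`, where `μ₁ = (μ₁ 0, μ₁ 1)` is the perturbation of `(K_v, D_v)`. -/
def pair (a : Fin 2 → ℂ) (μ₁ : Fin 2 → ℝ) : ℂ := a 0 * μ₁ 0 + a 1 * μ₁ 1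

/-- `β = (1, - K_v / D_v)`. -/
def Params.β : Fin 2 → ℂ := ![1, -(P.Kv / P.Dv)]

/-- The forcing `(0, e₂ᵀμ₁ (∂_t V + σ_v V) / D_v, 0, - e₁ᵀμ₁ (v - V|_{r=R}))` that the perturbation
`μ₁` of `(K_v, D_v)` produces from `W`; here `Wt` is the derivative of `W` in the fast time `t`. -/
def Params.detuning (μ₁ : Fin 2 → ℝ) (Wt W : State) : State :=
  (0, fun z => μ₁ 1 * ((Wt.V z + P.σv * W.V z) / P.Dv),
   0, fun θ => -(μ₁ 0 * (W.v θ - W.V (polar P.R θ))))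

/-- The boundary forcing `βᵀμ₁ (v - V|_{r=R})` that the perturbation `μ₁` produces from `W`. -/
def Params.detuningFlux (μ₁ : Fin 2 → ℝ) (W : State) : ℝ → ℂ :=
  fun θ => pair P.β μ₁ * (W.v θ - W.V (polar P.R θ))

/-- The componentwise derivative at `s` of a curve of states. -/
def stateDeriv (W : ℝ → State) (s : ℝ) : State :=
  (fun z => deriv (fun x => (W x).U z) s, fun z => deriv (fun x => (W x).V z) s,
   fun θ => deriv (fun x => (W x).u θ) s, fun θ => deriv (fun x => (W x).v θ) s)

/-- The right-hand side of the third-order problem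
`∂_t W₃ - 𝓛 W₃ = - ∂_τ W₁ + 2 𝓑(W₁, W₂) + 𝓒(W₁, W₁, W₁) + (detuning of W₁)`,
where `W₁, W₂` are functions of the slow time `τ` and the fast time `t`. -/
def Params.thirdForcing (e : Fin 2 → ℝ) (μ₁ : Fin 2 → ℝ) (W₁ W₂ : ℝ → ℝ → State) (τ t : ℝ) :
    State :=
  -stateDeriv (fun s => W₁ s t) τ + (2 : ℂ) • P.bilin e (W₁ τ t) (W₂ τ t)
    + P.trilin e (W₁ τ t) (W₁ τ t) (W₁ τ t) + P.detuning μ₁ (stateDeriv (W₁ τ) t) (W₁ τ t)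

/-- The coefficient of `e^{i k ω t}` of a `2π/ω`-periodic function of `t`. -/
def harmonic (ω : ℝ) (k : ℤ) (h : ℝ → ℂ) : ℂ :=
  (ω / (2 * Real.pi) : ℝ) * ∫ t in (0 : ℝ)..(2 * Real.pi / ω), h t * exp (-(k * ω * t * I))

/-- The coefficient of `e^{i k ω t}` of a time-periodic state. -/
def stateHarmonic (ω : ℝ) (k : ℤ) (W : ℝ → State) : State :=
  (fun z => harmonic ω k (fun t => (W t).U z), fun z => harmonic ω k (fun t => (W t).V z),
   fun θ => harmonic ω k (fun t => (W t).u θ), fun θ => harmonic ω k (fun t => (W t).v θ))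

/-- The first-order Hopf solution `𝓦₀ A₀ e^{iωt} + c.c.` -/
def Params.hopfFirst (ω : ℝ) (φ₀ : Fin 2 → ℂ) (A₀ : ℝ → ℂ) (τ t : ℝ) : State :=
  (A₀ τ * exp (ω * t * I)) • P.mode 0 (ω * I) φ₀ +
    (conj (A₀ τ) * exp (-(ω * t * I))) • star (P.mode 0 (ω * I) φ₀)

/-- The first-order pitchfork solution `𝓦_n A_n + 𝓦_{-n} conj A_n`. -/
def Params.pitchforkFirst (n : ℤ) (φn : Fin 2 → ℂ) (An : ℝ → ℂ) (τ : ℝ) : State :=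
  An τ • P.mode n 0 φn + conj (An τ) • P.mode (-n) 0 φn

/-- The amplitude-dependent part of the second-order solution at a Hopf point. -/
def hopfSecond (ω : ℝ) (W2000 W1100 : State) (A₀ : ℝ → ℂ) (τ t : ℝ) : State :=
  (A₀ τ ^ 2 * exp (2 * ω * t * I)) • W2000 + ((‖A₀ τ‖ : ℂ) ^ 2) • W1100 +
    (conj (A₀ τ) ^ 2 * exp (-(2 * ω * t * I))) • star W2000

/-- The amplitude-dependent part of the second-order solution at a pitchfork point. -/
def pitchforkSecond (W0020 W0011 : State) (An : ℝ → ℂ) (τ : ℝ) : State :=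
  (An τ ^ 2) • W0020 + ((‖An τ‖ : ℂ) ^ 2) • W0011 + (conj (An τ) ^ 2) • star W0020

/-- The mixed part of the second-order solution at a pitchfork-Hopf point
(`W0110 = star W1001`, `W0101 = star W1010`). -/
def mixedSecond (ω : ℝ) (W1010 W1001 : State) (A₀ An : ℝ → ℂ) (τ t : ℝ) : State :=
  (A₀ τ * An τ * exp (ω * t * I)) • W1010 + (A₀ τ * conj (An τ) * exp (ω * t * I)) • W1001 +
    (conj (A₀ τ) * An τ * exp (-(ω * t * I))) • star W1001 +
    (conj (A₀ τ) * conj (An τ) * exp (-(ω * t * I))) • star W1010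

/-- `W0000`: the second-order correction of the base state caused by the perturbation `μ₁`. -/
def Params.IsBaseCorrection (e : Fin 2 → ℝ) (μ₁ : Fin 2 → ℝ) (W0000 : State) : Prop :=
  P.Solves e 0 W0000 (P.detuning μ₁ 0 (P.baseState e)) (P.detuningFlux μ₁ (P.baseState e))

/-- `W2000` and `W1100`: the second-order harmonics generated by the Hopf mode. -/
def Params.IsHopfSecond (e : Fin 2 → ℝ) (ω : ℝ) (φ₀ : Fin 2 → ℂ) (W2000 W1100 : State) : Prop :=
  P.Solves e (2 * (ω * I)) W2000 (P.bilin e (P.mode 0 (ω * I) φ₀) (P.mode 0 (ω * I) φ₀)) 0 ∧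
  P.Solves e 0 W1100
    ((2 : ℂ) • P.bilin e (P.mode 0 (ω * I) φ₀) (star (P.mode 0 (ω * I) φ₀))) 0

/-- `W0020` and `W0011`: the second-order harmonics generated by the modes `±n`. -/
def Params.IsPitchforkSecond (e : Fin 2 → ℝ) (n : ℤ) (φn : Fin 2 → ℂ) (W0020 W0011 : State) :
    Prop :=
  P.Solves e 0 W0020 (P.bilin e (P.mode n 0 φn) (P.mode n 0 φn)) 0 ∧
  P.Solves e 0 W0011 ((2 : ℂ) • P.bilin e (P.mode n 0 φn) (P.mode (-n) 0 φn)) 0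

/-- `W1010` and `W1001`: the second-order harmonics generated by the interaction of the Hopf mode
with the modes `n` and `-n`. -/
def Params.IsMixedSecond (e : Fin 2 → ℝ) (ω : ℝ) (n : ℤ) (φ₀ φn : Fin 2 → ℂ)
    (W1010 W1001 : State) : Prop :=
  P.Solves e (ω * I) W1010 ((2 : ℂ) • P.bilin e (P.mode 0 (ω * I) φ₀) (P.mode n 0 φn)) 0 ∧
  P.Solves e (ω * I) W1001 ((2 : ℂ) • P.bilin e (P.mode 0 (ω * I) φ₀) (P.mode (-n) 0 φn)) 0

/-! ### Explicit coefficients -/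

/-- `α = q₀(0)² e₁ + ω_v K_v² / (D_v ω_v I₁ + K_v I₀)² · (I₀ I₁ + ω_v R / 2 · (I₁² - I₀²)) e₂`,
with the Bessel functions evaluated at `ω_v R`. -/
def Params.α : Fin 2 → ℂ :=
  let w := P.Ωv 0
  let I0 := besselI 0 (w * P.R)
  let I1 := besselI 1 (w * P.R)
  ![P.q 0 0 ^ 2,
    w * P.Kv ^ 2 / (P.Dv * w * I1 + P.Kv * I0) ^ 2 *
      (I0 * I1 + w * P.R / 2 * (I1 ^ 2 - I0 ^ 2))]

/-- `ũ₀₀₀₀ = Φ₀(0)⁻¹ E₂ e`. -/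
def Params.u0000 (e : Fin 2 → ℝ) : Fin 2 → ℂ := (P.Phi e 0 0)⁻¹ *ᵥ ![0, (e 1 : ℂ)]

/-- `u₂₀₀₀ = - Φ₀(2iω)⁻¹ B(φ₀, φ₀)`. -/
def Params.u2000 (e : Fin 2 → ℝ) (ω : ℝ) (φ₀ : Fin 2 → ℂ) : Fin 2 → ℂ :=
  -((P.Phi e 0 (2 * (ω * I)))⁻¹ *ᵥ P.B e φ₀ φ₀)

/-- `u₁₁₀₀ = - 2 Φ₀(0)⁻¹ B(φ₀, conj φ₀)`. -/
def Params.u1100 (e : Fin 2 → ℝ) (φ₀ : Fin 2 → ℂ) : Fin 2 → ℂ :=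
  -((2 : ℂ) • ((P.Phi e 0 0)⁻¹ *ᵥ P.B e φ₀ (star φ₀)))

/-- `u₀₀₂₀ = - Φ_{2n}(0)⁻¹ B(φ_n, φ_n)`. -/
def Params.u0020 (e : Fin 2 → ℝ) (n : ℤ) (φn : Fin 2 → ℂ) : Fin 2 → ℂ :=
  -((P.Phi e (2 * n) 0)⁻¹ *ᵥ P.B e φn φn)

/-- `u₀₀₁₁ = - 2 Φ₀(0)⁻¹ B(φ_n, φ_n)` (recall `φ_{-n} = φ_n`). -/
def Params.u0011 (e : Fin 2 → ℝ) (φn : Fin 2 → ℂ) : Fin 2 → ℂ :=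
  -((2 : ℂ) • ((P.Phi e 0 0)⁻¹ *ᵥ P.B e φn φn))

/-- `u₁₀₁₀ = u₁₀₀₁ = - 2 Φ_n(iω)⁻¹ B(φ₀, φ_n)`. -/
def Params.u1010 (e : Fin 2 → ℝ) (ω : ℝ) (n : ℤ) (φ₀ φn : Fin 2 → ℂ) : Fin 2 → ℂ :=
  -((2 : ℂ) • ((P.Phi e n (ω * I))⁻¹ *ᵥ P.B e φ₀ φn))

/-- `B_n(λ)² Ω_v² (R / 2) (1 - I_{n-1}(Ω_v R) I_{n+1}(Ω_v R) / I_n(Ω_v R)²)`; for `n = 0` the last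
quotient is `(I₁ / I₀)²`. -/
def Params.bulkWeight (n : ℤ) (lam : ℂ) : ℂ :=
  P.coefB n lam ^ 2 * P.Ωv lam ^ 2 * (P.R / 2) *
    (1 - besselI (n - 1) (P.Ωv lam * P.R) * besselI (n + 1) (P.Ωv lam * P.R) /
      besselI n (P.Ωv lam * P.R) ^ 2)

/-- The vector of linear coefficients: `g₁₀₀₀` for `n = 0`, `λ = iω`, and `g₀₀₁₀` for the modes
`±n`, `λ = 0`:
`2πR φ*₂ φ₂ (B_n q_n β + (bulk weight) e₂ - q_n e₁) + 4πR φ*ᵀ B(φ, ũ₀₀₀₀) α`,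
with the complex conjugate of `φ*`. -/
def Params.gLinear (e : Fin 2 → ℝ) (n : ℤ) (lam : ℂ) (φ φs : Fin 2 → ℂ) : Fin 2 → ℂ :=
  (2 * Real.pi * P.R * conj (φs 1) * φ 1 : ℂ) •
      ((P.coefB n lam * P.q n lam) • P.β + P.bulkWeight n lam • ![0, 1] - P.q n lam • ![1, 0]) +
    (4 * Real.pi * P.R * (star φs ⬝ᵥ P.B e φ (P.u0000 e)) : ℂ) • P.α

/-- `g₂₁₀₀`. -/
def Params.g2100 (e : Fin 2 → ℝ) (ω : ℝ) (φ₀ φ₀s : Fin 2 → ℂ) : ℂ :=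
  2 * Real.pi * P.R * (star φ₀s ⬝ᵥ ((2 : ℂ) • P.B e φ₀ (P.u1100 e φ₀) +
    (2 : ℂ) • P.B e (star φ₀) (P.u2000 e ω φ₀) + (3 : ℂ) • P.C e φ₀ φ₀ (star φ₀)))

/-- `g₁₀₁₁`. -/
def Params.g1011 (e : Fin 2 → ℝ) (ω : ℝ) (n : ℤ) (φ₀ φ₀s φn : Fin 2 → ℂ) : ℂ :=
  2 * Real.pi * P.R * (star φ₀s ⬝ᵥ ((2 : ℂ) • P.B e φ₀ (P.u0011 e φn) +
    (2 : ℂ) • P.B e φn (P.u1010 e ω n φ₀ φn) + (2 : ℂ) • P.B e φn (P.u1010 e ω n φ₀ φn) +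
    (6 : ℂ) • P.C e φ₀ φn φn))

/-- `g₀₀₂₁`. -/
def Params.g0021 (e : Fin 2 → ℝ) (n : ℤ) (φn φns : Fin 2 → ℂ) : ℂ :=
  2 * Real.pi * P.R * (star φns ⬝ᵥ ((2 : ℂ) • P.B e φn (P.u0011 e φn) +
    (2 : ℂ) • P.B e φn (P.u0020 e n φn) + (3 : ℂ) • P.C e φn φn φn))

/-- `g₁₁₁₀`. -/
def Params.g1110 (e : Fin 2 → ℝ) (ω : ℝ) (n : ℤ) (φ₀ φn φns : Fin 2 → ℂ) : ℂ :=
  2 * Real.pi * P.R * (star φns ⬝ᵥ ((2 : ℂ) • P.B e φn (P.u1100 e φ₀) +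
    (2 : ℂ) • P.B e φ₀ (star (P.u1010 e ω n φ₀ φn)) +
    (2 : ℂ) • P.B e (star φ₀) (P.u1010 e ω n φ₀ φn) + (6 : ℂ) • P.C e φ₀ (star φ₀) φn))

/-! ### The coefficients as inner products with the adjoint eigenfunctions -/

/-- `⟨𝓦₀*, 2𝓑(𝓦₀, W1100) + 2𝓑(conj 𝓦₀, W2000) + 3𝓒(𝓦₀, 𝓦₀, conj 𝓦₀)⟩`. -/
def Params.hopfCubic (e : Fin 2 → ℝ) (W₀s W₀ W2000 W1100 : State) : ℂ :=
  P.inner W₀s ((2 : ℂ) • P.bilin e W₀ W1100 + (2 : ℂ) • P.bilin e (star W₀) W2000 +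
    (3 : ℂ) • P.trilin e W₀ W₀ (star W₀))

/-- `⟨𝓦_n*, 2𝓑(𝓦_n, W0011) + 2𝓑(𝓦_{-n}, W0020) + 3𝓒(𝓦_n, 𝓦_n, 𝓦_{-n})⟩`. -/
def Params.pitchforkCubic (e : Fin 2 → ℝ) (Wns Wn Wm W0020 W0011 : State) : ℂ :=
  P.inner Wns ((2 : ℂ) • P.bilin e Wn W0011 + (2 : ℂ) • P.bilin e Wm W0020 +
    (3 : ℂ) • P.trilin e Wn Wn Wm)

/-- `⟨𝓦₀*, 2𝓑(𝓦₀, W0011) + 2𝓑(𝓦_n, W1001) + 2𝓑(𝓦_{-n}, W1010) + 6𝓒(𝓦₀, 𝓦_n, 𝓦_{-n})⟩`. -/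
def Params.hopfMixed (e : Fin 2 → ℝ) (W₀s W₀ Wn Wm W0011 W1010 W1001 : State) : ℂ :=
  P.inner W₀s ((2 : ℂ) • P.bilin e W₀ W0011 + (2 : ℂ) • P.bilin e Wn W1001 +
    (2 : ℂ) • P.bilin e Wm W1010 + (6 : ℂ) • P.trilin e W₀ Wn Wm)

/-- `⟨𝓦_n*, 2𝓑(𝓦_n, W1100) + 2𝓑(𝓦₀, W0110) + 2𝓑(conj 𝓦₀, W1010) + 6𝓒(𝓦₀, conj 𝓦₀, 𝓦_n)⟩`. -/
def Params.pitchforkMixed (e : Fin 2 → ℝ) (Wns W₀ Wn W1100 W1010 W0110 : State) : ℂ :=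
  P.inner Wns ((2 : ℂ) • P.bilin e Wn W1100 + (2 : ℂ) • P.bilin e W₀ W0110 +
    (2 : ℂ) • P.bilin e (star W₀) W1010 + (6 : ℂ) • P.trilin e W₀ (star W₀) Wn)

/-- The solvability condition of the third-order problem, with amplitude `A`, its slow derivative
`A'`, and the cubic terms collected in `N`:
`- 2πR B_n q_n φ*₂ φ₂ βᵀμ₁ A = - A' + 2⟨𝓦_n*, 𝓑(𝓦_n, W0000)⟩ A
  + 2πR φ*₂ φ₂ ((bulk weight) e₂ᵀμ₁ - q_n e₁ᵀμ₁) A + N`,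
with the complex conjugate of `φ*`. -/
def Params.SolvabilityCondition (e : Fin 2 → ℝ) (μ₁ : Fin 2 → ℝ) (n : ℤ) (lam : ℂ)
    (φ φs : Fin 2 → ℂ) (W0000 : State) (A A' N : ℂ) : Prop :=
  -(2 * Real.pi * P.R * P.coefB n lam * P.q n lam * conj (φs 1) * φ 1 * pair P.β μ₁ * A) =
    -A' + 2 * P.inner (P.adjMode n lam φs) (P.bilin e (P.mode n lam φ) W0000) * A +
    2 * Real.pi * P.R * conj (φs 1) * φ 1 *
      (P.bulkWeight n lam * μ₁ 1 - P.q n lam * μ₁ 0) * A + N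

end BulkSurface

end

open BulkSurface

noncomputable section

namespace BulkSurface

open Complex Matrix ComplexConjugate

/-! ### The entire function behind the Bessel functions -/

/-! The theorem is a Fredholm solvability computation in which the pairing with the adjoint modes is
made explicit one angular Fourier mode at a time. Fix λ with Re λ ≥ 0 and an index n. Projected on
e^{inθ}, each bulk equation becomes a radial ODE whose homogeneous regular solution is y = `prof |n|
κ`, with κ = (λ + σ)/D. Green's identity against y (`bulk_green`) converts the bulk forcing into
boundary data, and the Robin condition removes the normal derivative (`resp_balance`,
`bulk_projection`). The remaining unknown, the trace of the bulk field, cancels against the surface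
equations. What is left is a 2×2 relation: for every classical solution X of λX - 𝓛X = F with flux
η, and every vector φ*, ⟨𝓦_n*, F⟩ + R B_n conj(φ*_2) η̂_n = -R (conj φ*)ᵀ Φ_n(λ) X̂_n, where hats
are unnormalised Fourier integrals over the circle (`Params.Solves.pairing`).

This relation is used twice. At second order Φ is invertible at the Fourier modes that matter, so it
determines the surface Fourier integrals of the second-order fields (`Params.Solves.fvec_bilin`,
`fvec_baseCorrection`). Those fields need not be unique: modes with singular Φ stay undetermined,
but they never enter the amplitude equations. At third order φ* lies in the kernel of the adjoint
matrix, the right side vanishes, and the left side is the solvability equation (`solvability`); the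
normalization of the critical pair makes the coefficient of dA/dτ equal to -1.

Two analytic facts about y are needed. First, y(R) and the Robin denominators do not vanish for
complex κ with Re κ > 0; this follows from an energy identity for the flux (`hasDerivAt_hyp_flux`,
`re_conj_prof_mul_profDeriv_pos`). Second, ∫ r y² dr has an elementary antiderivative
(`integral_prof_sq`), which together with the Bessel recurrences yields the closed form of the bulk
weight.

The rest is algebra of frequencies and wave numbers. The third-order forcing is a trigonometric
polynomial in t (`thirdForcing_harmonics`); multiplication by a mode shifts the Fourier index; and
`fvec_nonlinOne` and `fvec_nonlinZero` record which products reach the critical mode. The steady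
coefficients are real because conjugation fixes every ingredient at λ = 0. -/

/-- The entire function `∑ w ^ k / (k! (k + m)!)`, so that `I_m(z) = (z / 2) ^ m hyp m (z² / 4)`. -/
def hyp (m : ℕ) (w : ℂ) : ℂ :=
  ∑' k : ℕ, w ^ k / ((k.factorial : ℂ) * ((k + m).factorial : ℂ))

theorem norm_hyp_term_le (m k : ℕ) (c : ℂ) :
    ‖c / ((k.factorial : ℂ) * ((k + m).factorial : ℂ))‖ ≤ ‖c‖ / k.factorial := by
  rw [norm_div, norm_mul, Complex.norm_natCast, Complex.norm_natCast]
  have h1 : (0 : ℝ) < k.factorial := by exact_mod_cast k.factorial_pos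
  have h2 : (1 : ℝ) ≤ (k + m).factorial := by exact_mod_cast (k + m).factorial_pos
  gcongr
  nlinarith

theorem summable_hyp (m : ℕ) (w : ℂ) :
    Summable fun k : ℕ => w ^ k / ((k.factorial : ℂ) * ((k + m).factorial : ℂ)) := by
  refine Summable.of_norm_bounded (Real.summable_pow_div_factorial ‖w‖) fun k => ?_
  simpa using norm_hyp_term_le m k (w ^ k)

theorem hyp_zero (m : ℕ) : hyp m 0 = 1 / (m.factorial : ℂ) := by
  rw [hyp, tsum_eq_single 0]
  · simp
  · intro k hk
    simp [hk]

/-- Differentiating w^k/(k!(k+m)!) cancels a factor k, and (k+m)! = ((k-1)+(m+1))!, so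
differentiation just raises the index. -/
theorem hasDerivAt_hyp (m : ℕ) (w : ℂ) : HasDerivAt (hyp m) (hyp (m + 1) w) w := by
  -- The slack 1 puts w inside the open ball of radius M, on which the differentiated terms are
  -- dominated by k M^(k-1)/k!.
  set M : ℝ := ‖w‖ + 1 with hM
  have hM0 : 0 ≤ M := by positivity
  have hu : Summable fun k : ℕ => (k : ℝ) * M ^ (k - 1) / k.factorial := by
    rw [← summable_nat_add_iff 1]
    refine (Real.summable_pow_div_factorial M).congr fun k => ?_
    rw [Nat.factorial_succ]
    push_cast
    have : (k.factorial : ℝ) ≠ 0 := by exact_mod_cast k.factorial_ne_zero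
    have : (k : ℝ) + 1 ≠ 0 := by positivity
    field_simp
  have hd := hasDerivAt_tsum_of_isPreconnected (𝕜 := ℂ) (t := Metric.ball (0 : ℂ) M) (y₀ := 0)
    (g := fun (k : ℕ) (w : ℂ) => w ^ k / ((k.factorial : ℂ) * ((k + m).factorial : ℂ)))
    (g' := fun (k : ℕ) (w : ℂ) =>
      ((k : ℂ) * w ^ (k - 1)) / ((k.factorial : ℂ) * ((k + m).factorial : ℂ)))
    (y := w) hu Metric.isOpen_ball (convex_ball _ _).isPreconnected
    (fun k y _ => (hasDerivAt_pow k y).div_const _)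
    (fun k y hy => by
      refine (norm_hyp_term_le m k _).trans ?_
      have : ‖y‖ ≤ M := by simpa using (Metric.mem_ball.1 hy).le
      rw [norm_mul, Complex.norm_natCast, norm_pow]
      gcongr)
    (Metric.mem_ball_self (by positivity)) (summable_hyp m 0)
    (by simp [hM])
  have hd' : HasDerivAt (hyp m) _ w := hd
  refine hd'.congr_deriv (Eq.symm ?_)
  rw [hyp, tsum_eq_zero_add' (f := fun k : ℕ =>
    ((k : ℂ) * w ^ (k - 1)) / ((k.factorial : ℂ) * ((k + m).factorial : ℂ)))]
  · simp only [Nat.cast_zero, zero_mul, zero_div, zero_add]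
    refine tsum_congr fun k => ?_
    rw [Nat.factorial_succ, show k + 1 + m = k + (m + 1) by ring]
    have h1 : (k.factorial : ℂ) ≠ 0 := by exact_mod_cast k.factorial_ne_zero
    have h2 : (k : ℂ) + 1 ≠ 0 := by exact_mod_cast k.succ_ne_zero
    have h3 : ((k + (m + 1)).factorial : ℂ) ≠ 0 := by exact_mod_cast Nat.factorial_ne_zero _
    push_cast
    field_simp
  · refine (summable_hyp (m + 1) w).congr fun k => ?_
    rw [Nat.factorial_succ, show k + 1 + m = k + (m + 1) by ring]
    have h1 : (k.factorial : ℂ) ≠ 0 := by exact_mod_cast k.factorial_ne_zero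
    have h2 : (k : ℂ) + 1 ≠ 0 := by exact_mod_cast k.succ_ne_zero
    have h3 : ((k + (m + 1)).factorial : ℂ) ≠ 0 := by exact_mod_cast Nat.factorial_ne_zero _
    push_cast
    field_simp

/-- Compare coefficients: 1/(k!(k+m)!) = (k+m+1)/(k!(k+m+1)!), with k+m+1 split as (m+1) + k.
Combined with `hasDerivAt_hyp` this is w h'' + (m+1) h' = h, the form in which Bessel's equation
enters. -/
theorem hyp_recurrence (m : ℕ) (w : ℂ) :
    hyp m w = (m + 1) * hyp (m + 1) w + w * hyp (m + 2) w := by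
  have e1 : w * hyp (m + 2) w = ∑' k : ℕ, (k : ℂ) * w ^ k /
      ((k.factorial : ℂ) * ((k + (m + 1)).factorial : ℂ)) := by
    have key : ∀ k : ℕ, w * (w ^ k / ((k.factorial : ℂ) * ((k + (m + 2)).factorial : ℂ))) =
        ((k + 1 : ℕ) : ℂ) * w ^ (k + 1) /
          (((k + 1).factorial : ℂ) * ((k + 1 + (m + 1)).factorial : ℂ)) := by
      intro k
      rw [Nat.factorial_succ, show k + 1 + (m + 1) = k + (m + 2) by ring]
      have h1 : (k.factorial : ℂ) ≠ 0 := by exact_mod_cast k.factorial_ne_zero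
      have h2 : (k : ℂ) + 1 ≠ 0 := by exact_mod_cast k.succ_ne_zero
      have h3 : ((k + (m + 2)).factorial : ℂ) ≠ 0 := by exact_mod_cast Nat.factorial_ne_zero _
      push_cast
      field_simp
      ring
    rw [hyp, ← tsum_mul_left, tsum_eq_zero_add' (f := fun k : ℕ => (k : ℂ) * w ^ k /
      ((k.factorial : ℂ) * ((k + (m + 1)).factorial : ℂ)))]
    · simp only [Nat.cast_zero, zero_mul, zero_div, zero_add]
      exact tsum_congr key
    · exact ((summable_hyp (m + 2) w).mul_left w).congr key
  have hs : Summable fun k : ℕ => (k : ℂ) * w ^ k /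
      ((k.factorial : ℂ) * ((k + (m + 1)).factorial : ℂ)) := by
    rw [← summable_nat_add_iff 1]
    refine ((summable_hyp (m + 2) w).mul_left w).congr fun k => ?_
    rw [Nat.factorial_succ, show k + 1 + (m + 1) = k + (m + 2) by ring]
    have h1 : (k.factorial : ℂ) ≠ 0 := by exact_mod_cast k.factorial_ne_zero
    have h2 : (k : ℂ) + 1 ≠ 0 := by exact_mod_cast k.succ_ne_zero
    have h3 : ((k + (m + 2)).factorial : ℂ) ≠ 0 := by exact_mod_cast Nat.factorial_ne_zero _
    push_cast
    field_simp
    ring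
  rw [e1]
  conv_rhs => rw [hyp, ← tsum_mul_left]
  rw [← ((summable_hyp (m + 1) w).mul_left _).tsum_add hs, hyp]
  refine tsum_congr fun k => ?_
  rw [show k + (m + 1) = k + m + 1 by ring, Nat.factorial_succ]
  have h1 : (k.factorial : ℂ) ≠ 0 := by exact_mod_cast k.factorial_ne_zero
  have h2 : ((k + m : ℕ) : ℂ) + 1 ≠ 0 := by exact_mod_cast (k + m).succ_ne_zero
  have h3 : ((k + m).factorial : ℂ) ≠ 0 := by exact_mod_cast Nat.factorial_ne_zero _
  push_cast at h2 ⊢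
  field_simp
  ring

theorem conj_hyp (m : ℕ) (w : ℂ) : conj (hyp m w) = hyp m (conj w) := by
  simp [hyp, Complex.conj_tsum]

theorem contDiff_hyp (m : ℕ) {k : WithTop ℕ∞} : ContDiff ℂ k (hyp m) :=
  Differentiable.contDiff fun w => (hasDerivAt_hyp m w).differentiableAt

/-- In `besselI n (Ω * r)` the root Ω survives only in the prefactor (Ω/2)^|n|; the rest depends on
Ω². The prefactor cancels in the response quotients, which therefore depend on κ = Ω² alone. -/
theorem besselI_eq_hyp (n : ℤ) (z : ℂ) :
    besselI n z = (z / 2) ^ n.natAbs * hyp n.natAbs (z ^ 2 / 4) := by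
  rw [besselI, hyp, ← tsum_mul_left]
  refine tsum_congr fun k => ?_
  rw [pow_add, pow_mul, show (z / 2) ^ 2 = z ^ 2 / 4 by ring]
  ring

theorem besselI_neg (n : ℤ) : besselI (-n) = besselI n := by
  funext z
  simp [besselI]

theorem hasDerivAt_besselI (n : ℤ) (z : ℂ) :
    HasDerivAt (besselI n) (n.natAbs / 2 * (z / 2) ^ (n.natAbs - 1) * hyp n.natAbs (z ^ 2 / 4) +
      (z / 2) ^ (n.natAbs + 1) * hyp (n.natAbs + 1) (z ^ 2 / 4)) z := by
  have e : besselI n = fun z => (z / 2) ^ n.natAbs * hyp n.natAbs (z ^ 2 / 4) :=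
    funext (besselI_eq_hyp n)
  rw [e]
  have h1 : HasDerivAt (fun z : ℂ => (z / 2) ^ n.natAbs)
      (n.natAbs * (z / 2) ^ (n.natAbs - 1) * (1 / 2)) z :=
    ((hasDerivAt_id z).div_const 2).pow n.natAbs
  have h2 : HasDerivAt (fun z : ℂ => z ^ 2 / 4) (2 * z / 4) z := by
    simpa using (hasDerivAt_pow 2 z).div_const 4
  refine (h1.mul ((hasDerivAt_hyp n.natAbs (z ^ 2 / 4)).comp z h2)).congr_deriv ?_
  simp only [Function.comp]
  ring

theorem deriv_besselI (n : ℤ) (z : ℂ) :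
    deriv (besselI n) z = n.natAbs / 2 * (z / 2) ^ (n.natAbs - 1) * hyp n.natAbs (z ^ 2 / 4) +
      (z / 2) ^ (n.natAbs + 1) * hyp (n.natAbs + 1) (z ^ 2 / 4) :=
  (hasDerivAt_besselI n z).deriv

theorem conj_besselI (n : ℤ) (z : ℂ) : conj (besselI n z) = besselI n (conj z) := by
  simp [besselI_eq_hyp, conj_hyp, map_ofNat]

/-! ### Radial profiles -/

/-- The solution `r ^ m hyp m (κ r² / 4)` of the radial modified Helmholtz equation. -/
def prof (m : ℕ) (κ : ℂ) (r : ℝ) : ℂ := (r : ℂ) ^ m * hyp m (κ * r ^ 2 / 4)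

/-- `r` times the derivative of `prof m κ`. -/
def profDeriv (m : ℕ) (κ : ℂ) (r : ℝ) : ℂ :=
  (r : ℂ) ^ m * (m * hyp m (κ * r ^ 2 / 4) + κ * r ^ 2 / 2 * hyp (m + 1) (κ * r ^ 2 / 4))

theorem hasDerivAt_hyp_sq (m : ℕ) (κ : ℂ) (r : ℝ) :
    HasDerivAt (fun r : ℝ => hyp m (κ * r ^ 2 / 4))
      (κ * r / 2 * hyp (m + 1) (κ * r ^ 2 / 4)) r := by
  have h2 : HasDerivAt (fun z : ℂ => κ * z ^ 2 / 4) (κ * r / 2) (r : ℂ) := by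
    refine (((hasDerivAt_pow 2 (r : ℂ)).const_mul κ).div_const 4).congr_deriv ?_
    simp
    ring
  have h3 := (HasDerivAt.comp (r : ℂ) (hasDerivAt_hyp m (κ * (r : ℂ) ^ 2 / 4)) h2).comp_ofReal
  refine h3.congr_deriv ?_
  ring

theorem hasDerivAt_ofReal_pow (m : ℕ) (r : ℝ) :
    HasDerivAt (fun r : ℝ => (r : ℂ) ^ m) (m * (r : ℂ) ^ (m - 1)) r :=
  (hasDerivAt_pow m (r : ℂ)).comp_ofReal

theorem natCast_mul_pow_pred (m : ℕ) (x : ℂ) : (m : ℂ) * x ^ (m - 1) * x = m * x ^ m := by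
  cases m with
  | zero => simp
  | succ k => simp [pow_succ]; ring

theorem hasDerivAt_prof (m : ℕ) (κ : ℂ) {r : ℝ} (hr : r ≠ 0) :
    HasDerivAt (prof m κ) (profDeriv m κ r / r) r := by
  refine ((hasDerivAt_ofReal_pow m r).mul (hasDerivAt_hyp_sq m κ r)).congr_deriv ?_
  have hr' : (r : ℂ) ≠ 0 := by exact_mod_cast hr
  rw [eq_div_iff hr', profDeriv]
  linear_combination (hyp m (κ * r ^ 2 / 4)) * natCast_mul_pow_pred m r

/-- The radial modified Helmholtz equation in self-adjoint form, r (r y')' = (m² + κ r²) y; it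
reduces to `hyp_recurrence`. -/
theorem hasDerivAt_profDeriv (m : ℕ) (κ : ℂ) {r : ℝ} (hr : r ≠ 0) :
    HasDerivAt (profDeriv m κ) ((m ^ 2 / r + κ * r) * prof m κ r) r := by
  have h1 := ((hasDerivAt_ofReal_pow 2 r).const_mul κ).div_const 2
  have h2 := (hasDerivAt_ofReal_pow m r).mul
    (((hasDerivAt_hyp_sq m κ r).const_mul (m : ℂ)).add (h1.mul (hasDerivAt_hyp_sq (m + 1) κ r)))
  refine h2.congr_deriv ?_
  have hr' : (r : ℂ) ≠ 0 := by exact_mod_cast hr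
  rw [prof, ← mul_left_inj' hr', show ((m : ℂ) ^ 2 / r + κ * r) *
    ((r : ℂ) ^ m * hyp m (κ * r ^ 2 / 4)) * r = (m ^ 2 + κ * r ^ 2) *
    ((r : ℂ) ^ m * hyp m (κ * r ^ 2 / 4)) by field_simp]
  simp only [Nat.add_one_sub_one, Nat.cast_ofNat, pow_one, Pi.add_apply, Pi.mul_apply]
  linear_combination (m * hyp m (κ * r ^ 2 / 4) + κ * r ^ 2 / 2 * hyp (m + 1) (κ * r ^ 2 / 4)) *
    natCast_mul_pow_pred m r - κ * r ^ 2 * (r : ℂ) ^ m * hyp_recurrence m (κ * r ^ 2 / 4)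

theorem continuous_prof (m : ℕ) (κ : ℂ) : Continuous (prof m κ) := by
  have := (contDiff_hyp m (k := 0)).continuous
  unfold prof
  fun_prop

theorem continuous_profDeriv (m : ℕ) (κ : ℂ) : Continuous (profDeriv m κ) := by
  have := (contDiff_hyp m (k := 0)).continuous
  have := (contDiff_hyp (m + 1) (k := 0)).continuous
  unfold profDeriv
  fun_prop

theorem conj_prof (m : ℕ) (κ : ℂ) (r : ℝ) : conj (prof m κ r) = prof m (conj κ) r := by
  simp [prof, conj_hyp, map_ofNat]

theorem conj_profDeriv (m : ℕ) (κ : ℂ) (r : ℝ) :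
    conj (profDeriv m κ r) = profDeriv m (conj κ) r := by
  simp [profDeriv, conj_hyp, map_ofNat]

theorem hasDerivAt_normSq {f : ℝ → ℂ} {f' : ℂ} {r : ℝ} (hf : HasDerivAt f f' r) :
    HasDerivAt (fun r => normSq (f r)) (2 * (conj (f r) * f').re) r := by
  have hre : HasDerivAt (fun r => (f r).re) f'.re r :=
    (Complex.reCLM.hasFDerivAt.comp_hasDerivAt r hf)
  have him : HasDerivAt (fun r => (f r).im) f'.im r :=
    (Complex.imCLM.hasFDerivAt.comp_hasDerivAt r hf)
  have h := (hre.mul hre).add (him.mul him)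
  refine h.congr_deriv ?_
  simp
  ring

theorem hasDerivAt_re {f : ℝ → ℂ} {f' : ℂ} {r : ℝ} (hf : HasDerivAt f f' r) :
    HasDerivAt (fun r => (f r).re) f'.re r :=
  Complex.reCLM.hasFDerivAt.comp_hasDerivAt r hf

theorem hasDerivAt_conj {f : ℝ → ℂ} {f' : ℂ} {r : ℝ} (hf : HasDerivAt f f' r) :
    HasDerivAt (fun r => conj (f r)) (conj f') r :=
  Complex.conjCLE.toContinuousLinearMap.hasFDerivAt.comp_hasDerivAt r hf

/-- The flux `r ^ (2m + 1) h̄ h'` of `h(r) = hyp m (κ r² / 4)` has derivative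
`r ^ (2m + 1) (|h'|² + κ |h|²)`. -/
theorem hasDerivAt_hyp_flux (m : ℕ) (κ : ℂ) (r : ℝ) :
    HasDerivAt (fun r : ℝ => (r : ℂ) ^ (2 * m + 2) * (κ / 2) *
        (conj (hyp m (κ * r ^ 2 / 4)) * hyp (m + 1) (κ * r ^ 2 / 4)))
      ((r : ℂ) ^ (2 * m + 1) * (conj (κ * r / 2 * hyp (m + 1) (κ * r ^ 2 / 4)) *
          (κ * r / 2 * hyp (m + 1) (κ * r ^ 2 / 4)) +
        κ * (conj (hyp m (κ * r ^ 2 / 4)) * hyp m (κ * r ^ 2 / 4)))) r := by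
  have h1 := ((hasDerivAt_ofReal_pow (2 * m + 2) r).mul_const (κ / 2)).mul
    ((hasDerivAt_conj (hasDerivAt_hyp_sq m κ r)).mul (hasDerivAt_hyp_sq (m + 1) κ r))
  refine h1.congr_deriv ?_
  simp only [Pi.mul_apply, show 2 * m + 2 - 1 = 2 * m + 1 by omega, map_mul, map_div₀, map_ofNat,
    Complex.conj_ofReal]
  push_cast
  linear_combination -(r : ℂ) ^ (2 * m + 1) * κ * conj (hyp m (κ * r ^ 2 / 4)) *
    hyp_recurrence m (κ * r ^ 2 / 4)

theorem re_hyp_flux_nonneg (m : ℕ) {κ : ℂ} (hκ : 0 < κ.re) {r : ℝ} (hr : 0 ≤ r) :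
    0 ≤ ((r : ℂ) ^ (2 * m + 1) * (conj (κ * r / 2 * hyp (m + 1) (κ * r ^ 2 / 4)) *
          (κ * r / 2 * hyp (m + 1) (κ * r ^ 2 / 4)) +
        κ * (conj (hyp m (κ * r ^ 2 / 4)) * hyp m (κ * r ^ 2 / 4)))).re := by
  rw [← Complex.normSq_eq_conj_mul_self, ← Complex.normSq_eq_conj_mul_self, ← Complex.ofReal_pow,
    Complex.re_ofReal_mul, Complex.add_re, Complex.ofReal_re, Complex.re_mul_ofReal]
  have := Complex.normSq_nonneg (hyp m (κ * r ^ 2 / 4))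
  have := Complex.normSq_nonneg (κ * r / 2 * hyp (m + 1) (κ * r ^ 2 / 4))
  positivity

/-- The flux vanishes at r = 0, and its real part is nondecreasing because Re κ > 0. -/
theorem re_hyp_mul_nonneg (m : ℕ) {κ : ℂ} (hκ : 0 < κ.re) {r : ℝ} (hr : 0 ≤ r) :
    0 ≤ ((r : ℂ) ^ (2 * m + 2) * (κ / 2) *
        (conj (hyp m (κ * r ^ 2 / 4)) * hyp (m + 1) (κ * r ^ 2 / 4))).re := by
  have hd := fun r : ℝ => hasDerivAt_re (hasDerivAt_hyp_flux m κ r)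
  have hm : MonotoneOn (fun r : ℝ => ((r : ℂ) ^ (2 * m + 2) * (κ / 2) *
        (conj (hyp m (κ * r ^ 2 / 4)) * hyp (m + 1) (κ * r ^ 2 / 4))).re) (Set.Ici 0) := by
    refine monotoneOn_of_deriv_nonneg (convex_Ici 0)
      (fun r _ => (hd r).continuousAt.continuousWithinAt)
      (fun r _ => (hd r).differentiableAt.differentiableWithinAt) fun r hr => ?_
    rw [interior_Ici] at hr
    rw [(hd r).deriv]
    exact re_hyp_flux_nonneg m hκ (le_of_lt hr)
  have := hm (Set.mem_Ici.2 le_rfl) (Set.mem_Ici.2 hr) hr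
  simpa using this

/-- By the sign of the flux, |h(r)|² is nondecreasing for h(r) = `hyp m (κ r² / 4)`, and it starts
from the positive value 1/(m!)². -/
theorem hyp_sq_ne_zero (m : ℕ) {κ : ℂ} (hκ : 0 < κ.re) {r : ℝ} (hr : 0 ≤ r) :
    hyp m (κ * r ^ 2 / 4) ≠ 0 := by
  have hd := fun r : ℝ => hasDerivAt_normSq (hasDerivAt_hyp_sq m κ r)
  have hm : MonotoneOn (fun r : ℝ => normSq (hyp m (κ * r ^ 2 / 4))) (Set.Ici 0) := by
    refine monotoneOn_of_deriv_nonneg (convex_Ici 0)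
      (fun r _ => (hd r).continuousAt.continuousWithinAt)
      (fun r _ => (hd r).differentiableAt.differentiableWithinAt) fun r hr => ?_
    rw [interior_Ici] at hr
    have hr0 : 0 < r := hr
    rw [(hd r).deriv]
    have h := re_hyp_mul_nonneg m hκ hr0.le
    have e : (r : ℂ) ^ (2 * m + 2) * (κ / 2) *
        (conj (hyp m (κ * r ^ 2 / 4)) * hyp (m + 1) (κ * r ^ 2 / 4)) =
        ((r ^ (2 * m + 1) : ℝ) : ℂ) * (conj (hyp m (κ * r ^ 2 / 4)) *
          (κ * r / 2 * hyp (m + 1) (κ * r ^ 2 / 4))) := by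
      push_cast
      ring
    rw [e, Complex.re_ofReal_mul] at h
    have : 0 < r ^ (2 * m + 1) := by positivity
    have := nonneg_of_mul_nonneg_right h this
    positivity
  have h := hm (Set.mem_Ici.2 le_rfl) (Set.mem_Ici.2 hr) hr
  intro h0
  simp only [h0, map_zero] at h
  have h1 : normSq (hyp m (κ * ((0 : ℝ) : ℂ) ^ 2 / 4)) = 0 := le_antisymm h (normSq_nonneg _)
  rw [normSq_eq_zero] at h1
  simp [hyp_zero, Nat.factorial_ne_zero] at h1

/-- Once h is known not to vanish, the flux increases strictly. Passing from h to y = r^m h adds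
only the nonnegative term m R^(2m) |h(R)|². -/
theorem re_conj_prof_mul_profDeriv_pos (m : ℕ) {κ : ℂ} (hκ : 0 < κ.re) {R : ℝ} (hR : 0 < R) :
    0 < (conj (prof m κ R) * profDeriv m κ R).re := by
  have hd := fun r : ℝ => hasDerivAt_re (hasDerivAt_hyp_flux m κ r)
  have hm : StrictMonoOn (fun r : ℝ => ((r : ℂ) ^ (2 * m + 2) * (κ / 2) *
        (conj (hyp m (κ * r ^ 2 / 4)) * hyp (m + 1) (κ * r ^ 2 / 4))).re) (Set.Ici 0) := by
    refine strictMonoOn_of_deriv_pos (convex_Ici 0)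
      (fun r _ => (hd r).continuousAt.continuousWithinAt) fun r hr => ?_
    rw [interior_Ici] at hr
    have hr0 : 0 < r := hr
    rw [(hd r).deriv, ← Complex.normSq_eq_conj_mul_self, ← Complex.normSq_eq_conj_mul_self,
      ← Complex.ofReal_pow, Complex.re_ofReal_mul, Complex.add_re, Complex.ofReal_re,
      Complex.re_mul_ofReal]
    have := Complex.normSq_pos.2 (hyp_sq_ne_zero m hκ hr0.le)
    have := Complex.normSq_nonneg (κ * r / 2 * hyp (m + 1) (κ * r ^ 2 / 4))
    positivity
  have h := hm (Set.mem_Ici.2 le_rfl) (Set.mem_Ici.2 hR.le) hR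
  have e : conj (prof m κ R) * profDeriv m κ R =
      ((m * R ^ (2 * m) * normSq (hyp m (κ * R ^ 2 / 4)) : ℝ) : ℂ) + (R : ℂ) ^ (2 * m + 2) * (κ / 2) *
        (conj (hyp m (κ * R ^ 2 / 4)) * hyp (m + 1) (κ * R ^ 2 / 4)) := by
    push_cast
    rw [Complex.normSq_eq_conj_mul_self, prof, profDeriv, map_mul, map_pow, Complex.conj_ofReal]
    ring
  rw [e, Complex.add_re, Complex.ofReal_re]
  have := Complex.normSq_nonneg (hyp m (κ * R ^ 2 / 4))
  have h2 : 0 ≤ m * R ^ (2 * m) * normSq (hyp m (κ * R ^ 2 / 4)) := by positivity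
  simp at h
  simp
  linarith

theorem prof_ne_zero (m : ℕ) {κ : ℂ} (hκ : 0 < κ.re) {R : ℝ} (hR : 0 < R) : prof m κ R ≠ 0 := by
  intro h
  have := re_conj_prof_mul_profDeriv_pos m hκ hR
  simp [h] at this

/-- The denominator in the response coefficients does not vanish. -/
theorem profDeriv_add_prof_ne_zero (m : ℕ) {κ : ℂ} (hκ : 0 < κ.re) {R D K : ℝ} (hR : 0 < R)
    (hD : 0 < D) (hK : 0 < K) : D * profDeriv m κ R + K * R * prof m κ R ≠ 0 := by
  intro h
  have h1 := re_conj_prof_mul_profDeriv_pos m hκ hR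
  -- Multiplication by conj y(R) turns the denominator into a sum whose first term has positive real
  -- part and whose second is nonnegative.
  have h2 : ((D : ℝ) : ℂ) * (conj (prof m κ R) * profDeriv m κ R) +
      ((K * R * normSq (prof m κ R) : ℝ) : ℂ) = 0 := by
    push_cast
    rw [Complex.normSq_eq_conj_mul_self]
    linear_combination conj (prof m κ R) * h
  have h3 := congrArg Complex.re h2
  rw [Complex.add_re, Complex.re_ofReal_mul, Complex.ofReal_re, Complex.zero_re] at h3
  have := Complex.normSq_nonneg (prof m κ R)
  have : 0 ≤ K * R * normSq (prof m κ R) := by positivity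
  nlinarith [mul_pos hD h1]

/-- `2 κ ∫₀ᴿ r y² dr = (m² + κ R²) y(R)² - (R y'(R))²` for `y = prof m κ`. -/
theorem integral_prof_sq (m : ℕ) (κ : ℂ) {R : ℝ} (hR : 0 < R) :
    2 * κ * ∫ r in (0 : ℝ)..R, (r : ℂ) * prof m κ r ^ 2 =
      (m ^ 2 + κ * R ^ 2) * prof m κ R ^ 2 - profDeriv m κ R ^ 2 := by
  have hc1 := continuous_prof m κ
  have hc2 := continuous_profDeriv m κ
  -- In the derivative of (m² + κ r²) y² - (r y')² the terms in y y' cancel by the radial equation,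
  -- leaving 2 κ r y².
  rw [← intervalIntegral.integral_const_mul, intervalIntegral.integral_eq_sub_of_hasDerivAt_of_le
    (f := fun r : ℝ => ((m : ℂ) ^ 2 + κ * r ^ 2) * prof m κ r ^ 2 - profDeriv m κ r ^ 2) hR.le]
  · have : ((m : ℂ) ^ 2 + κ * (0 : ℝ) ^ 2) * prof m κ 0 ^ 2 - profDeriv m κ 0 ^ 2 = 0 := by
      simp [prof, profDeriv]
      ring
    rw [this, sub_zero]
  · fun_prop
  · intro r hr
    have hr0 : r ≠ 0 := hr.1.ne'
    have hr' : (r : ℂ) ≠ 0 := by exact_mod_cast hr0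
    have h1 := ((((hasDerivAt_ofReal_pow 2 r).const_mul κ).const_add ((m : ℂ) ^ 2)).mul
      ((hasDerivAt_prof m κ hr0).pow 2)).sub ((hasDerivAt_profDeriv m κ hr0).pow 2)
    refine h1.congr_deriv ?_
    simp only [Nat.add_one_sub_one, Nat.cast_ofNat, pow_one, Pi.pow_apply]
    field_simp
    ring
  · apply Continuous.intervalIntegrable
    fun_prop

/-! ### Fourier coefficients in the angle -/

/-- The integral `∫₀^{2π} u(θ) e^{-inθ} dθ`. -/
def fint (n : ℤ) (u : ℝ → ℂ) : ℂ := ∫ θ in (0 : ℝ)..(2 * Real.pi), u θ * exp (-(n * θ * I))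

theorem exp_int_mul_two_pi (n : ℤ) : exp (-(n * ((2 * Real.pi : ℝ) : ℂ) * I)) = 1 := by
  rw [Complex.exp_eq_one_iff]
  exact ⟨-n, by push_cast; ring⟩

theorem hasDerivAt_exp_angle (n : ℤ) (θ : ℝ) :
    HasDerivAt (fun θ : ℝ => exp (-(n * θ * I))) (-(n * I) * exp (-(n * θ * I))) θ := by
  have h : HasDerivAt (fun z : ℂ => -(n * z * I)) (-(n * I)) (θ : ℂ) := by
    refine (((hasDerivAt_id (θ : ℂ)).const_mul (n : ℂ)).mul_const I).neg.congr_deriv ?_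
    ring
  have h2 := (h.cexp).comp_ofReal
  exact h2.congr_deriv (by ring)

theorem continuous_exp_angle (n : ℤ) : Continuous fun θ : ℝ => exp (-(n * θ * I)) := by
  fun_prop

theorem fint_add (n : ℤ) {u v : ℝ → ℂ} (hu : Continuous u) (hv : Continuous v) :
    fint n (fun θ => u θ + v θ) = fint n u + fint n v := by
  have he := continuous_exp_angle n
  rw [fint, fint, fint, ← intervalIntegral.integral_add]
  · simp only [add_mul]
  · exact (hu.mul he).intervalIntegrable _ _
  · exact (hv.mul he).intervalIntegrable _ _

theorem fint_const_mul (n : ℤ) (c : ℂ) (u : ℝ → ℂ) :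
    fint n (fun θ => c * u θ) = c * fint n u := by
  rw [fint, fint, ← intervalIntegral.integral_const_mul]
  simp only [mul_assoc]

theorem fint_linear (n : ℤ) (a b : ℂ) {u v : ℝ → ℂ} (hu : Continuous u) (hv : Continuous v) :
    fint n (fun θ => a * u θ + b * v θ) = a * fint n u + b * fint n v := by
  rw [fint_add n (u := fun θ => a * u θ) (v := fun θ => b * v θ) (continuous_const.mul hu)
    (continuous_const.mul hv), fint_const_mul, fint_const_mul]

/-- Both integrations by parts are done at once: (u' + i n u) e^{-inθ} is an antiderivative of (u''
+ n² u) e^{-inθ}, and its end values agree by periodicity. -/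
theorem fint_second_deriv (n : ℤ) {u u' u'' : ℝ → ℂ} (h1 : ∀ θ, HasDerivAt u (u' θ) θ)
    (h2 : ∀ θ, HasDerivAt u' (u'' θ) θ) (hc : Continuous u'') (hp : u (2 * Real.pi) = u 0)
    (hp' : u' (2 * Real.pi) = u' 0) : fint n u'' = -(n : ℂ) ^ 2 * fint n u := by
  have hu : Continuous u := continuous_iff_continuousAt.2 fun θ => (h1 θ).continuousAt
  have he := continuous_exp_angle n
  have key : ∫ θ in (0 : ℝ)..(2 * Real.pi), (u'' θ * exp (-(n * θ * I)) +
      (n : ℂ) ^ 2 * (u θ * exp (-(n * θ * I)))) = 0 := by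
    rw [intervalIntegral.integral_eq_sub_of_hasDerivAt
      (f := fun θ => (u' θ + n * I * u θ) * exp (-(n * θ * I)))]
    · rw [exp_int_mul_two_pi, hp, hp']
      simp
    · intro θ _
      refine (((h2 θ).add ((h1 θ).const_mul (n * I))).mul (hasDerivAt_exp_angle n θ)).congr_deriv ?_
      simp only [Pi.add_apply]
      linear_combination -(n : ℂ) ^ 2 * u θ * exp (-(n * θ * I)) * I_sq
    · apply Continuous.intervalIntegrable
      fun_prop
  rw [intervalIntegral.integral_add, intervalIntegral.integral_const_mul] at key
  · rw [fint, fint]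
    linear_combination key
  · apply Continuous.intervalIntegrable
    fun_prop
  · apply Continuous.intervalIntegrable
    fun_prop

theorem continuousOn_integral_param {G : ℝ → ℝ → ℂ} {a b : ℝ} (hab : a ≤ b) (c d : ℝ)
    (hG : ContinuousOn (fun p : ℝ × ℝ => G p.1 p.2) (Set.Icc a b ×ˢ Set.univ)) :
    ContinuousOn (fun r => ∫ θ in c..d, G r θ) (Set.Icc a b) := by
  -- Clamping r to [a, b] extends the integrand to a function continuous on the whole plane without
  -- changing it where it is used.
  have h : Continuous fun p : ℝ × ℝ => G (Set.projIcc a b hab p.1) p.2 := by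
    have h1 : Continuous fun p : ℝ × ℝ => (((Set.projIcc a b hab p.1 : Set.Icc a b) : ℝ), p.2) := by
      have := continuous_projIcc (a := a) (b := b) (h := hab)
      fun_prop
    exact hG.comp_continuous h1 fun p => ⟨Subtype.prop _, Set.mem_univ _⟩
  have h2 : Continuous fun r => ∫ θ in c..d, G (Set.projIcc a b hab r) θ :=
    intervalIntegral.continuous_parametric_intervalIntegral_of_continuous' h c d
  refine h2.continuousOn.congr fun r hr => ?_
  simp only [Set.projIcc_of_mem hab hr]

theorem hasDerivAt_integral_param {G G' : ℝ → ℝ → ℂ} {a b : ℝ} {c d : ℝ}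
    (hG : ContinuousOn (fun p : ℝ × ℝ => G p.1 p.2) (Set.Ioo a b ×ˢ Set.univ))
    (hG' : ContinuousOn (fun p : ℝ × ℝ => G' p.1 p.2) (Set.Ioo a b ×ˢ Set.univ))
    (hd : ∀ r ∈ Set.Ioo a b, ∀ θ, HasDerivAt (fun r => G r θ) (G' r θ) r) {r : ℝ}
    (hr : r ∈ Set.Ioo a b) :
    HasDerivAt (fun r => ∫ θ in c..d, G r θ) (∫ θ in c..d, G' r θ) r := by
  obtain ⟨δ, hδ, hsub⟩ := Metric.nhds_basis_closedBall.mem_iff.1 (Ioo_mem_nhds hr.1 hr.2)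
  -- Compactness in both variables supplies a constant dominating function.
  have hK : IsCompact (Metric.closedBall r δ ×ˢ Set.uIcc c d) :=
    (isCompact_closedBall r δ).prod isCompact_uIcc
  obtain ⟨C, hC⟩ := hK.exists_bound_of_continuousOn
    (hG'.mono (Set.prod_mono hsub (Set.subset_univ _)))
  have slice : ∀ {H : ℝ → ℝ → ℂ},
      ContinuousOn (fun p : ℝ × ℝ => H p.1 p.2) (Set.Ioo a b ×ˢ Set.univ) →
      ∀ s ∈ Set.Ioo a b, Continuous (H s) := by
    intro H hH s hs
    exact hH.comp_continuous (f := fun θ : ℝ => (s, θ)) (by fun_prop) fun θ => ⟨hs, Set.mem_univ _⟩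
  refine (intervalIntegral.hasDerivAt_integral_of_dominated_loc_of_deriv_le (μ := MeasureTheory.volume)
    (bound := fun _ => C) (Metric.closedBall_mem_nhds r hδ) ?_ ?_ ?_ ?_ ?_ ?_).2
  · filter_upwards [Ioo_mem_nhds hr.1 hr.2] with s hs
    exact (slice hG s hs).aestronglyMeasurable
  · exact (slice hG r hr).intervalIntegrable _ _
  · exact (slice hG' r hr).aestronglyMeasurable
  · refine Filter.Eventually.of_forall fun θ hθ s hs => hC (s, θ) ⟨hs, Set.uIoc_subset_uIcc hθ⟩
  · exact intervalIntegrable_const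
  · exact Filter.Eventually.of_forall fun θ _ s hs => hd s (hsub hs) θ

/-! ### The Laplacian in polar coordinates -/

theorem laplacian_eq_second_deriv (U : ℂ → ℂ) (z : ℂ) :
    Laplacian.laplacian U z =
      fderiv ℝ (fderiv ℝ U) z 1 1 + fderiv ℝ (fderiv ℝ U) z I I := by
  rw [InnerProductSpace.laplacian_eq_iteratedFDeriv_complexPlane]
  simp [iteratedFDeriv_two_apply]

/-- The trace of a bilinear form is the same in every orthonormal basis. The mixed terms cancel
between the two directions, so symmetry of the second derivative is not needed. -/
theorem laplacian_eq_rotated (U : ℂ → ℂ) (z : ℂ) (θ : ℝ) :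
    Laplacian.laplacian U z =
      fderiv ℝ (fderiv ℝ U) z (exp (θ * I)) (exp (θ * I)) +
        fderiv ℝ (fderiv ℝ U) z (exp (θ * I) * I) (exp (θ * I) * I) := by
  have e1 : exp (θ * I) = Real.cos θ • (1 : ℂ) + Real.sin θ • I := by
    rw [Complex.exp_mul_I, ← Complex.ofReal_cos, ← Complex.ofReal_sin]
    simp
  have e2 : exp (θ * I) * I = (-Real.sin θ) • (1 : ℂ) + Real.cos θ • I := by
    rw [e1]
    simp only [Complex.real_smul, Complex.ofReal_neg]
    linear_combination (Real.sin θ : ℂ) * I_sq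
  rw [e2, e1, laplacian_eq_second_deriv]
  simp only [map_add, map_smul, _root_.add_apply, _root_.smul_apply]
  simp only [Complex.real_smul, Complex.ofReal_neg]
  have h : (Real.sin θ : ℂ) ^ 2 + (Real.cos θ : ℂ) ^ 2 = 1 := by
    exact_mod_cast Real.sin_sq_add_cos_sq θ
  linear_combination -(fderiv ℝ (fderiv ℝ U) z 1 1 + fderiv ℝ (fderiv ℝ U) z I I) * h

theorem norm_polar (r θ : ℝ) : ‖polar r θ‖ = |r| := by
  rw [polar, norm_mul, Complex.norm_exp_ofReal_mul_I, Complex.norm_real, mul_one, Real.norm_eq_abs]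

theorem polar_mem_ball {r R : ℝ} (hr : r ∈ Set.Ioo 0 R) (θ : ℝ) :
    polar r θ ∈ Metric.ball (0 : ℂ) R := by
  rw [mem_ball_zero_iff, norm_polar, abs_of_pos hr.1]
  exact hr.2

theorem polar_mem_closedBall {r R : ℝ} (hr : r ∈ Set.Icc 0 R) (θ : ℝ) :
    polar r θ ∈ Metric.closedBall (0 : ℂ) R := by
  rw [mem_closedBall_zero_iff, norm_polar, abs_of_nonneg hr.1]
  exact hr.2

theorem continuous_polar : Continuous fun p : ℝ × ℝ => polar p.1 p.2 := by
  unfold polar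
  fun_prop

theorem hasDerivAt_polar_radius (r θ : ℝ) :
    HasDerivAt (fun r => polar r θ) (exp (θ * I)) r := by
  simpa [polar] using (hasDerivAt_ofReal_pow 1 r).mul_const (exp (θ * I))

theorem hasDerivAt_polar_angle (r θ : ℝ) :
    HasDerivAt (fun θ => polar r θ) (polar r θ * I) θ := by
  have h : HasDerivAt (fun z : ℂ => z * I) I (θ : ℂ) := by
    simpa using (hasDerivAt_id (θ : ℂ)).mul_const I
  refine ((h.cexp).comp_ofReal.const_mul (r : ℂ)).congr_deriv ?_
  rw [polar, mul_assoc]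

theorem polar_two_pi (r : ℝ) : polar r (2 * Real.pi) = polar r 0 := by
  simp [polar, Complex.exp_two_pi_mul_I]

/-! ### Green's identity on the disk, one Fourier mode at a time -/

section Green

variable {U : ℂ → ℂ} {R : ℝ}

theorem hasFDerivAt_of_contDiffOn_ball (hU : ContDiffOn ℝ 2 U (Metric.ball 0 R)) {z : ℂ}
    (hz : z ∈ Metric.ball (0 : ℂ) R) :
    HasFDerivAt U (fderiv ℝ U z) z ∧ HasFDerivAt (fderiv ℝ U) (fderiv ℝ (fderiv ℝ U) z) z := by
  have h := hU.contDiffAt (Metric.isOpen_ball.mem_nhds hz)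
  exact ⟨(h.differentiableAt (by norm_num)).hasFDerivAt,
    ((h.fderiv_right (m := 1) (by norm_num)).differentiableAt (by norm_num)).hasFDerivAt⟩

theorem continuousOn_second_fderiv (hU : ContDiffOn ℝ 2 U (Metric.ball 0 R)) :
    ContinuousOn (fderiv ℝ (fderiv ℝ U)) (Metric.ball 0 R) := fun z hz => by
  have h := hU.contDiffAt (Metric.isOpen_ball.mem_nhds hz)
  have h2 : ContDiffAt ℝ 0 (fderiv ℝ (fderiv ℝ U)) z :=
    (h.fderiv_right (m := 1) (by norm_num)).fderiv_right (by norm_num)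
  exact h2.continuousAt.continuousWithinAt

theorem continuousOn_fderiv (hU : ContDiffOn ℝ 2 U (Metric.ball 0 R)) :
    ContinuousOn (fderiv ℝ U) (Metric.ball 0 R) := fun _ hz =>
  (hasFDerivAt_of_contDiffOn_ball hU hz).2.continuousAt.continuousWithinAt

theorem continuousOn_comp_polar {E : Type*} [TopologicalSpace E] {g : ℂ → E}
    (hg : ContinuousOn g (Metric.closedBall 0 R)) :
    ContinuousOn (fun p : ℝ × ℝ => g (polar p.1 p.2)) (Set.Icc 0 R ×ˢ Set.univ) :=
  hg.comp continuous_polar.continuousOn fun p hp => polar_mem_closedBall hp.1 p.2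

theorem continuousOn_comp_polar_open {E : Type*} [TopologicalSpace E] {g : ℂ → E}
    (hg : ContinuousOn g (Metric.ball 0 R)) :
    ContinuousOn (fun p : ℝ × ℝ => g (polar p.1 p.2)) (Set.Ioo 0 R ×ˢ Set.univ) :=
  hg.comp continuous_polar.continuousOn fun p hp => polar_mem_ball hp.1 p.2

/-- The polar form of the Laplacian on the `n`-th Fourier mode. -/
theorem fint_laplacian (hU : ContDiffOn ℝ 2 U (Metric.ball 0 R)) (n : ℤ) {r : ℝ}
    (hr : r ∈ Set.Ioo 0 R) :
    (r : ℂ) ^ 2 * fint n (fun θ => Laplacian.laplacian U (polar r θ)) =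
      r ^ 2 * fint n (fun θ =>
        fderiv ℝ (fderiv ℝ U) (polar r θ) (exp (θ * I)) (exp (θ * I))) +
      r * fint n (fun θ => fderiv ℝ U (polar r θ) (exp (θ * I))) -
      (n : ℂ) ^ 2 * fint n (fun θ => U (polar r θ)) := by
  have hc2 : Continuous fun θ : ℝ => fderiv ℝ (fderiv ℝ U) (polar r θ) :=
    (continuousOn_comp_polar_open (continuousOn_second_fderiv hU)).comp_continuous
      (f := fun θ : ℝ => (r, θ)) (by fun_prop) fun θ => ⟨hr, Set.mem_univ _⟩
  have hc1 : Continuous fun θ : ℝ => fderiv ℝ U (polar r θ) :=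
    (continuousOn_comp_polar_open (continuousOn_fderiv hU)).comp_continuous
      (f := fun θ : ℝ => (r, θ)) (by fun_prop) fun θ => ⟨hr, Set.mem_univ _⟩
  have hp : Continuous fun θ : ℝ => polar r θ :=
    continuous_polar.comp (f := fun θ : ℝ => (r, θ)) (by fun_prop)
  have he := continuous_exp_angle n
  have h := fint_second_deriv n (u := fun θ => U (polar r θ))
    (u' := fun θ => fderiv ℝ U (polar r θ) (polar r θ * I))
    (u'' := fun θ => fderiv ℝ (fderiv ℝ U) (polar r θ) (polar r θ * I) (polar r θ * I) +
      fderiv ℝ U (polar r θ) (polar r θ * I * I))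
    (fun θ => (hasFDerivAt_of_contDiffOn_ball hU (polar_mem_ball hr θ)).1.comp_hasDerivAt θ
      (hasDerivAt_polar_angle r θ))
    (fun θ => by
      have h1 := (hasFDerivAt_of_contDiffOn_ball hU (polar_mem_ball hr θ)).2.comp_hasDerivAt θ
        (hasDerivAt_polar_angle r θ)
      exact h1.clm_apply ((hasDerivAt_polar_angle r θ).mul_const I))
    (by fun_prop) (by simp only [polar_two_pi]) (by simp only [polar_two_pi])
  -- The last term of U_θθ comes from the acceleration -r e^{iθ} of the circle and equals -r U_r;
  -- hence r² ΔU = r² U_rr + r U_r + U_θθ.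
  have e : ∀ θ : ℝ, (r : ℂ) ^ 2 * Laplacian.laplacian U (polar r θ) =
      r ^ 2 * fderiv ℝ (fderiv ℝ U) (polar r θ) (exp (θ * I)) (exp (θ * I)) +
        r * fderiv ℝ U (polar r θ) (exp (θ * I)) +
      (fderiv ℝ (fderiv ℝ U) (polar r θ) (polar r θ * I) (polar r θ * I) +
        fderiv ℝ U (polar r θ) (polar r θ * I * I)) := by
    intro θ
    have e1 : polar r θ * I = r • (exp (θ * I) * I) := by
      rw [polar, Complex.real_smul]
      ring
    have e2 : polar r θ * I * I = (-r) • exp (θ * I) := by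
      rw [polar, Complex.real_smul, Complex.ofReal_neg]
      linear_combination (r : ℂ) * exp (θ * I) * I_sq
    rw [e2, e1, laplacian_eq_rotated U _ θ]
    simp only [map_smul, _root_.smul_apply]
    simp only [Complex.real_smul, Complex.ofReal_neg]
    ring
  rw [← fint_const_mul]
  simp only [e]
  rw [fint_add _ (by fun_prop) (by fun_prop), fint_add _ (by fun_prop) (by fun_prop), h,
    fint_const_mul, fint_const_mul]
  ring

/-- Green's identity against the `n`-th radial solution. -/
theorem bulk_green {f : ℂ → ℂ} {D : ℝ} {a κ : ℂ} (hR : 0 < R) (hD : D ≠ 0) (hκ : D * κ = a)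
    (hU2 : ContDiffOn ℝ 2 U (Metric.ball 0 R)) (hU1 : ContDiffOn ℝ 1 U (Metric.closedBall 0 R))
    (hf : ContinuousOn f (Metric.closedBall 0 R))
    (heq : ∀ z ∈ Metric.ball (0 : ℂ) R, a * U z - D * Laplacian.laplacian U z = f z) (n : ℤ) :
    ∫ r in (0 : ℝ)..R, r * prof n.natAbs κ r * fint n (fun θ => f (polar r θ)) =
      D * (fint n (fun θ => U (polar R θ)) * profDeriv n.natAbs κ R -
        R * prof n.natAbs κ R *
          fint n (fun θ => derivWithin (fun r : ℝ => U (polar r θ)) (Set.Icc 0 R) R)) := by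
  set m := n.natAbs with hm
  have hDc : (D : ℂ) ≠ 0 := by exact_mod_cast hD
  have hmn : (m : ℂ) ^ 2 = (n : ℂ) ^ 2 := by
    rw [hm, ← Int.cast_natCast, ← Int.cast_pow, Int.natAbs_sq, Int.cast_pow]
  have hpc := continuous_prof m κ
  have hpc' := continuous_profDeriv m κ
  have hud : UniqueDiffOn ℝ (Metric.closedBall (0 : ℂ) R) :=
    uniqueDiffOn_convex (convex_closedBall 0 R) (by
      rw [interior_closedBall _ hR.ne']
      exact ⟨0, Metric.mem_ball_self hR⟩)
  -- The derivative within the closed disk is continuous up to the boundary and equals `fderiv`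
  -- inside. It lets `x1` below be both x' on (0, R) and the boundary flux at R.
  have hgc : ContinuousOn (fderivWithin ℝ U (Metric.closedBall 0 R)) (Metric.closedBall 0 R) :=
    hU1.continuousOn_fderivWithin hud (by norm_num)
  have hg : ∀ z ∈ Metric.ball (0 : ℂ) R, fderivWithin ℝ U (Metric.closedBall 0 R) z = fderiv ℝ U z :=
    fun z hz => fderivWithin_of_mem_nhds
      (Filter.mem_of_superset (Metric.isOpen_ball.mem_nhds hz) Metric.ball_subset_closedBall)
  have hrd : ∀ θ : ℝ, derivWithin (fun r : ℝ => U (polar r θ)) (Set.Icc 0 R) R =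
      fderivWithin ℝ U (Metric.closedBall 0 R) (polar R θ) (exp (θ * I)) := by
    intro θ
    have h1 : HasFDerivWithinAt U (fderivWithin ℝ U (Metric.closedBall 0 R) (polar R θ))
        (Metric.closedBall 0 R) (polar R θ) :=
      ((hU1.differentiableOn (by norm_num)) _
        (polar_mem_closedBall ⟨hR.le, le_rfl⟩ θ)).hasFDerivWithinAt
    exact (h1.comp_hasDerivWithinAt R (hasDerivAt_polar_radius R θ).hasDerivWithinAt
      fun r hr => polar_mem_closedBall hr θ).derivWithin
      (uniqueDiffOn_Icc hR R ⟨hR.le, le_rfl⟩)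
  set x : ℝ → ℂ := fun r => fint n (fun θ => U (polar r θ)) with hx
  set x1 : ℝ → ℂ := fun r => fint n (fun θ =>
    fderivWithin ℝ U (Metric.closedBall 0 R) (polar r θ) (exp (θ * I))) with hx1
  set x2 : ℝ → ℂ := fun r => fint n (fun θ =>
    fderiv ℝ (fderiv ℝ U) (polar r θ) (exp (θ * I)) (exp (θ * I))) with hx2
  have he : Continuous fun p : ℝ × ℝ => exp (-(n * p.2 * I)) := by fun_prop
  have hee : Continuous fun p : ℝ × ℝ => exp (p.2 * I) := by fun_prop
  have hxc : ContinuousOn x (Set.Icc 0 R) := continuousOn_integral_param hR.le _ _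
    ((continuousOn_comp_polar hU1.continuousOn).mul he.continuousOn)
  have hx1c : ContinuousOn x1 (Set.Icc 0 R) := continuousOn_integral_param hR.le _ _
    (((continuousOn_comp_polar hgc).clm_apply hee.continuousOn).mul he.continuousOn)
  have hfc : ContinuousOn (fun r => fint n (fun θ => f (polar r θ))) (Set.Icc 0 R) :=
    continuousOn_integral_param hR.le _ _ ((continuousOn_comp_polar hf).mul he.continuousOn)
  have hxd : ∀ r ∈ Set.Ioo 0 R, HasDerivAt x (x1 r) r := by
    intro r hr
    have h1 : x1 r = fint n (fun θ => fderiv ℝ U (polar r θ) (exp (θ * I))) := by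
      simp only [hx1, hg _ (polar_mem_ball hr _)]
    rw [h1]
    refine hasDerivAt_integral_param
      (G' := fun r θ => fderiv ℝ U (polar r θ) (exp (θ * I)) * exp (-(n * θ * I)))
      ((continuousOn_comp_polar_open hU2.continuousOn).mul he.continuousOn)
      (((continuousOn_comp_polar_open (continuousOn_fderiv hU2)).clm_apply
        hee.continuousOn).mul he.continuousOn) (fun s hs θ => ?_) hr
    exact ((hasFDerivAt_of_contDiffOn_ball hU2 (polar_mem_ball hs θ)).1.comp_hasDerivAt s
      (hasDerivAt_polar_radius s θ)).mul_const _
  have hx1d : ∀ r ∈ Set.Ioo 0 R, HasDerivAt x1 (x2 r) r := by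
    intro r hr
    have h1 : HasDerivAt (fun r => fint n (fun θ => fderiv ℝ U (polar r θ) (exp (θ * I))))
        (x2 r) r := by
      refine hasDerivAt_integral_param
        (G := fun r θ => fderiv ℝ U (polar r θ) (exp (θ * I)) * exp (-(n * θ * I)))
        (G' := fun r θ => fderiv ℝ (fderiv ℝ U) (polar r θ) (exp (θ * I)) (exp (θ * I)) *
          exp (-(n * θ * I)))
        (((continuousOn_comp_polar_open (continuousOn_fderiv hU2)).clm_apply
          hee.continuousOn).mul he.continuousOn)
        ((((continuousOn_comp_polar_open (continuousOn_second_fderiv hU2)).clm_apply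
          hee.continuousOn).clm_apply hee.continuousOn).mul he.continuousOn) (fun s hs θ => ?_) hr
      have h2 := (hasFDerivAt_of_contDiffOn_ball hU2 (polar_mem_ball hs θ)).2.comp_hasDerivAt s
        (hasDerivAt_polar_radius s θ)
      have h3 := h2.clm_apply (hasDerivAt_const s (exp (θ * I)))
      simpa using h3.mul_const (exp (-(n * θ * I)))
    refine h1.congr_of_eventuallyEq ?_
    filter_upwards [Ioo_mem_nhds hr.1 hr.2] with s hs
    simp only [hx1, hg _ (polar_mem_ball hs _)]
  have hode : ∀ r ∈ Set.Ioo 0 R, (r : ℂ) ^ 2 * x2 r + r * x1 r - (m : ℂ) ^ 2 * x r =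
      r ^ 2 * (κ * x r - fint n (fun θ => f (polar r θ)) / D) := by
    intro r hr
    have h1 : x1 r = fint n (fun θ => fderiv ℝ U (polar r θ) (exp (θ * I))) := by
      simp only [hx1, hg _ (polar_mem_ball hr _)]
    have h2 : fint n (fun θ => Laplacian.laplacian U (polar r θ)) =
        κ * x r - fint n (fun θ => f (polar r θ)) / D := by
      have hcU : Continuous fun θ : ℝ => U (polar r θ) :=
        (continuousOn_comp_polar_open hU2.continuousOn).comp_continuous
          (f := fun θ : ℝ => (r, θ)) (by fun_prop) fun θ => ⟨hr, Set.mem_univ _⟩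
      have hcf : Continuous fun θ : ℝ => f (polar r θ) :=
        (continuousOn_comp_polar hf).comp_continuous
          (f := fun θ : ℝ => (r, θ)) (by fun_prop)
          fun θ => ⟨Set.Ioo_subset_Icc_self hr, Set.mem_univ _⟩
      have e : ∀ θ : ℝ, Laplacian.laplacian U (polar r θ) =
          κ * U (polar r θ) + (-(1 / D : ℂ)) * f (polar r θ) := by
        intro θ
        rw [← heq _ (polar_mem_ball hr θ), ← hκ]
        field_simp
        ring
      simp only [e]
      rw [fint_linear n _ _ hcU hcf]
      ring
    rw [← h2, fint_laplacian hU2 n hr, hmn, h1]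
  -- The function integrated is the Wronskian r y x' - x (r y'), whose derivative retains only the
  -- forcing. Since U is C² only inside, differentiability is available on (0, R), and continuity is
  -- all that is used at the end points.
  have key := intervalIntegral.integral_eq_sub_of_hasDerivAt_of_le
    (f := fun r : ℝ => x1 r * (r * prof m κ r) - x r * profDeriv m κ r)
    (f' := fun r : ℝ => -(1 / D : ℂ) * (r * prof m κ r * fint n (fun θ => f (polar r θ))))
    hR.le
    (by
      have h1 : ContinuousOn (fun r : ℝ => (r : ℂ) * prof m κ r) (Set.Icc 0 R) := by fun_prop
      exact (hx1c.mul h1).sub (hxc.mul hpc'.continuousOn))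
    (fun r hr => by
      have hr0 : r ≠ 0 := hr.1.ne'
      have hr' : (r : ℂ) ≠ 0 := by exact_mod_cast hr0
      have h1 := ((hx1d r hr).mul ((hasDerivAt_ofReal_pow 1 r).mul (hasDerivAt_prof m κ hr0))).sub
        ((hxd r hr).mul (hasDerivAt_profDeriv m κ hr0))
      simp only [Pi.mul_apply, pow_one] at h1
      have h2 := h1.congr_deriv (g' := -(1 / D : ℂ) * (r * prof m κ r *
          fint n (fun θ => f (polar r θ)))) (by
        have h3 := hode r hr
        simp only [Nat.cast_one, Nat.sub_self, pow_zero, mul_one]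
        field_simp at h3 ⊢
        linear_combination prof m κ r * h3)
      refine h2.congr_of_eventuallyEq (Filter.Eventually.of_forall fun s => ?_)
      simp)
    (by
      have h1 : ContinuousOn (fun r : ℝ => (r : ℂ) * prof m κ r) (Set.Icc 0 R) := by fun_prop
      apply ContinuousOn.intervalIntegrable
      rw [Set.uIcc_of_le hR.le]
      exact continuousOn_const.mul (h1.mul hfc))
  rw [intervalIntegral.integral_const_mul] at key
  -- The centre contributes nothing: r y' vanishes there through the factors m and r² if m = 0, and
  -- through r^m otherwise.
  have h0 : profDeriv m κ 0 = 0 := by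
    simp only [profDeriv, Complex.ofReal_zero]
    rcases eq_or_ne m 0 with h | h <;> simp [h]
  simp only [hrd]
  change _ = D * (x R * _ - _ * x1 R)
  rw [h0] at key
  simp only [Complex.ofReal_zero, zero_mul, mul_zero, sub_zero] at key
  field_simp at key
  linear_combination -key

end Green

/-! ### The bulk parts of the modes -/

/-- `I` for `0 ≤ n` and `-I` for `n < 0`. -/
def rotUnit (n : ℤ) : ℂ := if 0 ≤ n then I else -I

theorem rotUnit_sq (n : ℤ) : rotUnit n ^ 2 = -1 := by
  unfold rotUnit
  split_ifs <;> simp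

theorem rotUnit_exp (n : ℤ) (θ : ℝ) :
    ((Real.cos θ : ℂ) + rotUnit n * Real.sin θ) ^ n.natAbs = exp (n * θ * I) := by
  unfold rotUnit
  split_ifs with h
  · rw [mul_comm I, Complex.ofReal_cos, Complex.ofReal_sin, ← Complex.exp_mul_I, ← Complex.exp_nat_mul]
    obtain ⟨k, rfl⟩ := Int.eq_ofNat_of_zero_le h
    simp [mul_assoc]
  · have e : (Real.cos θ : ℂ) + -I * Real.sin θ = exp (-θ * I) := by
      rw [Complex.exp_mul_I, Complex.cos_neg, Complex.sin_neg, Complex.ofReal_cos,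
        Complex.ofReal_sin]
      ring
    rw [e, ← Complex.exp_nat_mul]
    obtain ⟨k, hk⟩ := Int.eq_ofNat_of_zero_le (a := -n) (by omega)
    obtain rfl : n = -k := by omega
    simp [mul_assoc]

/-- The smooth extension of `prof |n| κ r e^{inθ}` to the plane. -/
def modeBulk (n : ℤ) (κ z : ℂ) : ℂ :=
  ((z.re : ℂ) + rotUnit n * z.im) ^ n.natAbs *
    hyp n.natAbs (κ * ((z.re : ℂ) ^ 2 + (z.im : ℂ) ^ 2) / 4)

theorem polar_re (r θ : ℝ) : (polar r θ).re = r * Real.cos θ := by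
  rw [polar, Complex.re_ofReal_mul, Complex.exp_ofReal_mul_I_re]

theorem polar_im (r θ : ℝ) : (polar r θ).im = r * Real.sin θ := by
  rw [polar, Complex.im_ofReal_mul, Complex.exp_ofReal_mul_I_im]

theorem modeBulk_polar (n : ℤ) (κ : ℂ) (r θ : ℝ) :
    modeBulk n κ (polar r θ) = prof n.natAbs κ r * exp (n * θ * I) := by
  have h : (Real.cos θ : ℂ) ^ 2 + (Real.sin θ : ℂ) ^ 2 = 1 := by
    exact_mod_cast Real.cos_sq_add_sin_sq θ
  rw [modeBulk, prof, ← rotUnit_exp, polar_re, polar_im]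
  push_cast
  push_cast at h
  rw [show κ * ((r * Complex.cos θ) ^ 2 + (r * Complex.sin θ) ^ 2) / 4 = κ * r ^ 2 / 4 by
    linear_combination κ * r ^ 2 / 4 * h,
    show (r : ℂ) * Complex.cos θ + rotUnit n * (r * Complex.sin θ) =
      r * (Complex.cos θ + rotUnit n * Complex.sin θ) by ring, mul_pow]
  ring

theorem polar_norm_arg (z : ℂ) : polar ‖z‖ (arg z) = z := by
  rw [polar, Complex.norm_mul_exp_arg_mul_I]

/-- The expression in `‖z‖` and `arg z` looks singular at the origin and on the cut of `arg`; it is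
(x ± i y)^|n| times an entire function of x² + y², hence smooth. -/
theorem prof_mul_exp_arg (n : ℤ) (κ z : ℂ) :
    prof n.natAbs κ ‖z‖ * exp (n * arg z * I) = modeBulk n κ z := by
  rw [← modeBulk_polar, polar_norm_arg]

theorem contDiff_modeBulk (n : ℤ) (κ : ℂ) {k : WithTop ℕ∞} : ContDiff ℝ k (modeBulk n κ) := by
  have h : ContDiff ℝ k (hyp n.natAbs) := (contDiff_hyp n.natAbs).restrict_scalars ℝ
  have hre : ContDiff ℝ k fun z : ℂ => (z.re : ℂ) :=
    (Complex.ofRealCLM.comp Complex.reCLM).contDiff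
  have him : ContDiff ℝ k fun z : ℂ => (z.im : ℂ) :=
    (Complex.ofRealCLM.comp Complex.imCLM).contDiff
  unfold modeBulk
  fun_prop

/-- Second derivatives from derivatives along lines. -/
theorem second_fderiv_of_line {f g : ℂ → ℂ} {v c : ℂ} (hf : ContDiff ℝ 2 f) (z : ℂ)
    (h1 : ∀ w, HasDerivAt (fun t : ℝ => f (w + t * v)) (g w) 0)
    (h2 : HasDerivAt (fun t : ℝ => g (z + t * v)) c 0) :
    fderiv ℝ (fderiv ℝ f) z v v = c := by
  have hl : ∀ w : ℂ, HasDerivAt (fun t : ℝ => w + t * v) v 0 := fun w => by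
    simpa using ((hasDerivAt_ofReal_pow 1 0).mul_const v).const_add w
  have hg : ∀ w, g w = fderiv ℝ f w v := by
    intro w
    have hw : HasFDerivAt f (fderiv ℝ f w) (w + ((0 : ℝ) : ℂ) * v) := by
      simpa using (hf.differentiable (by norm_num) w).hasFDerivAt
    have h3 : HasDerivAt (fun t : ℝ => f (w + t * v)) (fderiv ℝ f w v) 0 :=
      hw.comp_hasDerivAt (0 : ℝ) (hl w)
    exact (h1 w).unique h3
  have hz : HasFDerivAt (fderiv ℝ f) (fderiv ℝ (fderiv ℝ f) z) (z + ((0 : ℝ) : ℂ) * v) := by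
    simpa using
      ((hf.fderiv_right (m := 1) (by norm_num)).differentiable (by norm_num) z).hasFDerivAt
  have h3 : HasDerivAt (fun t : ℝ => fderiv ℝ f (z + t * v)) (fderiv ℝ (fderiv ℝ f) z v) 0 :=
    hz.comp_hasDerivAt (0 : ℝ) (hl z)
  have h4 : HasDerivAt (fun t : ℝ => fderiv ℝ f (z + t * v) v) (fderiv ℝ (fderiv ℝ f) z v v) 0 := by
    simpa using h3.clm_apply (hasDerivAt_const (0 : ℝ) v)
  simp only [← hg] at h4
  exact h4.unique h2

theorem hasDerivAt_hyp_line (m : ℕ) {κ x y : ℂ} {p q : ℂ} :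
    HasDerivAt (fun t : ℝ => hyp m (κ * ((x + t * p) ^ 2 + (y + t * q) ^ 2) / 4))
      (κ * (x * p + y * q) / 2 * hyp (m + 1) (κ * (x ^ 2 + y ^ 2) / 4)) 0 := by
  have hl : ∀ x p : ℂ, HasDerivAt (fun t : ℝ => x + t * p) p 0 := fun x p => by
    simpa using ((hasDerivAt_ofReal_pow 1 0).mul_const p).const_add x
  have h1 := (((((hl x p).pow 2).add ((hl y q).pow 2)).const_mul κ).div_const 4)
  have h2 : HasDerivAt (hyp m) (hyp (m + 1) (κ * (x ^ 2 + y ^ 2) / 4))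
      (κ * ((x + ((0 : ℝ) : ℂ) * p) ^ 2 + (y + ((0 : ℝ) : ℂ) * q) ^ 2) / 4) := by
    simpa using hasDerivAt_hyp m (κ * (x ^ 2 + y ^ 2) / 4)
  refine (h2.comp (0 : ℝ) h1).congr_deriv ?_
  simp
  ring

/-- With a = ±i and w = κ(x² + y²)/4, the factor (x + a y)^m is harmonic because a² = -1. By Euler's
relation the cross term is κ m (x + a y)^m `hyp (m+1)`, and the second derivatives of the other
factor complete it to κ (x + a y)^m ((m+1) `hyp (m+1)` + w `hyp (m+2)`), which the recurrence
collapses. -/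
theorem laplacian_modeBulk (n : ℤ) (κ z : ℂ) :
    Laplacian.laplacian (modeBulk n κ) z = κ * modeBulk n κ z := by
  have hl : ∀ x p : ℂ, HasDerivAt (fun t : ℝ => x + t * p) p 0 := fun x p => by
    simpa using ((hasDerivAt_ofReal_pow 1 0).mul_const p).const_add x
  have ha := rotUnit_sq n
  set a := rotUnit n
  set m := n.natAbs with hm
  have hline : ∀ (p q : ℝ) (w : ℂ), HasDerivAt (fun t : ℝ => modeBulk n κ (w + t * ⟨p, q⟩))
      (m * ((w.re : ℂ) + a * w.im) ^ (m - 1) * (p + a * q) *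
          hyp m (κ * ((w.re : ℂ) ^ 2 + (w.im : ℂ) ^ 2) / 4) +
        ((w.re : ℂ) + a * w.im) ^ m * (κ * (w.re * p + w.im * q) / 2 *
          hyp (m + 1) (κ * ((w.re : ℂ) ^ 2 + (w.im : ℂ) ^ 2) / 4))) 0 := by
    intro p q w
    have h := ((hl (w.re + a * w.im) (p + a * q)).pow m).mul
      (hasDerivAt_hyp_line m (κ := κ) (x := w.re) (y := w.im) (p := p) (q := q))
    refine (h.congr_deriv ?_).congr_of_eventuallyEq (Filter.Eventually.of_forall fun t => ?_)
    · simp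
    · simp only [modeBulk, Pi.mul_apply, Pi.pow_apply, Complex.add_re, Complex.add_im,
        Complex.re_ofReal_mul, Complex.im_ofReal_mul]
      push_cast
      congr 2
      ring
  have hline2 : ∀ (p q : ℝ), fderiv ℝ (fderiv ℝ (modeBulk n κ)) z ⟨p, q⟩ ⟨p, q⟩ =
      m * ((m - 1 : ℕ) * ((z.re : ℂ) + a * z.im) ^ (m - 1 - 1) * (p + a * q)) * (p + a * q) *
          hyp m (κ * ((z.re : ℂ) ^ 2 + (z.im : ℂ) ^ 2) / 4) +
      2 * (m * ((z.re : ℂ) + a * z.im) ^ (m - 1) * (p + a * q)) *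
          (κ * (z.re * p + z.im * q) / 2 *
            hyp (m + 1) (κ * ((z.re : ℂ) ^ 2 + (z.im : ℂ) ^ 2) / 4)) +
      ((z.re : ℂ) + a * z.im) ^ m * (κ * (p ^ 2 + q ^ 2) / 2 *
          hyp (m + 1) (κ * ((z.re : ℂ) ^ 2 + (z.im : ℂ) ^ 2) / 4) +
        (κ * (z.re * p + z.im * q) / 2) ^ 2 *
          hyp (m + 2) (κ * ((z.re : ℂ) ^ 2 + (z.im : ℂ) ^ 2) / 4)) := by
    intro p q
    refine second_fderiv_of_line (contDiff_modeBulk n κ) z (hline p q) ?_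
    have e1 := ((((hl (z.re + a * z.im) (p + a * q)).pow (m - 1)).const_mul (m : ℂ)).mul_const
      ((p : ℂ) + a * q)).mul
      (hasDerivAt_hyp_line m (κ := κ) (x := z.re) (y := z.im) (p := p) (q := q))
    have e2 := ((hl (z.re + a * z.im) (p + a * q)).pow m).mul
      ((((hl (z.re * p + z.im * q) (p * p + q * q)).const_mul κ).div_const 2).mul
      (hasDerivAt_hyp_line (m + 1) (κ := κ) (x := z.re) (y := z.im) (p := p) (q := q)))
    refine ((e1.add e2).congr_deriv ?_).congr_of_eventuallyEq
      (Filter.Eventually.of_forall fun t => ?_)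
    · simp
      ring
    · simp only [Pi.mul_apply, Pi.pow_apply, Pi.add_apply, Complex.add_re, Complex.add_im,
        Complex.re_ofReal_mul, Complex.im_ofReal_mul]
      push_cast
      ring_nf
  have h1 := hline2 1 0
  have h2 := hline2 0 1
  rw [show (⟨1, 0⟩ : ℂ) = 1 from rfl] at h1
  rw [show (⟨0, 1⟩ : ℂ) = I from rfl] at h2
  rw [laplacian_eq_second_deriv, h1, h2, modeBulk]
  simp only [Complex.ofReal_one, Complex.ofReal_zero]
  have h3 := natCast_mul_pow_pred m ((z.re : ℂ) + a * z.im)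
  have h4 := hyp_recurrence m (κ * ((z.re : ℂ) ^ 2 + (z.im : ℂ) ^ 2) / 4)
  rw [← hm]
  linear_combination (m * ((m - 1 : ℕ) * ((z.re : ℂ) + a * z.im) ^ (m - 1 - 1)) *
      hyp m (κ * ((z.re : ℂ) ^ 2 + (z.im : ℂ) ^ 2) / 4)) * ha +
    κ * hyp (m + 1) (κ * ((z.re : ℂ) ^ 2 + (z.im : ℂ) ^ 2) / 4) * h3 -
    κ * ((z.re : ℂ) + a * z.im) ^ m * h4

theorem hasDerivAt_modeBulk_radius (n : ℤ) (κ : ℂ) {r : ℝ} (hr : r ≠ 0) (θ : ℝ) :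
    HasDerivAt (fun r => modeBulk n κ (polar r θ))
      (profDeriv n.natAbs κ r / r * exp (n * θ * I)) r := by
  simp only [modeBulk_polar]
  exact (hasDerivAt_prof _ κ hr).mul_const _

/-! ### Response of one bulk component -/

/-- The factor `K R / (D R y'(R) + K R y(R))` for `y = prof m κ`. -/
def resp (K D R : ℝ) (κ : ℂ) (m : ℕ) : ℂ :=
  K * R / (D * profDeriv m κ R + K * R * prof m κ R)

theorem conj_resp (K D R : ℝ) (κ : ℂ) (m : ℕ) : conj (resp K D R κ m) = resp K D R (conj κ) m := by
  simp [resp, conj_prof, conj_profDeriv]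

theorem besselI_mul_eq_prof (n : ℤ) {Ω κ : ℂ} (h : Ω ^ 2 = κ) (r : ℝ) :
    besselI n (Ω * r) = (Ω / 2) ^ n.natAbs * prof n.natAbs κ r := by
  rw [besselI_eq_hyp, prof, ← h, show Ω * r / 2 = Ω / 2 * r by ring, mul_pow,
    show (Ω * r) ^ 2 = Ω ^ 2 * r ^ 2 by ring]
  ring

theorem deriv_besselI_mul_eq_profDeriv (n : ℤ) {Ω κ : ℂ} (h : Ω ^ 2 = κ) (r : ℝ) :
    Ω * deriv (besselI n) (Ω * r) * r = (Ω / 2) ^ n.natAbs * profDeriv n.natAbs κ r := by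
  rw [deriv_besselI, profDeriv, ← h, show Ω * r / 2 = Ω / 2 * r by ring,
    show (Ω * r) ^ 2 = Ω ^ 2 * r ^ 2 by ring, pow_succ (Ω / 2 * r)]
  have h1 := natCast_mul_pow_pred n.natAbs (Ω / 2 * r)
  rw [mul_pow _ _ n.natAbs] at h1 ⊢
  linear_combination hyp n.natAbs (Ω ^ 2 * r ^ 2 / 4) * h1

/-- Multiplying numerator and denominator by R produces R y' from Ω I_n', and the common factor
(Ω/2)^|n|, nonzero because Re κ > 0, cancels. -/
theorem coef_eq_resp (n : ℤ) {Ω κ : ℂ} (h : Ω ^ 2 = κ) (hκ : 0 < κ.re) {K D R : ℝ} (hR : 0 < R) :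
    K * besselI n (Ω * R) / (D * Ω * deriv (besselI n) (Ω * R) + K * besselI n (Ω * R)) =
      resp K D R κ n.natAbs * prof n.natAbs κ R := by
  have hΩ : Ω ≠ 0 := by
    rintro rfl
    simp [← h] at hκ
  have hR' : (R : ℂ) ≠ 0 := by exact_mod_cast hR.ne'
  have h1 := besselI_mul_eq_prof n h R
  have h2 := deriv_besselI_mul_eq_profDeriv n h R
  have hp : (Ω / 2) ^ n.natAbs ≠ 0 := pow_ne_zero _ (div_ne_zero hΩ two_ne_zero)
  rw [← mul_div_mul_right _ _ hR', show (D * Ω * deriv (besselI n) (Ω * R) + K * besselI n (Ω * R)) * R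
    = D * (Ω * deriv (besselI n) (Ω * R) * R) + K * besselI n (Ω * R) * R by ring, h2, h1, resp,
    ← mul_div_mul_left (K * R : ℂ) _ hp, div_mul_eq_mul_div]
  congr 1 <;> ring

theorem mode_eq_modeBulk (n : ℤ) {Ω κ : ℂ} (h : Ω ^ 2 = κ) (hκ : 0 < κ.re) {R : ℝ} (hR : 0 < R)
    (c : ℂ) (z : ℂ) :
    c * prof n.natAbs κ R * (besselI n (Ω * ‖z‖) / besselI n (Ω * R)) * exp (n * arg z * I) =
      c * modeBulk n κ z := by
  have hΩ : Ω ≠ 0 := by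
    rintro rfl
    simp [← h] at hκ
  have hp : (Ω / 2) ^ n.natAbs ≠ 0 := pow_ne_zero _ (div_ne_zero hΩ two_ne_zero)
  have hprof := prof_ne_zero n.natAbs hκ hR
  rw [besselI_mul_eq_prof n h, besselI_mul_eq_prof n h, ← prof_mul_exp_arg]
  field_simp

/-! ### Response coefficients of the two bulk components -/

section ParamFacts

variable (P : Params)

/-- `(λ + σ_u) / D_u`. -/
def Params.κu (lam : ℂ) : ℂ := (lam + P.σu) / P.Du

/-- `(λ + σ_v) / D_v`. -/
def Params.κv (lam : ℂ) : ℂ := (lam + P.σv) / P.Dv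

/-- The response factor of `U`. -/
def Params.ru (n : ℤ) (lam : ℂ) : ℂ := resp P.Ku P.Du P.R (P.κu lam) n.natAbs

/-- The response factor of `V`. -/
def Params.rv (n : ℤ) (lam : ℂ) : ℂ := resp P.Kv P.Dv P.R (P.κv lam) n.natAbs

theorem cpow_half_sq (z : ℂ) : (z ^ (1 / 2 : ℂ)) ^ 2 = z := by
  rw [one_div, show (2 : ℂ) = ((2 : ℕ) : ℂ) by norm_num, Complex.cpow_nat_inv_pow z two_ne_zero]

theorem Params.Ωu_sq (lam : ℂ) : P.Ωu lam ^ 2 = P.κu lam := cpow_half_sq _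

theorem Params.Ωv_sq (lam : ℂ) : P.Ωv lam ^ 2 = P.κv lam := cpow_half_sq _

theorem Params.re_κu_pos {lam : ℂ} (h : 0 ≤ lam.re) : 0 < (P.κu lam).re := by
  have := P.Du_pos
  have := P.σu_pos
  rw [Params.κu, Complex.div_ofReal_re, Complex.add_re, Complex.ofReal_re]
  positivity

theorem Params.re_κv_pos {lam : ℂ} (h : 0 ≤ lam.re) : 0 < (P.κv lam).re := by
  have := P.Dv_pos
  have := P.σv_pos
  rw [Params.κv, Complex.div_ofReal_re, Complex.add_re, Complex.ofReal_re]
  positivity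

theorem Params.Du_mul_κu (lam : ℂ) : P.Du * P.κu lam = lam + P.σu :=
  mul_div_cancel₀ _ (by exact_mod_cast P.Du_pos.ne')

theorem Params.Dv_mul_κv (lam : ℂ) : P.Dv * P.κv lam = lam + P.σv :=
  mul_div_cancel₀ _ (by exact_mod_cast P.Dv_pos.ne')

theorem Params.R_ne : (P.R : ℂ) ≠ 0 := by exact_mod_cast P.R_pos.ne'

/-- The boundary balance of the response: `D r y' = K (1 - r y)`. -/
theorem resp_balance (m : ℕ) {κ : ℂ} (hκ : 0 < κ.re) {K D R : ℝ} (hR : 0 < R) (hD : 0 < D)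
    (hK : 0 < K) :
    D * (resp K D R κ m * profDeriv m κ R) = K * R * (1 - resp K D R κ m * prof m κ R) := by
  have h := profDeriv_add_prof_ne_zero m hκ hR hD hK
  rw [resp]
  field_simp
  ring

variable {P} {lam : ℂ}

theorem Params.coefA_eq (h : 0 ≤ lam.re) (n : ℤ) :
    P.coefA n lam = P.ru n lam * prof n.natAbs (P.κu lam) P.R :=
  coef_eq_resp n (P.Ωu_sq lam) (P.re_κu_pos h) P.R_pos

theorem Params.coefB_eq (h : 0 ≤ lam.re) (n : ℤ) :
    P.coefB n lam = P.rv n lam * prof n.natAbs (P.κv lam) P.R :=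
  coef_eq_resp n (P.Ωv_sq lam) (P.re_κv_pos h) P.R_pos

theorem besselI_robin_ne_zero (n : ℤ) {Ω κ : ℂ} (h : Ω ^ 2 = κ) (hκ : 0 < κ.re) {K D R : ℝ}
    (hR : 0 < R) (hD : 0 < D) (hK : 0 < K) :
    D * Ω * deriv (besselI n) (Ω * R) + K * besselI n (Ω * R) ≠ 0 := by
  have hΩ : Ω ≠ 0 := by
    rintro rfl
    simp [← h] at hκ
  have hp : (Ω / 2) ^ n.natAbs ≠ 0 := pow_ne_zero _ (div_ne_zero hΩ two_ne_zero)
  intro h0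
  apply mul_ne_zero hp (profDeriv_add_prof_ne_zero n.natAbs hκ hR hD hK)
  have h1 := besselI_mul_eq_prof n h R
  have h2 := deriv_besselI_mul_eq_profDeriv n h R
  linear_combination (R : ℂ) * h0 - D * h2 - K * R * h1

/-- The quotients defining p_n and q_n are thereby the complements 1 - A_n and 1 - B_n; this needs
the Robin denominator to be nonzero. -/
theorem one_sub_coef (n : ℤ) {Ω κ : ℂ} (h : Ω ^ 2 = κ) (hκ : 0 < κ.re) {K D R : ℝ} (hR : 0 < R)
    (hD : 0 < D) (hK : 0 < K) :
    D * Ω * deriv (besselI n) (Ω * R) /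
      (D * Ω * deriv (besselI n) (Ω * R) + K * besselI n (Ω * R)) =
    1 - resp K D R κ n.natAbs * prof n.natAbs κ R := by
  rw [← coef_eq_resp n h hκ hR]
  have hne := besselI_robin_ne_zero n h hκ hR hD hK
  field_simp
  ring

theorem Params.p_eq (h : 0 ≤ lam.re) (n : ℤ) : P.p n lam = 1 - P.coefA n lam := by
  rw [P.coefA_eq h]
  exact one_sub_coef n (P.Ωu_sq lam) (P.re_κu_pos h) P.R_pos P.Du_pos P.Ku_pos

theorem Params.q_eq (h : 0 ≤ lam.re) (n : ℤ) : P.q n lam = 1 - P.coefB n lam := by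
  rw [P.coefB_eq h]
  exact one_sub_coef n (P.Ωv_sq lam) (P.re_κv_pos h) P.R_pos P.Dv_pos P.Kv_pos

theorem Params.mode_eq (h : 0 ≤ lam.re) (n : ℤ) (φ : Fin 2 → ℂ) :
    P.mode n lam φ = (fun z => P.ru n lam * φ 0 * modeBulk n (P.κu lam) z,
      fun z => P.rv n lam * φ 1 * modeBulk n (P.κv lam) z,
      fun θ : ℝ => φ 0 * exp (n * θ * I), fun θ : ℝ => φ 1 * exp (n * θ * I)) := by
  rw [Params.mode, P.coefA_eq h, P.coefB_eq h]
  congr 2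
  · funext z
    rw [← mode_eq_modeBulk n (P.Ωu_sq lam) (P.re_κu_pos h) P.R_pos]
    ring
  · funext z
    rw [← mode_eq_modeBulk n (P.Ωv_sq lam) (P.re_κv_pos h) P.R_pos]
    ring

theorem re_conj_pos {κ : ℂ} (h : 0 < κ.re) : 0 < (conj κ).re := by
  rwa [Complex.conj_re]

theorem Params.adjMode_eq (h : 0 ≤ lam.re) (n : ℤ) (φ : Fin 2 → ℂ) :
    P.adjMode n lam φ = (fun z => conj (P.ru n lam) * φ 0 * modeBulk n (conj (P.κu lam)) z,
      fun z => conj (P.rv n lam) * φ 1 * modeBulk n (conj (P.κv lam)) z,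
      fun θ : ℝ => φ 0 * exp (n * θ * I), fun θ : ℝ => φ 1 * exp (n * θ * I)) := by
  rw [Params.adjMode, P.coefA_eq h, P.coefB_eq h, map_mul, map_mul, conj_prof, conj_prof]
  congr 2
  · funext z
    rw [← mode_eq_modeBulk n (Ω := conj (P.Ωu lam)) (by rw [← map_pow, P.Ωu_sq])
      (re_conj_pos (P.re_κu_pos h)) P.R_pos]
    ring
  · funext z
    rw [← mode_eq_modeBulk n (Ω := conj (P.Ωv lam)) (by rw [← map_pow, P.Ωv_sq])
      (re_conj_pos (P.re_κv_pos h)) P.R_pos]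
    ring

/-! ### The adjoint eigenfunctions -/

theorem hasDerivAt_exp_mode (n : ℤ) (θ : ℝ) :
    HasDerivAt (fun θ : ℝ => exp (n * θ * I)) (n * I * exp (n * θ * I)) θ := by
  have h := hasDerivAt_exp_angle (-n) θ
  simpa using h

theorem iteratedDeriv_two_exp_mode (n : ℤ) (c : ℂ) (θ : ℝ) :
    iteratedDeriv 2 (fun θ : ℝ => c * exp (n * θ * I)) θ =
      -((n : ℂ) ^ 2 * (c * exp (n * θ * I))) := by
  have h1 : deriv (fun θ : ℝ => c * exp (n * θ * I)) =
      fun θ : ℝ => c * (n * I * exp (n * θ * I)) :=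
    funext fun θ => ((hasDerivAt_exp_mode n θ).const_mul c).deriv
  rw [iteratedDeriv_succ, iteratedDeriv_one, h1,
    (((hasDerivAt_exp_mode n θ).const_mul (n * I)).const_mul c).deriv]
  linear_combination c * n ^ 2 * exp (n * θ * I) * I_sq

theorem periodic_exp_mode (n : ℤ) (c : ℂ) :
    Function.Periodic (fun θ : ℝ => c * exp (n * θ * I)) (2 * Real.pi) := by
  intro θ
  have h := exp_int_mul_two_pi (-n)
  simp only
  rw [show (n : ℂ) * ((θ + 2 * Real.pi : ℝ) : ℂ) * I =
    n * θ * I + -((-n : ℤ) * ((2 * Real.pi : ℝ) : ℂ) * I) by push_cast; ring, Complex.exp_add, h,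
    mul_one]

theorem contDiff_exp_mode (n : ℤ) (c : ℂ) {k : WithTop ℕ∞} :
    ContDiff ℝ k (fun θ : ℝ => c * exp (n * θ * I)) := by
  have h : ContDiff ℝ k fun θ : ℝ => (θ : ℂ) := Complex.ofRealCLM.contDiff
  fun_prop

theorem radial_modeBulk (n : ℤ) {κ : ℂ} (hκ : 0 < κ.re) {K D R : ℝ} (hR : 0 < R) (hD : 0 < D)
    (hK : 0 < K) (c : ℂ) (θ : ℝ) :
    D * derivWithin (fun r : ℝ => resp K D R κ n.natAbs * c * modeBulk n κ (polar r θ))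
      (Set.Icc 0 R) R =
    K * (c * exp (n * θ * I) - resp K D R κ n.natAbs * c * modeBulk n κ (polar R θ)) := by
  have h := (hasDerivAt_modeBulk_radius n κ hR.ne' θ).const_mul (resp K D R κ n.natAbs * c)
  rw [h.hasDerivWithinAt.derivWithin (uniqueDiffOn_Icc hR R ⟨hR.le, le_rfl⟩), modeBulk_polar]
  have hR' : (R : ℂ) ≠ 0 := by exact_mod_cast hR.ne'
  have hb := resp_balance n.natAbs hκ hR hD hK
  field_simp
  linear_combination c * hb

/-- The bulk parts are radial solutions for conj κ, so the bulk equations are automatic. The Robin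
conditions are the balance of `resp`, and the two surface equations are the components of the kernel
relation for the adjoint matrix. -/
theorem Params.isAdjointEigen_adjMode {e : Fin 2 → ℝ} (h : 0 ≤ lam.re) {n : ℤ} {φ : Fin 2 → ℂ}
    (hφ : (P.Phi e n lam)ᴴ *ᵥ φ = 0) :
    P.IsAdjointEigen e (conj lam) (P.adjMode n lam φ) := by
  have hφ0 := congrFun hφ 0
  have hφ1 := congrFun hφ 1
  simp [Matrix.mulVec, dotProduct, Fin.sum_univ_two, Params.Phi, Params.jac,
    P.p_eq h, P.q_eq h, P.coefA_eq h, P.coefB_eq h, conj_prof] at hφ0 hφ1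
  have hU : ∀ (κ c : ℂ) {k : WithTop ℕ∞}, ContDiff ℝ k fun z => c * modeBulk n κ z :=
    fun κ c {k} => contDiff_const.mul (contDiff_modeBulk n κ)
  have hL : ∀ (κ c z : ℂ), Laplacian.laplacian (fun z => c * modeBulk n κ z) z =
      c * (κ * modeBulk n κ z) := by
    intro κ c z
    rw [← laplacian_modeBulk]
    exact InnerProductSpace.laplacian_smul c (contDiff_modeBulk n κ).contDiffAt
  rw [P.adjMode_eq h]
  refine ⟨⟨(hU _ _).contDiffOn, (hU _ _).contDiffOn, (hU _ _).contDiffOn, (hU _ _).contDiffOn,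
    contDiff_exp_mode n _, contDiff_exp_mode n _, periodic_exp_mode n _, periodic_exp_mode n _⟩,
    ⟨fun z _ => ⟨?_, ?_⟩, fun θ => ⟨?_, ?_⟩⟩, fun θ => ⟨?_, ?_⟩⟩
  · simp only [Params.adjOp, Params.linOpOf, State.U, hL, Prod.smul_fst, Pi.smul_apply, smul_eq_mul]
    have h1 := congrArg conj (P.Du_mul_κu lam)
    simp only [map_mul, map_add, Complex.conj_ofReal] at h1
    linear_combination (conj (P.ru n lam) * φ 0 * modeBulk n (conj (P.κu lam)) z) * h1
  · simp only [Params.adjOp, Params.linOpOf, State.V, hL, Prod.smul_fst, Prod.smul_snd,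
      Pi.smul_apply, smul_eq_mul]
    have h1 := congrArg conj (P.Dv_mul_κv lam)
    simp only [map_mul, map_add, Complex.conj_ofReal] at h1
    linear_combination (conj (P.rv n lam) * φ 1 * modeBulk n (conj (P.κv lam)) z) * h1
  · simp only [Params.adjOp, Params.linOpOf, State.U, State.u, State.v, Prod.smul_fst,
      Prod.smul_snd, Pi.smul_apply, smul_eq_mul, iteratedDeriv_two_exp_mode, modeBulk_polar]
    simp [Params.jac]
    linear_combination exp (n * θ * I) * hφ0
  · simp only [Params.adjOp, Params.linOpOf, State.V, State.u, State.v, Prod.smul_snd,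
      Pi.smul_apply, smul_eq_mul, iteratedDeriv_two_exp_mode, modeBulk_polar]
    simp [Params.jac]
    linear_combination exp (n * θ * I) * hφ1
  · simp only [Params.ru, conj_resp]
    exact radial_modeBulk n (re_conj_pos (P.re_κu_pos h)) P.R_pos P.Du_pos P.Ku_pos _ θ
  · simp only [Params.rv, conj_resp, Pi.zero_apply, add_zero]
    exact radial_modeBulk n (re_conj_pos (P.re_κv_pos h)) P.R_pos P.Dv_pos P.Kv_pos _ θ

/-! ### Projection on a Fourier mode -/

/-- The integral `∫₀ᴿ y(r) (∫₀^{2π} f e^{-inθ} dθ) r dr` with `y = prof |n| κ`. -/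
def radialInt (n : ℤ) (κ : ℂ) (R : ℝ) (f : ℂ → ℂ) : ℂ :=
  ∫ r in (0 : ℝ)..R, r * prof n.natAbs κ r * fint n (fun θ => f (polar r θ))

/-- The vector of surface Fourier integrals. -/
def fvec (n : ℤ) (W : State) : Fin 2 → ℂ := ![fint n W.u, fint n W.v]

/-- Green's identity leaves the normal derivative and the trace of U. The Robin condition replaces
the former, and the scaling by `resp` is chosen so that the trace ends up with coefficient R K for
every n and κ. The surface equation carries the same trace with the opposite sign. -/
theorem bulk_projection {U f : ℂ → ℂ} {u η : ℝ → ℂ} {a κ : ℂ} {K D R : ℝ} (hR : 0 < R) (hD : 0 < D)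
    (hK : 0 < K) (hκ : 0 < κ.re) (ha : D * κ = a)
    (hU2 : ContDiffOn ℝ 2 U (Metric.ball 0 R)) (hU1 : ContDiffOn ℝ 1 U (Metric.closedBall 0 R))
    (hf : ContinuousOn f (Metric.closedBall 0 R)) (hu : Continuous u) (hη : Continuous η)
    (heq : ∀ z ∈ Metric.ball (0 : ℂ) R, a * U z - D * Laplacian.laplacian U z = f z)
    (hbc : ∀ θ : ℝ, D * derivWithin (fun r : ℝ => U (polar r θ)) (Set.Icc 0 R) R =
      K * (u θ - U (polar R θ)) + η θ) (n : ℤ) :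
    resp K D R κ n.natAbs * radialInt n κ R f = R * (K * fint n (fun θ => U (polar R θ)) -
      resp K D R κ n.natAbs * prof n.natAbs κ R * (K * fint n u + fint n η)) := by
  have hg := bulk_green hR hD.ne' ha hU2 hU1 hf heq n
  have hUc : Continuous fun θ => U (polar R θ) :=
    (continuousOn_comp_polar hU1.continuousOn).comp_continuous
      (f := fun θ : ℝ => (R, θ)) (by fun_prop) fun θ => ⟨⟨hR.le, le_rfl⟩, Set.mem_univ _⟩
  have hb : D * fint n (fun θ => derivWithin (fun r : ℝ => U (polar r θ)) (Set.Icc 0 R) R) =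
      K * (fint n u - fint n (fun θ => U (polar R θ))) + fint n η := by
    rw [← fint_const_mul]
    simp only [hbc]
    rw [fint_add n (u := fun θ => K * (u θ - U (polar R θ)))
      (continuous_const.mul (hu.sub hUc)) hη, fint_const_mul]
    have e : (fun θ => u θ - U (polar R θ)) = fun θ => 1 * u θ + (-1) * U (polar R θ) := by
      funext θ
      ring
    rw [e, fint_linear n _ _ hu hUc]
    ring
  have hbal := resp_balance n.natAbs hκ hR hD hK
  rw [radialInt, hg]
  linear_combination -(R * prof n.natAbs κ R * resp K D R κ n.natAbs) * hb +
    fint n (fun θ => U (polar R θ)) * hbal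

theorem fint_iteratedDeriv_two (n : ℤ) {u : ℝ → ℂ} (hu : ContDiff ℝ 2 u)
    (hp : Function.Periodic u (2 * Real.pi)) :
    fint n (iteratedDeriv 2 u) = -(n : ℂ) ^ 2 * fint n u := by
  have h1 : ∀ θ, HasDerivAt u (deriv u θ) θ := fun θ =>
    (hu.differentiable (by norm_num) θ).hasDerivAt
  have h2 : ∀ θ, HasDerivAt (deriv u) (iteratedDeriv 2 u θ) θ := fun θ => by
    rw [iteratedDeriv_succ, iteratedDeriv_one]
    have : ContDiff ℝ 1 (deriv u) := ((contDiff_succ_iff_deriv (n := 1)).1 hu).2.2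
    exact (this.differentiable (by norm_num) θ).hasDerivAt
  refine fint_second_deriv n h1 h2 (hu.continuous_iteratedDeriv 2 (by norm_num))
    (by simpa using hp 0) ?_
  -- The derivative inherits the period because the translate of u is u itself.
  have h3 : (fun θ => u (θ + 2 * Real.pi)) = u := funext hp
  have h4 := deriv_comp_add_const (f := u) (a := 2 * Real.pi) (x := 0)
  rw [h3] at h4
  simpa using h4.symm

/-- The `n`-th Fourier mode of a solution of `λ X - 𝓛 X = F` with flux `η`. -/
theorem Params.Solves.projection {e : Fin 2 → ℝ} {X F : State} {η : ℝ → ℂ} (h : 0 ≤ lam.re)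
    (hX : P.Solves e lam X F η) (hFU : ContinuousOn F.U (Metric.closedBall 0 P.R))
    (hFV : ContinuousOn F.V (Metric.closedBall 0 P.R)) (hη : Continuous η) (n : ℤ) :
    P.ru n lam * radialInt n (P.κu lam) P.R F.U + P.R * fint n F.u =
      -(P.R * (P.Phi e n lam *ᵥ fvec n X) 0) ∧
    P.rv n lam * radialInt n (P.κv lam) P.R F.V + P.R * fint n F.v +
      P.R * (P.coefB n lam * fint n η) = -(P.R * (P.Phi e n lam *ᵥ fvec n X) 1) := by
  obtain ⟨hreg, ⟨hbulk, hsurf⟩, hbc⟩ := hX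
  have hR := P.R_pos
  have hcU : ∀ {U : ℂ → ℂ}, ContDiffOn ℝ 1 U (Metric.closedBall 0 P.R) →
      Continuous fun θ => U (polar P.R θ) := fun hU =>
    (continuousOn_comp_polar hU.continuousOn).comp_continuous
      (f := fun θ : ℝ => (P.R, θ)) (by fun_prop) fun θ => ⟨⟨hR.le, le_rfl⟩, Set.mem_univ _⟩
  have hcU1 := hcU hreg.U_closed
  have hcV1 := hcU hreg.V_closed
  have hcu := hreg.u_smooth.continuous
  have hcv := hreg.v_smooth.continuous
  have hcu2 := hreg.u_smooth.continuous_iteratedDeriv 2 (by norm_num)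
  have hcv2 := hreg.v_smooth.continuous_iteratedDeriv 2 (by norm_num)
  have pU := bulk_projection hR P.Du_pos P.Ku_pos (P.re_κu_pos h) (P.Du_mul_κu lam) hreg.U_inside
    hreg.U_closed hFU hcu (continuous_const (y := (0 : ℂ))) (fun z hz => by
      rw [← (hbulk z hz).1]
      simp [Params.linOp, Params.linOpOf, State.U]
      ring) (fun θ => (hbc θ).1.trans (add_zero _).symm) n
  have pV := bulk_projection hR P.Dv_pos P.Kv_pos (P.re_κv_pos h) (P.Dv_mul_κv lam) hreg.V_inside
    hreg.V_closed hFV hcv hη (fun z hz => by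
      rw [← (hbulk z hz).2]
      simp [Params.linOp, Params.linOpOf, State.V]
      ring) (fun θ => (hbc θ).2) n
  have h0 : fint n (fun _ => (0 : ℂ)) = 0 := by simp [fint]
  rw [h0] at pU
  have su : fint n F.u = (lam + P.Ku - P.jac e 0 0) * fint n X.u -
      P.du / (P.R : ℂ) ^ 2 * fint n (iteratedDeriv 2 X.u) - P.jac e 0 1 * fint n X.v -
      P.Ku * fint n (fun θ => X.U (polar P.R θ)) := by
    have e1 : F.u = fun θ => (lam + P.Ku - P.jac e 0 0) * X.u θ +
        (-(P.du / (P.R : ℂ) ^ 2) * iteratedDeriv 2 X.u θ + (-P.jac e 0 1 * X.v θ +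
          -P.Ku * X.U (polar P.R θ))) := by
      funext θ
      rw [← (hsurf θ).1]
      simp [Params.linOp, Params.linOpOf, State.u, State.U]
      ring
    rw [e1, fint_add n (u := fun θ => (lam + P.Ku - P.jac e 0 0) * X.u θ)
      (v := fun θ => -(P.du / (P.R : ℂ) ^ 2) * iteratedDeriv 2 X.u θ + (-P.jac e 0 1 * X.v θ +
          -P.Ku * X.U (polar P.R θ))) (by fun_prop) (by fun_prop),
      fint_add n (u := fun θ => -(P.du / (P.R : ℂ) ^ 2) * iteratedDeriv 2 X.u θ)
      (v := fun θ => -P.jac e 0 1 * X.v θ + -P.Ku * X.U (polar P.R θ)) (by fun_prop) (by fun_prop),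
      fint_add n (u := fun θ => -P.jac e 0 1 * X.v θ) (v := fun θ => -P.Ku * X.U (polar P.R θ))
      (by fun_prop) (by fun_prop), fint_const_mul, fint_const_mul, fint_const_mul, fint_const_mul]
    ring
  have sv : fint n F.v = (lam + P.Kv - P.jac e 1 1) * fint n X.v -
      P.dv / (P.R : ℂ) ^ 2 * fint n (iteratedDeriv 2 X.v) - P.jac e 1 0 * fint n X.u -
      P.Kv * fint n (fun θ => X.V (polar P.R θ)) := by
    have e1 : F.v = fun θ => (lam + P.Kv - P.jac e 1 1) * X.v θ +
        (-(P.dv / (P.R : ℂ) ^ 2) * iteratedDeriv 2 X.v θ + (-P.jac e 1 0 * X.u θ +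
          -P.Kv * X.V (polar P.R θ))) := by
      funext θ
      rw [← (hsurf θ).2]
      simp [Params.linOp, Params.linOpOf, State.v, State.V]
      ring
    rw [e1, fint_add n (u := fun θ => (lam + P.Kv - P.jac e 1 1) * X.v θ)
      (v := fun θ => -(P.dv / (P.R : ℂ) ^ 2) * iteratedDeriv 2 X.v θ + (-P.jac e 1 0 * X.u θ +
          -P.Kv * X.V (polar P.R θ))) (by fun_prop) (by fun_prop),
      fint_add n (u := fun θ => -(P.dv / (P.R : ℂ) ^ 2) * iteratedDeriv 2 X.v θ)
      (v := fun θ => -P.jac e 1 0 * X.u θ + -P.Kv * X.V (polar P.R θ)) (by fun_prop) (by fun_prop),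
      fint_add n (u := fun θ => -P.jac e 1 0 * X.u θ) (v := fun θ => -P.Kv * X.V (polar P.R θ))
      (by fun_prop) (by fun_prop), fint_const_mul, fint_const_mul, fint_const_mul, fint_const_mul]
    ring
  -- The bulk traces in `pU` and `pV` cancel those in `su` and `sv`; only surface Fourier integrals
  -- of X remain.
  rw [su, sv, fint_iteratedDeriv_two n hreg.u_smooth hreg.u_periodic,
    fint_iteratedDeriv_two n hreg.v_smooth hreg.v_periodic, Params.ru, Params.rv, pU, pV,
    P.coefB_eq h]
  simp only [Matrix.mulVec, dotProduct, Fin.sum_univ_two, Params.Phi, fvec, P.p_eq h, P.q_eq h,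
    P.coefA_eq h, P.coefB_eq h, Matrix.sub_apply, Matrix.smul_apply, Matrix.diagonal_apply,
    Matrix.one_apply]
  simp [Params.ru, Params.rv]
  constructor <;> ring

/-- The pairing with an adjoint eigenfunction in terms of Fourier integrals. -/
theorem Params.inner_adjMode (h : 0 ≤ lam.re) (n : ℤ) (φ : Fin 2 → ℂ) {F : State}
    (hFU : ContinuousOn F.U (Metric.closedBall 0 P.R))
    (hFV : ContinuousOn F.V (Metric.closedBall 0 P.R)) (hu : Continuous F.u) (hv : Continuous F.v) :
    P.inner (P.adjMode n lam φ) F =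
      conj (φ 0) * (P.ru n lam * radialInt n (P.κu lam) P.R F.U + P.R * fint n F.u) +
      conj (φ 1) * (P.rv n lam * radialInt n (P.κv lam) P.R F.V + P.R * fint n F.v) := by
  have hR := P.R_pos
  have hexp : ∀ θ : ℝ, conj (exp (n * θ * I)) = exp (-(n * θ * I)) := fun θ => by
    rw [← Complex.exp_conj]
    simp
  have hmb : ∀ κ : ℂ, ∀ r θ : ℝ, conj (modeBulk n (conj κ) (polar r θ)) =
      prof n.natAbs κ r * exp (-(n * θ * I)) := fun κ r θ => by
    rw [modeBulk_polar, map_mul, conj_prof, Complex.conj_conj, hexp]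
  have he : Continuous fun p : ℝ × ℝ => exp (-(n * p.2 * I)) := by fun_prop
  have hpu := continuous_prof n.natAbs (P.κu lam)
  have hpv := continuous_prof n.natAbs (P.κv lam)
  rw [P.adjMode_eq h, Params.inner]
  simp only [State.U, State.V, State.u, State.v, map_mul, hmb, hexp, Complex.conj_conj]
  -- `Params.inner` integrates first in r, `radialInt` first in θ; Fubini applies since the
  -- integrand is continuous on a compact rectangle.
  rw [MeasureTheory.intervalIntegral_intervalIntegral_swap]
  · have e1 : ∀ r : ℝ, r ∈ Set.uIcc 0 P.R → (∫ θ in (0 : ℝ)..(2 * Real.pi),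
        (P.ru n lam * conj (φ 0) * (prof n.natAbs (P.κu lam) r * exp (-(n * θ * I))) *
          F.1 (polar r θ) +
        P.rv n lam * conj (φ 1) * (prof n.natAbs (P.κv lam) r * exp (-(n * θ * I))) *
          F.2.1 (polar r θ)) * r) =
        conj (φ 0) * P.ru n lam * (r * prof n.natAbs (P.κu lam) r *
          fint n (fun θ => F.1 (polar r θ))) +
        conj (φ 1) * P.rv n lam * (r * prof n.natAbs (P.κv lam) r *
          fint n (fun θ => F.2.1 (polar r θ))) := by
      intro r hr
      rw [Set.uIcc_of_le hR.le] at hr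
      have hcf : ∀ {f : ℂ → ℂ}, ContinuousOn f (Metric.closedBall 0 P.R) →
          Continuous fun θ : ℝ => f (polar r θ) := fun hf =>
        (continuousOn_comp_polar hf).comp_continuous (f := fun θ : ℝ => (r, θ)) (by fun_prop)
          fun θ => ⟨hr, Set.mem_univ _⟩
      have h1 := hcf hFU
      have h2 := hcf hFV
      rw [← mul_assoc, ← mul_assoc, ← mul_assoc, ← mul_assoc, ← fint_linear n _ _ h1 h2, fint]
      refine intervalIntegral.integral_congr fun θ _ => ?_
      ring
    rw [intervalIntegral.integral_congr e1, intervalIntegral.integral_add,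
      intervalIntegral.integral_const_mul, intervalIntegral.integral_const_mul]
    · have e2 : ∫ θ in (0 : ℝ)..(2 * Real.pi), (conj (φ 0) * exp (-(n * θ * I)) * F.2.2.1 θ +
          conj (φ 1) * exp (-(n * θ * I)) * F.2.2.2 θ) * P.R =
          P.R * (conj (φ 0) * fint n F.u + conj (φ 1) * fint n F.v) := by
        rw [← fint_linear n _ _ hu hv, ← fint_const_mul, fint]
        refine intervalIntegral.integral_congr fun θ _ => ?_
        ring
      rw [e2, radialInt, radialInt]
      ring
    all_goals
      apply ContinuousOn.intervalIntegrable
      rw [Set.uIcc_of_le hR.le]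
    · exact continuousOn_const.mul (ContinuousOn.mul (by fun_prop)
        (continuousOn_integral_param hR.le _ _ ((continuousOn_comp_polar hFU).mul he.continuousOn)))
    · exact continuousOn_const.mul (ContinuousOn.mul (by fun_prop)
        (continuousOn_integral_param hR.le _ _ ((continuousOn_comp_polar hFV).mul he.continuousOn)))
  · have hc : ∀ {f : ℂ → ℂ}, ContinuousOn f (Metric.closedBall 0 P.R) →
        ContinuousOn (fun p : ℝ × ℝ => f (polar p.2 p.1))
          (Set.Icc 0 (2 * Real.pi) ×ˢ Set.Icc 0 P.R) := fun hf =>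
      (continuousOn_comp_polar hf).comp (f := fun p : ℝ × ℝ => (p.2, p.1)) (by fun_prop)
        fun p hp => ⟨hp.2, Set.mem_univ _⟩
    have h1 := hc hFU
    have h2 := hc hFV
    have hcont : ContinuousOn (Function.uncurry fun θ r : ℝ =>
        (P.ru n lam * conj (φ 0) * (prof n.natAbs (P.κu lam) r * exp (-(n * θ * I))) *
          F.1 (polar r θ) +
        P.rv n lam * conj (φ 1) * (prof n.natAbs (P.κv lam) r * exp (-(n * θ * I))) *
          F.2.1 (polar r θ)) * r) (Set.Icc 0 (2 * Real.pi) ×ˢ Set.Icc 0 P.R) := by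
      have a1 : Continuous fun p : ℝ × ℝ => P.ru n lam * conj (φ 0) *
        (prof n.natAbs (P.κu lam) p.2 * exp (-(n * p.1 * I))) := by fun_prop
      have a2 : Continuous fun p : ℝ × ℝ => P.rv n lam * conj (φ 1) *
        (prof n.natAbs (P.κv lam) p.2 * exp (-(n * p.1 * I))) := by fun_prop
      have a3 : Continuous fun p : ℝ × ℝ => (p.2 : ℂ) := by fun_prop
      exact ((a1.continuousOn.mul h1).add (a2.continuousOn.mul h2)).mul a3.continuousOn
    refine (hcont.integrableOn_compact (isCompact_Icc.prod isCompact_Icc)).mono_set ?_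
    rw [Set.uIoc_of_le Real.two_pi_pos.le, Set.uIoc_of_le hR.le]
    exact Set.prod_mono Set.Ioc_subset_Icc_self Set.Ioc_subset_Icc_self

end ParamFacts

/-! ### Time harmonics -/

theorem harmonic_exp {ω : ℝ} (hω : 0 < ω) (k j : ℤ) (c : ℂ) :
    harmonic ω k (fun t => c * exp (j * ω * t * I)) = if j = k then c else 0 := by
  have hω' : (ω : ℂ) ≠ 0 := by exact_mod_cast hω.ne'
  have hpi : (Real.pi : ℂ) ≠ 0 := by exact_mod_cast Real.pi_ne_zero
  have e : ∀ t : ℝ, c * exp (j * ω * t * I) * exp (-(k * ω * t * I)) =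
      c * exp ((((j - k : ℤ) : ℂ) * ω * I) * t) := fun t => by
    rw [mul_assoc, ← Complex.exp_add]
    congr 2
    push_cast
    ring
  rw [harmonic]
  simp only [e]
  rw [intervalIntegral.integral_const_mul]
  split_ifs with h
  · subst h
    simp
    field_simp
  · have hne : ((j - k : ℤ) : ℂ) * ω * I ≠ 0 :=
      mul_ne_zero (mul_ne_zero (by exact_mod_cast sub_ne_zero.2 h) hω') I_ne_zero
    rw [integral_exp_mul_complex hne]
    have h1 : exp (((j - k : ℤ) : ℂ) * ω * I * ((2 * Real.pi / ω : ℝ) : ℂ)) = 1 := by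
      rw [Complex.exp_eq_one_iff]
      refine ⟨j - k, ?_⟩
      push_cast
      field_simp
    rw [h1]
    simp

theorem harmonic_add {ω : ℝ} (k : ℤ) {h h' : ℝ → ℂ} (hh : Continuous h) (hh' : Continuous h') :
    harmonic ω k (fun t => h t + h' t) = harmonic ω k h + harmonic ω k h' := by
  have he : Continuous fun t : ℝ => exp (-(k * ω * t * I)) := by fun_prop
  rw [harmonic, harmonic, harmonic, ← mul_add, ← intervalIntegral.integral_add]
  · simp only [add_mul]
  · exact (hh.mul he).intervalIntegrable _ _
  · exact (hh'.mul he).intervalIntegrable _ _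

theorem harmonic_sum {ω : ℝ} (hω : 0 < ω) (k : ℤ) (s : Finset ℤ) (c : ℤ → ℂ) :
    harmonic ω k (fun t => ∑ j ∈ s, c j * exp (j * ω * t * I)) = if k ∈ s then c k else 0 := by
  classical
  induction s using Finset.induction_on with
  | empty => simp [harmonic]
  | insert a s ha ih =>
    simp only [Finset.sum_insert ha]
    rw [harmonic_add k (by fun_prop) (by fun_prop), ih, harmonic_exp hω]
    by_cases h : a = k
    · subst h
      simp [ha]
    · have h' : k ≠ a := fun h2 => h h2.symm
      simp [h, h']

/-- The coefficients of `1` and `e^{iωt}` of a trigonometric polynomial of degree three. -/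
theorem harmonic_laurent {ω : ℝ} (hω : 0 < ω) {h : ℝ → ℂ} {c0 c1 c2 c3 d1 d2 d3 : ℂ}
    (hh : ∀ t : ℝ, h t = c0 + c1 * exp (ω * t * I) + c2 * exp (ω * t * I) ^ 2 +
      c3 * exp (ω * t * I) ^ 3 + d1 * exp (-(ω * t * I)) + d2 * exp (-(ω * t * I)) ^ 2 +
      d3 * exp (-(ω * t * I)) ^ 3) : harmonic ω 0 h = c0 ∧ harmonic ω 1 h = c1 := by
  -- The final default value serves j = -3, the only index of the sum not listed before it.
  set c : ℤ → ℂ := fun j => if j = 0 then c0 else if j = 1 then c1 else if j = 2 then c2 else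
    if j = 3 then c3 else if j = -1 then d1 else if j = -2 then d2 else d3 with hc
  have e : h = fun t : ℝ => ∑ j ∈ ({0, 1, 2, 3, -1, -2, -3} : Finset ℤ),
      c j * exp (j * ω * t * I) := by
    funext t
    rw [hh t]
    simp [hc, Finset.sum_insert]
    simp only [← Complex.exp_nat_mul]
    push_cast
    ring_nf
  rw [e, harmonic_sum hω, harmonic_sum hω]
  simp [hc]

/-- E and E' stand for e^{iωt} and e^{-iωt}. The vectors a, a', s are the parts of the first-order
field at frequencies 1, -1, 0, and w, b, b', p, p' those of the second-order field at 0, 1, -1, 2,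
-2. -/
theorem quadForm_expand (h : ℝ → ℝ → ℝ) (e : Fin 2 → ℝ) (a a' s w b b' p p' : Fin 2 → ℂ) {E E' : ℂ}
    (hE : E * E' = 1) :
    quadForm h e (E • a + E' • a' + s) (w + E • b + E' • b' + E ^ 2 • p + E' ^ 2 • p') =
      (quadForm h e a b' + quadForm h e a' b + quadForm h e s w) +
      (quadForm h e a w + quadForm h e s b + quadForm h e a' p) * E +
      (quadForm h e a b + quadForm h e s p) * E ^ 2 + quadForm h e a p * E ^ 3 +
      (quadForm h e a' w + quadForm h e s b' + quadForm h e a p') * E' +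
      (quadForm h e a' b' + quadForm h e s p') * E' ^ 2 + quadForm h e a' p' * E' ^ 3 := by
  -- These are the products in which E meets E'; they account for the whole difference between the
  -- plain expansion and the collected one.
  have h1 : (quadForm h e a b' + quadForm h e a' b + quadForm h e a p' * E' +
      quadForm h e a' p * E) * (E * E' - 1) = 0 := by
    rw [hE, sub_self, mul_zero]
  simp only [quadForm, Pi.add_apply, Pi.smul_apply, smul_eq_mul] at h1 ⊢
  linear_combination h1

theorem cubicForm_expand (h : ℝ → ℝ → ℝ) (e : Fin 2 → ℝ) (a a' s : Fin 2 → ℂ) {E E' : ℂ}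
    (hE : E * E' = 1) :
    cubicForm h e (E • a + E' • a' + s) (E • a + E' • a' + s) (E • a + E' • a' + s) =
      (cubicForm h e s s s + 6 * cubicForm h e a a' s) +
      (3 * cubicForm h e a s s + 3 * cubicForm h e a a a') * E +
      (3 * cubicForm h e a a s) * E ^ 2 + cubicForm h e a a a * E ^ 3 +
      (3 * cubicForm h e a' s s + 3 * cubicForm h e a' a' a) * E' +
      (3 * cubicForm h e a' a' s) * E' ^ 2 + cubicForm h e a' a' a' * E' ^ 3 := by
  have h1 : (6 * cubicForm h e a a' s + 3 * cubicForm h e a a a' * E +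
      3 * cubicForm h e a' a' a * E') * (E * E' - 1) = 0 := by
    rw [hE, sub_self, mul_zero]
  simp only [cubicForm, Pi.add_apply, Pi.smul_apply, smul_eq_mul] at h1 ⊢
  linear_combination h1

theorem exp_mul_exp_neg (z : ℂ) : exp z * exp (-z) = 1 := by
  rw [← Complex.exp_add, add_neg_cancel, Complex.exp_zero]

/-- The harmonics of the surface nonlinearity along a time-periodic curve. -/
theorem harmonic_nonlin {ω : ℝ} (hω : 0 < ω) (h : ℝ → ℝ → ℝ) (e : Fin 2 → ℝ)
    (a a' s w b b' p p' : Fin 2 → ℂ) (y0 y1 y2 : ℂ) {F : ℝ → ℂ}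
    (hF : ∀ t : ℝ, F t = (y0 + y1 * exp (ω * t * I) + y2 * exp (-(ω * t * I))) +
      2 * quadForm h e (exp (ω * t * I) • a + exp (-(ω * t * I)) • a' + s)
        (w + exp (ω * t * I) • b + exp (-(ω * t * I)) • b' + exp (ω * t * I) ^ 2 • p +
          exp (-(ω * t * I)) ^ 2 • p') +
      cubicForm h e (exp (ω * t * I) • a + exp (-(ω * t * I)) • a' + s)
        (exp (ω * t * I) • a + exp (-(ω * t * I)) • a' + s)
        (exp (ω * t * I) • a + exp (-(ω * t * I)) • a' + s)) :
    harmonic ω 0 F = y0 + 2 * (quadForm h e a b' + quadForm h e a' b + quadForm h e s w) +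
      (cubicForm h e s s s + 6 * cubicForm h e a a' s) ∧
    harmonic ω 1 F = y1 + 2 * (quadForm h e a w + quadForm h e s b + quadForm h e a' p) +
      3 * (cubicForm h e a s s + cubicForm h e a a a') := by
  refine harmonic_laurent hω
    (c2 := 2 * (quadForm h e a b + quadForm h e s p) + 3 * cubicForm h e a a s)
    (c3 := 2 * quadForm h e a p + cubicForm h e a a a)
    (d1 := y2 + 2 * (quadForm h e a' w + quadForm h e s b' + quadForm h e a p') +
      3 * (cubicForm h e a' s s + cubicForm h e a' a' a))
    (d2 := 2 * (quadForm h e a' b' + quadForm h e s p') + 3 * cubicForm h e a' a' s)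
    (d3 := 2 * quadForm h e a' p' + cubicForm h e a' a' a') fun t => ?_
  rw [hF, quadForm_expand h e a a' s w b b' p p' (exp_mul_exp_neg _),
    cubicForm_expand h e a a' s (exp_mul_exp_neg _)]
  ring

/-! ### Harmonics of the third-order forcing -/

section ThirdOrder

theorem deriv_slow {A₀ An : ℝ → ℂ} {τ : ℝ} (h0 : DifferentiableAt ℝ A₀ τ)
    (hn : DifferentiableAt ℝ An τ) (E E' m m' mn mm : ℂ) :
    deriv (fun s => A₀ s * E * m + conj (A₀ s) * E' * m' + (An s * mn + conj (An s) * mm)) τ =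
      deriv A₀ τ * E * m + conj (deriv A₀ τ) * E' * m' +
        (deriv An τ * mn + conj (deriv An τ) * mm) := by
  have d0 := h0.hasDerivAt
  have dn := hn.hasDerivAt
  exact ((((d0.mul_const E).mul_const m).add (((hasDerivAt_conj d0).mul_const E').mul_const m')).add
    ((dn.mul_const mn).add ((hasDerivAt_conj dn).mul_const mm))).deriv

theorem deriv_fast (ω : ℝ) (c c' m m' k : ℂ) (t : ℝ) :
    deriv (fun t : ℝ => c * exp (ω * t * I) * m + c' * exp (-(ω * t * I)) * m' + k) t =
      ω * I * (c * m) * exp (ω * t * I) - ω * I * (c' * m') * exp (-(ω * t * I)) := by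
  have h : HasDerivAt (fun t : ℝ => (ω * t * I : ℂ)) (ω * I) t := by
    simpa using (((hasDerivAt_ofReal_pow 1 t).const_mul (ω : ℂ)).mul_const I)
  have h1 := ((h.cexp.const_mul c).mul_const m).add ((h.neg.cexp.const_mul c').mul_const m')
  refine ((h1.add_const k).congr_deriv ?_).deriv
  simp only [Pi.neg_apply]
  ring

variable {P : Params} {e : Fin 2 → ℝ} {μ₁ : Fin 2 → ℝ} {ω : ℝ} {M Mn Mm : State} {A₀ An : ℝ → ℂ}
  {τ : ℝ}

/-- The first-order solution built from a Hopf mode `M` and steady modes `Mn, Mm`. -/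
def firstOrder (ω : ℝ) (M Mn Mm : State) (A₀ An : ℝ → ℂ) (s t : ℝ) : State :=
  (A₀ s * exp (ω * t * I)) • M + (conj (A₀ s) * exp (-(ω * t * I))) • star M +
    (An s • Mn + conj (An s) • Mm)

/-- The part of the third-order nonlinearity that is proportional to `e^{iωt}`. -/
def Params.nonlinOne (e : Fin 2 → ℝ) (a a' s w b p : State) : State :=
  (2 : ℂ) • (P.bilin e a w + P.bilin e s b + P.bilin e a' p) +
    (3 : ℂ) • (P.trilin e a s s + P.trilin e a a a')

/-- The part of the third-order nonlinearity that is constant in time. -/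
def Params.nonlinZero (e : Fin 2 → ℝ) (a a' s w b b' : State) : State :=
  (2 : ℂ) • (P.bilin e a b' + P.bilin e a' b + P.bilin e s w) +
    (P.trilin e s s s + (6 : ℂ) • P.trilin e a a' s)

theorem surf_add (W W' : State) (θ : ℝ) : (W + W').surf θ = W.surf θ + W'.surf θ := by
  ext i
  fin_cases i <;> rfl

theorem surf_smul (c : ℂ) (W : State) (θ : ℝ) : (c • W).surf θ = c • W.surf θ := by
  ext i
  fin_cases i <;> rfl

theorem surf_star (W : State) (θ : ℝ) : (star W).surf θ = star (W.surf θ) := by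
  ext i
  fin_cases i <;> rfl

theorem firstOrder_surf (t θ : ℝ) : (firstOrder ω M Mn Mm A₀ An τ t).surf θ =
    exp (ω * t * I) • (A₀ τ • M).surf θ + exp (-(ω * t * I)) • (conj (A₀ τ) • star M).surf θ +
      (An τ • Mn + conj (An τ) • Mm).surf θ := by
  rw [firstOrder, surf_add, surf_add, surf_smul, surf_smul, surf_smul, surf_smul, smul_smul,
    smul_smul, mul_comm (A₀ τ), mul_comm (conj (A₀ τ))]

/-- The linear terms carry the frequencies 0 and ±1 of the first-order field, while the surface
products reach ±3, so each component is a trigonometric polynomial covered by `harmonic_laurent`.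
The fast derivative acts as multiplication by 0 on the mean and by iω on the first harmonic, which
explains the first arguments of `detuning`. -/
theorem thirdForcing_harmonics (hω : 0 < ω) (h0 : DifferentiableAt ℝ A₀ τ)
    (hn : DifferentiableAt ℝ An τ) {W₂ : ℝ → ℝ → State} {w b b' p p' : State}
    (hW₂ : ∀ t : ℝ, W₂ τ t = w + exp (ω * t * I) • b + exp (-(ω * t * I)) • b' +
      exp (ω * t * I) ^ 2 • p + exp (-(ω * t * I)) ^ 2 • p') :
    stateHarmonic ω 0 (P.thirdForcing e μ₁ (firstOrder ω M Mn Mm A₀ An) W₂ τ) =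
      -(deriv An τ • Mn + conj (deriv An τ) • Mm) +
      P.detuning μ₁ ((0 : ℂ) • (An τ • Mn + conj (An τ) • Mm)) (An τ • Mn + conj (An τ) • Mm) +
      P.nonlinZero e (A₀ τ • M) (conj (A₀ τ) • star M) (An τ • Mn + conj (An τ) • Mm) w b b' ∧
    stateHarmonic ω 1 (P.thirdForcing e μ₁ (firstOrder ω M Mn Mm A₀ An) W₂ τ) =
      -(deriv A₀ τ • M) + P.detuning μ₁ ((ω * I : ℂ) • (A₀ τ • M)) (A₀ τ • M) +
      P.nonlinOne e (A₀ τ • M) (conj (A₀ τ) • star M) (An τ • Mn + conj (An τ) • Mm) w b p := by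
  have cU : ∀ z, _ := fun z => harmonic_laurent hω
    (h := fun t => (P.thirdForcing e μ₁ (firstOrder ω M Mn Mm A₀ An) W₂ τ t).U z)
    (c0 := -(deriv An τ * Mn.U z + conj (deriv An τ) * Mm.U z)) (c1 := -(deriv A₀ τ * M.U z))
    (c2 := 0) (c3 := 0) (d1 := -(conj (deriv A₀ τ) * star (M.U z))) (d2 := 0) (d3 := 0)
    (fun t => by
      have := deriv_slow h0 hn (exp (ω * t * I)) (exp (-(ω * t * I))) (M.U z) (star (M.U z))
        (Mn.U z) (Mm.U z)
      simp [Params.thirdForcing, stateDeriv, firstOrder, State.U, Params.bilin, Params.trilin,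
        Params.detuning] at this ⊢
      rw [this]
      ring)
  have cV : ∀ z, _ := fun z => harmonic_laurent hω
    (h := fun t => (P.thirdForcing e μ₁ (firstOrder ω M Mn Mm A₀ An) W₂ τ t).V z)
    (c0 := -(deriv An τ * Mn.V z + conj (deriv An τ) * Mm.V z) +
      μ₁ 1 * (P.σv * (An τ * Mn.V z + conj (An τ) * Mm.V z) / P.Dv))
    (c1 := -(deriv A₀ τ * M.V z) +
      μ₁ 1 * ((ω * I * (A₀ τ * M.V z) + P.σv * (A₀ τ * M.V z)) / P.Dv))
    (c2 := 0) (c3 := 0)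
    (d1 := -(conj (deriv A₀ τ) * star (M.V z)) +
      μ₁ 1 * ((-(ω * I * (conj (A₀ τ) * star (M.V z))) +
        P.σv * (conj (A₀ τ) * star (M.V z))) / P.Dv)) (d2 := 0) (d3 := 0)
    (fun t => by
      have h1 := deriv_slow h0 hn (exp (ω * t * I)) (exp (-(ω * t * I))) (M.V z) (star (M.V z))
        (Mn.V z) (Mm.V z)
      have h2 := deriv_fast ω (A₀ τ) (conj (A₀ τ)) (M.V z) (star (M.V z))
        (An τ * Mn.V z + conj (An τ) * Mm.V z) t
      simp [Params.thirdForcing, stateDeriv, firstOrder, State.V, Params.bilin, Params.trilin,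
        Params.detuning] at h1 h2 ⊢
      rw [h1, h2]
      ring)
  have hs2 : ∀ t θ : ℝ, (W₂ τ t).surf θ = w.surf θ + exp (ω * t * I) • b.surf θ +
      exp (-(ω * t * I)) • b'.surf θ + exp (ω * t * I) ^ 2 • p.surf θ +
      exp (-(ω * t * I)) ^ 2 • p'.surf θ := fun t θ => by
    rw [hW₂]
    simp only [surf_add, surf_smul]
  have cu : ∀ θ, _ := fun θ => harmonic_nonlin hω P.f e ((A₀ τ • M).surf θ)
    ((conj (A₀ τ) • star M).surf θ) ((An τ • Mn + conj (An τ) • Mm).surf θ) (w.surf θ) (b.surf θ)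
    (b'.surf θ) (p.surf θ) (p'.surf θ) (-(deriv An τ * Mn.u θ + conj (deriv An τ) * Mm.u θ))
    (-(deriv A₀ τ * M.u θ)) (-(conj (deriv A₀ τ) * star (M.u θ)))
    (F := fun t => (P.thirdForcing e μ₁ (firstOrder ω M Mn Mm A₀ An) W₂ τ t).u θ)
    (fun t => by
      have h1 := deriv_slow h0 hn (exp (ω * t * I)) (exp (-(ω * t * I))) (M.u θ) (star (M.u θ))
        (Mn.u θ) (Mm.u θ)
      -- The trailing 0 is the detuning of the u equation: K_v and D_v perturb only V and v.
      have h5 : (P.thirdForcing e μ₁ (firstOrder ω M Mn Mm A₀ An) W₂ τ t).u θ =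
          -deriv (fun s => A₀ s * exp (ω * t * I) * M.u θ +
            conj (A₀ s) * exp (-(ω * t * I)) * star (M.u θ) +
            (An s * Mn.u θ + conj (An s) * Mm.u θ)) τ +
          2 * quadForm P.f e ((firstOrder ω M Mn Mm A₀ An τ t).surf θ) ((W₂ τ t).surf θ) +
          cubicForm P.f e ((firstOrder ω M Mn Mm A₀ An τ t).surf θ)
            ((firstOrder ω M Mn Mm A₀ An τ t).surf θ)
            ((firstOrder ω M Mn Mm A₀ An τ t).surf θ) + 0 := rfl
      simp only [h5, h1, hs2, firstOrder_surf]
      ring)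
  have cv : ∀ θ, _ := fun θ => harmonic_nonlin hω P.g e ((A₀ τ • M).surf θ)
    ((conj (A₀ τ) • star M).surf θ) ((An τ • Mn + conj (An τ) • Mm).surf θ) (w.surf θ) (b.surf θ)
    (b'.surf θ) (p.surf θ) (p'.surf θ)
    (-(deriv An τ * Mn.v θ + conj (deriv An τ) * Mm.v θ) -
      μ₁ 0 * (An τ * Mn.v θ + conj (An τ) * Mm.v θ -
        (An τ * Mn.V (polar P.R θ) + conj (An τ) * Mm.V (polar P.R θ))))
    (-(deriv A₀ τ * M.v θ) - μ₁ 0 * (A₀ τ * M.v θ - A₀ τ * M.V (polar P.R θ)))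
    (-(conj (deriv A₀ τ) * star (M.v θ)) - μ₁ 0 * (conj (A₀ τ) * star (M.v θ) -
      conj (A₀ τ) * star (M.V (polar P.R θ))))
    (F := fun t => (P.thirdForcing e μ₁ (firstOrder ω M Mn Mm A₀ An) W₂ τ t).v θ)
    (fun t => by
      have h1 := deriv_slow h0 hn (exp (ω * t * I)) (exp (-(ω * t * I))) (M.v θ) (star (M.v θ))
        (Mn.v θ) (Mm.v θ)
      have h5 : (P.thirdForcing e μ₁ (firstOrder ω M Mn Mm A₀ An) W₂ τ t).v θ =
          -deriv (fun s => A₀ s * exp (ω * t * I) * M.v θ +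
            conj (A₀ s) * exp (-(ω * t * I)) * star (M.v θ) +
            (An s * Mn.v θ + conj (An s) * Mm.v θ)) τ +
          2 * quadForm P.g e ((firstOrder ω M Mn Mm A₀ An τ t).surf θ) ((W₂ τ t).surf θ) +
          cubicForm P.g e ((firstOrder ω M Mn Mm A₀ An τ t).surf θ)
            ((firstOrder ω M Mn Mm A₀ An τ t).surf θ)
            ((firstOrder ω M Mn Mm A₀ An τ t).surf θ) +
          -(μ₁ 0 * (A₀ τ * exp (ω * t * I) * M.v θ + conj (A₀ τ) * exp (-(ω * t * I)) * star (M.v θ) +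
              (An τ * Mn.v θ + conj (An τ) * Mm.v θ) -
            (A₀ τ * exp (ω * t * I) * M.V (polar P.R θ) +
              conj (A₀ τ) * exp (-(ω * t * I)) * star (M.V (polar P.R θ)) +
              (An τ * Mn.V (polar P.R θ) + conj (An τ) * Mm.V (polar P.R θ))))) := rfl
      simp only [h5, h1, hs2, firstOrder_surf]
      ring)
  refine ⟨?_, ?_⟩
  · refine Prod.ext (funext fun z => ?_) (Prod.ext (funext fun z => ?_)
      (Prod.ext (funext fun θ => ?_) (funext fun θ => ?_)))
    · refine (cU z).1.trans ?_
      simp [Params.nonlinZero, Params.detuning, Params.bilin, Params.trilin, State.U]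
    · refine (cV z).1.trans ?_
      simp [Params.nonlinZero, Params.detuning, Params.bilin, Params.trilin, State.V]
    · refine (cu θ).1.trans ?_
      simp [Params.nonlinZero, Params.detuning, Params.bilin, Params.trilin, State.u, Params.B,
        Params.C]
      ring
    · refine (cv θ).1.trans ?_
      simp [Params.nonlinZero, Params.detuning, Params.bilin, Params.trilin, State.V, State.v,
        Params.B, Params.C]
      ring
  · refine Prod.ext (funext fun z => ?_) (Prod.ext (funext fun z => ?_)
      (Prod.ext (funext fun θ => ?_) (funext fun θ => ?_)))
    · refine (cU z).2.trans ?_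
      simp [Params.nonlinOne, Params.detuning, Params.bilin, Params.trilin, State.U]
    · refine (cV z).2.trans ?_
      simp [Params.nonlinOne, Params.detuning, Params.bilin, Params.trilin, State.V]
    · refine (cu θ).2.trans ?_
      simp [Params.nonlinOne, Params.detuning, Params.bilin, Params.trilin, State.u, Params.B,
        Params.C]
      ring
    · refine (cv θ).2.trans ?_
      simp [Params.nonlinOne, Params.detuning, Params.bilin, Params.trilin, State.V, State.v,
        Params.B, Params.C]
      ring

theorem detuningFlux_harmonics (hω : 0 < ω) :
    (fun θ => harmonic ω 0 (fun t => P.detuningFlux μ₁ (firstOrder ω M Mn Mm A₀ An τ t) θ)) =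
      P.detuningFlux μ₁ (An τ • Mn + conj (An τ) • Mm) ∧
    (fun θ => harmonic ω 1 (fun t => P.detuningFlux μ₁ (firstOrder ω M Mn Mm A₀ An τ t) θ)) =
      P.detuningFlux μ₁ (A₀ τ • M) := by
  have h : ∀ θ, _ := fun θ => harmonic_laurent hω
    (h := fun t => P.detuningFlux μ₁ (firstOrder ω M Mn Mm A₀ An τ t) θ)
    (c0 := P.detuningFlux μ₁ (An τ • Mn + conj (An τ) • Mm) θ)
    (c1 := P.detuningFlux μ₁ (A₀ τ • M) θ) (c2 := 0) (c3 := 0)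
    (d1 := P.detuningFlux μ₁ (conj (A₀ τ) • star M) θ) (d2 := 0) (d3 := 0) (fun t => by
      simp [Params.detuningFlux, firstOrder, State.v, State.V]
      ring)
  exact ⟨funext fun θ => (h θ).1, funext fun θ => (h θ).2⟩

end ThirdOrder

/-! ### Fourier calculus for states -/

/-- The surface components are continuous. -/
class SurfCont (W : State) : Prop where
  u : Continuous W.u
  v : Continuous W.v

/-- All components are continuous. -/
class StateCont (W : State) : Prop extends SurfCont W where
  U : Continuous W.U
  V : Continuous W.V

/-- Instances discharge the continuity side conditions of the Fourier calculus. Surface continuity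
is enough for the second-order fields, which enter only through 𝓑; a classical solution is
controlled in the bulk only on the closed disk. -/
instance (W W' : State) [h : SurfCont W] [h' : SurfCont W'] : SurfCont (W + W') :=
  ⟨h.u.add h'.u, h.v.add h'.v⟩

instance (c : ℂ) (W : State) [h : SurfCont W] : SurfCont (c • W) :=
  ⟨h.u.const_smul c, h.v.const_smul c⟩

instance (W : State) [h : SurfCont W] : SurfCont (star W) := ⟨h.u.star, h.v.star⟩

instance (W W' : State) [h : StateCont W] [h' : StateCont W'] : StateCont (W + W') :=
  ⟨h.U.add h'.U, h.V.add h'.V⟩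

instance (c : ℂ) (W : State) [h : StateCont W] : StateCont (c • W) :=
  ⟨h.U.const_smul c, h.V.const_smul c⟩

instance (W : State) [h : StateCont W] : StateCont (-W) :=
  { u := h.u.neg, v := h.v.neg, U := h.U.neg, V := h.V.neg }

theorem continuous_quadForm (h : ℝ → ℝ → ℝ) (e : Fin 2 → ℝ) (W W' : State) [hW : SurfCont W]
    [hW' : SurfCont W'] : Continuous fun θ => quadForm h e (W.surf θ) (W'.surf θ) := by
  have h1 := hW.u
  have h2 := hW.v
  have h3 := hW'.u
  have h4 := hW'.v
  simp only [quadForm, State.surf, Matrix.cons_val_zero, Matrix.cons_val_one]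
  fun_prop

theorem continuous_cubicForm (h : ℝ → ℝ → ℝ) (e : Fin 2 → ℝ) (W W' W'' : State) [hW : SurfCont W]
    [hW' : SurfCont W'] [hW'' : SurfCont W''] :
    Continuous fun θ => cubicForm h e (W.surf θ) (W'.surf θ) (W''.surf θ) := by
  have h1 := hW.u
  have h2 := hW.v
  have h3 := hW'.u
  have h4 := hW'.v
  have h5 := hW''.u
  have h6 := hW''.v
  simp only [cubicForm, State.surf, Matrix.cons_val_zero, Matrix.cons_val_one]
  fun_prop

instance (P : Params) (e : Fin 2 → ℝ) (W W' : State) [SurfCont W] [SurfCont W'] :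
    StateCont (P.bilin e W W') where
  u := continuous_quadForm P.f e W W'
  v := continuous_quadForm P.g e W W'
  U := continuous_const
  V := continuous_const

instance (P : Params) (e : Fin 2 → ℝ) (W W' W'' : State) [SurfCont W] [SurfCont W']
    [SurfCont W''] : StateCont (P.trilin e W W' W'') where
  u := continuous_cubicForm P.f e W W' W''
  v := continuous_cubicForm P.g e W W' W''
  U := continuous_const
  V := continuous_const

instance (P : Params) (n : ℤ) (lam : ℂ) (φ : Fin 2 → ℂ) : SurfCont (P.mode n lam φ) where
  u := by simp only [Params.mode, State.u]; fun_prop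
  v := by simp only [Params.mode, State.v]; fun_prop

theorem Params.stateCont_mode (P : Params) {lam : ℂ} (h : 0 ≤ lam.re) (n : ℤ) (φ : Fin 2 → ℂ) :
    StateCont (P.mode n lam φ) where
  U := by
    rw [P.mode_eq h]
    exact continuous_const.mul (contDiff_modeBulk n _ (k := 0)).continuous
  V := by
    rw [P.mode_eq h]
    exact continuous_const.mul (contDiff_modeBulk n _ (k := 0)).continuous

theorem continuous_polar_angle (r : ℝ) : Continuous fun θ => polar r θ :=
  continuous_polar.comp (f := fun θ : ℝ => (r, θ)) (by fun_prop)

theorem stateCont_detuning (P : Params) (μ₁ : Fin 2 → ℝ) (Wt W : State) [h : StateCont W]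
    [h' : StateCont Wt] : StateCont (P.detuning μ₁ Wt W) where
  u := continuous_const
  v := by
    have h1 := h.v
    have h2 := h.V.comp (continuous_polar_angle P.R)
    exact (continuous_const.mul (h1.sub h2)).neg
  U := continuous_const
  V := by
    have h1 := h.V
    have h2 := h'.V
    exact continuous_const.mul ((h2.add (continuous_const.mul h1)).div_const _)

theorem Params.Regular.surfCont {P : Params} {W : State} (h : P.Regular W) : SurfCont W :=
  ⟨h.u_smooth.continuous, h.v_smooth.continuous⟩

theorem fvec_add (n : ℤ) (W W' : State) [h : SurfCont W] [h' : SurfCont W'] :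
    fvec n (W + W') = fvec n W + fvec n W' := by
  ext i
  fin_cases i
  · exact fint_add n h.u h'.u
  · exact fint_add n h.v h'.v

theorem fvec_smul (n : ℤ) (c : ℂ) (W : State) : fvec n (c • W) = c • fvec n W := by
  ext i
  fin_cases i
  · exact fint_const_mul n c W.u
  · exact fint_const_mul n c W.v

theorem fint_star (n : ℤ) (u : ℝ → ℂ) : fint n (fun θ => star (u θ)) = star (fint (-n) u) := by
  simp only [fint, intervalIntegral.integral_of_le Real.two_pi_pos.le, Complex.star_def]
  rw [← integral_conj]
  congr 1
  funext θ
  rw [map_mul, ← Complex.exp_conj]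
  simp

theorem fvec_star (n : ℤ) (W : State) : fvec n (star W) = star (fvec (-n) W) := by
  ext i
  fin_cases i
  · exact fint_star n W.u
  · exact fint_star n W.v

theorem fint_exp (n k : ℤ) (c : ℂ) :
    fint n (fun θ => c * exp (k * θ * I)) = if k = n then 2 * Real.pi * c else 0 := by
  have e : ∀ θ : ℝ, c * exp (k * θ * I) * exp (-(n * θ * I)) =
      c * exp (-(((n - k : ℤ) : ℂ) * θ * I)) := fun θ => by
    rw [mul_assoc, ← Complex.exp_add]
    congr 2
    push_cast
    ring
  rw [fint]
  simp only [e]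
  rw [intervalIntegral.integral_const_mul]
  split_ifs with h
  · simp [h]
    ring
  · have hne : -(((n - k : ℤ) : ℂ) * I) ≠ 0 :=
      neg_ne_zero.2 (mul_ne_zero (by exact_mod_cast sub_ne_zero.2 (Ne.symm h)) I_ne_zero)
    have e2 : ∀ θ : ℝ, exp (-(((n - k : ℤ) : ℂ) * θ * I)) = exp (-(((n - k : ℤ) : ℂ) * I) * θ) :=
      fun θ => by ring_nf
    simp only [e2]
    rw [integral_exp_mul_complex hne, ← e2, exp_int_mul_two_pi]
    simp

/-- The surface vector of `W` is `φ e^{ikθ}`. -/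
def HasSurf (W : State) (k : ℤ) (φ : Fin 2 → ℂ) : Prop := ∀ θ : ℝ, W.surf θ = exp (k * θ * I) • φ

theorem HasSurf.fvec {W : State} {k : ℤ} {φ : Fin 2 → ℂ} (h : HasSurf W k φ) (n : ℤ) :
    fvec n W = if k = n then (2 * Real.pi : ℂ) • φ else 0 := by
  have hu : W.u = fun θ : ℝ => φ 0 * exp (k * θ * I) := funext fun θ => by
    have := congrFun (h θ) 0
    simpa [State.surf, mul_comm] using this
  have hv : W.v = fun θ : ℝ => φ 1 * exp (k * θ * I) := funext fun θ => by
    have := congrFun (h θ) 1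
    simpa [State.surf, mul_comm] using this
  rw [BulkSurface.fvec, hu, hv, fint_exp, fint_exp]
  split_ifs
  · ext i
    fin_cases i <;> simp
  · ext i
    fin_cases i <;> simp

theorem Params.hasSurf_mode (P : Params) (n : ℤ) (lam : ℂ) (φ : Fin 2 → ℂ) :
    HasSurf (P.mode n lam φ) n φ := by
  intro θ
  ext i
  fin_cases i <;> simp [State.surf, Params.mode, State.u, State.v, mul_comm]

theorem HasSurf.star {W : State} {φ : Fin 2 → ℂ} {k : ℤ} (h : HasSurf W k φ) :
    HasSurf (star W) (-k) (star φ) := by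
  intro θ
  rw [surf_star, h θ, star_smul]
  congr 1
  rw [Complex.star_def, ← Complex.exp_conj]
  simp

/-- With one argument frozen to a pure mode the form is linear in the other, and the factor e^{ikθ}
shifts the Fourier index by k. -/
theorem fint_quadForm (h : ℝ → ℝ → ℝ) (e : Fin 2 → ℝ) (n k : ℤ) (φ : Fin 2 → ℂ) (W : State)
    [hW : SurfCont W] :
    fint n (fun θ => quadForm h e (exp (k * θ * I) • φ) (W.surf θ)) =
      quadForm h e φ (fvec (n - k) W) := by
  have hu := hW.u
  have hv := hW.v
  set a : ℂ := (1 / 2) * ((partialU (partialU h) (e 0) (e 1) : ℂ) * φ 0 +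
    (partialV (partialU h) (e 0) (e 1) : ℂ) * φ 1) with ha
  set b : ℂ := (1 / 2) * ((partialV (partialU h) (e 0) (e 1) : ℂ) * φ 0 +
    (partialV (partialV h) (e 0) (e 1) : ℂ) * φ 1) with hb
  have e1 : fint n (fun θ => quadForm h e (exp (k * θ * I) • φ) (W.surf θ)) =
      fint (n - k) (fun θ => a * W.u θ + b * W.v θ) := by
    rw [fint, fint]
    refine intervalIntegral.integral_congr fun θ _ => ?_
    have e2 : exp (-(((n - k : ℤ) : ℂ) * θ * I)) = exp (k * θ * I) * exp (-(n * θ * I)) := by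
      rw [← Complex.exp_add]
      push_cast
      ring_nf
    simp only [e2, quadForm, State.surf, Pi.smul_apply, smul_eq_mul, Matrix.cons_val_zero,
      Matrix.cons_val_one, ha, hb]
    ring
  rw [e1, fint_linear _ _ _ hu hv]
  simp only [quadForm, fvec, Matrix.cons_val_zero, Matrix.cons_val_one, ha, hb]
  ring

theorem fvec_bilin (P : Params) (e : Fin 2 → ℝ) {X : State} {k : ℤ} {φ : Fin 2 → ℂ}
    (hX : HasSurf X k φ) (n : ℤ) (W : State) [SurfCont W] :
    fvec n (P.bilin e X W) = P.B e φ (fvec (n - k) W) := by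
  ext i
  fin_cases i
  · simp [fvec, Params.bilin, State.u, Params.B, hX _]
    exact fint_quadForm P.f e n k φ W
  · simp [fvec, Params.bilin, State.v, Params.B, hX _]
    exact fint_quadForm P.g e n k φ W

theorem hasSurf_trilin (P : Params) (e : Fin 2 → ℝ) {X Y Z : State} {k l m : ℤ}
    {φ ψ χ : Fin 2 → ℂ} (hX : HasSurf X k φ) (hY : HasSurf Y l ψ) (hZ : HasSurf Z m χ) :
    HasSurf (P.trilin e X Y Z) (k + l + m) (P.C e φ ψ χ) := by
  intro θ
  have e1 : exp (((k + l + m : ℤ) : ℂ) * θ * I) =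
      exp (k * θ * I) * exp (l * θ * I) * exp (m * θ * I) := by
    rw [← Complex.exp_add, ← Complex.exp_add]
    push_cast
    ring_nf
  rw [e1]
  ext i
  fin_cases i
  · simp [State.surf, Params.trilin, State.u, Params.C]
    change cubicForm P.f e (X.surf θ) (Y.surf θ) (Z.surf θ) = _
    rw [hX, hY, hZ]
    simp only [cubicForm, Pi.smul_apply, smul_eq_mul]
    ring
  · simp [State.surf, Params.trilin, State.v, Params.C]
    change cubicForm P.g e (X.surf θ) (Y.surf θ) (Z.surf θ) = _
    rw [hX, hY, hZ]
    simp only [cubicForm, Pi.smul_apply, smul_eq_mul]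
    ring

/-! ### Multilinearity, symmetry and reality of the quadratic and cubic forms -/

section Multilinear

variable (P : Params) (e : Fin 2 → ℝ)

theorem B_add_left (x y z : Fin 2 → ℂ) : P.B e (x + y) z = P.B e x z + P.B e y z := by
  ext i
  fin_cases i <;> simp [Params.B, quadForm] <;> ring

theorem B_smul_left (c : ℂ) (x z : Fin 2 → ℂ) : P.B e (c • x) z = c • P.B e x z := by
  ext i
  fin_cases i <;> simp [Params.B, quadForm] <;> ring

theorem B_comm (x y : Fin 2 → ℂ) : P.B e x y = P.B e y x := by
  ext i
  fin_cases i <;> simp [Params.B, quadForm] <;> ring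

theorem B_add_right (x y z : Fin 2 → ℂ) : P.B e x (y + z) = P.B e x y + P.B e x z := by
  rw [B_comm, B_add_left, B_comm P e y, B_comm P e z]

theorem B_smul_right (c : ℂ) (x z : Fin 2 → ℂ) : P.B e x (c • z) = c • P.B e x z := by
  rw [B_comm, B_smul_left, B_comm]

theorem B_zero_right (x : Fin 2 → ℂ) : P.B e x 0 = 0 := by
  simpa using B_smul_right P e 0 x 0

theorem C_swap_left (x y z : Fin 2 → ℂ) : P.C e x y z = P.C e y x z := by
  ext i
  fin_cases i <;> simp [Params.C, cubicForm] <;> ring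

theorem C_swap_right (x y z : Fin 2 → ℂ) : P.C e x y z = P.C e x z y := by
  ext i
  fin_cases i <;> simp [Params.C, cubicForm] <;> ring

theorem C_add (x x' y z : Fin 2 → ℂ) : P.C e (x + x') y z = P.C e x y z + P.C e x' y z := by
  ext i
  fin_cases i <;> simp [Params.C, cubicForm] <;> ring

theorem C_smul (c : ℂ) (x y z : Fin 2 → ℂ) : P.C e (c • x) y z = c • P.C e x y z := by
  ext i
  fin_cases i <;> simp [Params.C, cubicForm] <;> ring

theorem B_star (x y : Fin 2 → ℂ) : star (P.B e x y) = P.B e (star x) (star y) := by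
  ext i
  fin_cases i <;> simp [Params.B, quadForm]

theorem C_star (x y z : Fin 2 → ℂ) : star (P.C e x y z) = P.C e (star x) (star y) (star z) := by
  ext i
  fin_cases i <;> simp [Params.C, cubicForm]

theorem state_ext_surf {W W' : State} (hU : W.U = W'.U) (hV : W.V = W'.V)
    (hs : ∀ θ, W.surf θ = W'.surf θ) : W = W' :=
  Prod.ext hU (Prod.ext hV (Prod.ext (funext fun θ => congrFun (hs θ) 0)
    (funext fun θ => congrFun (hs θ) 1)))

theorem bilin_surf (W W' : State) (θ : ℝ) :
    (P.bilin e W W').surf θ = P.B e (W.surf θ) (W'.surf θ) := by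
  ext i
  fin_cases i <;> rfl

theorem trilin_surf (W W' W'' : State) (θ : ℝ) :
    (P.trilin e W W' W'').surf θ = P.C e (W.surf θ) (W'.surf θ) (W''.surf θ) := by
  ext i
  fin_cases i <;> rfl

theorem bilin_add_left (X Y Z : State) :
    P.bilin e (X + Y) Z = P.bilin e X Z + P.bilin e Y Z :=
  state_ext_surf (add_zero _).symm (add_zero _).symm fun θ => by
    rw [surf_add, bilin_surf, bilin_surf, bilin_surf, surf_add, B_add_left]

theorem bilin_smul_left (c : ℂ) (X Z : State) : P.bilin e (c • X) Z = c • P.bilin e X Z :=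
  state_ext_surf (smul_zero c).symm (smul_zero c).symm fun θ => by
    rw [surf_smul, bilin_surf, bilin_surf, surf_smul, B_smul_left]

theorem trilin_swap_left (X Y Z : State) : P.trilin e X Y Z = P.trilin e Y X Z :=
  state_ext_surf rfl rfl fun θ => by rw [trilin_surf, trilin_surf, C_swap_left]

theorem trilin_swap_right (X Y Z : State) : P.trilin e X Y Z = P.trilin e X Z Y :=
  state_ext_surf rfl rfl fun θ => by rw [trilin_surf, trilin_surf, C_swap_right]

theorem trilin_add₁ (X X' Y Z : State) :
    P.trilin e (X + X') Y Z = P.trilin e X Y Z + P.trilin e X' Y Z :=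
  state_ext_surf (add_zero _).symm (add_zero _).symm fun θ => by
    rw [surf_add, trilin_surf, trilin_surf, trilin_surf, surf_add, C_add]

theorem trilin_smul₁ (c : ℂ) (X Y Z : State) :
    P.trilin e (c • X) Y Z = c • P.trilin e X Y Z :=
  state_ext_surf (smul_zero c).symm (smul_zero c).symm fun θ => by
    rw [surf_smul, trilin_surf, trilin_surf, surf_smul, C_smul]

theorem trilin_add₂ (X X' Y Z : State) :
    P.trilin e Y (X + X') Z = P.trilin e Y X Z + P.trilin e Y X' Z := by
  rw [trilin_swap_left, trilin_add₁, trilin_swap_left P e X, trilin_swap_left P e X']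

theorem trilin_smul₂ (c : ℂ) (X Y Z : State) :
    P.trilin e Y (c • X) Z = c • P.trilin e Y X Z := by
  rw [trilin_swap_left, trilin_smul₁, trilin_swap_left]

theorem trilin_add₃ (X X' Y Z : State) :
    P.trilin e Y Z (X + X') = P.trilin e Y Z X + P.trilin e Y Z X' := by
  rw [trilin_swap_right, trilin_add₂, trilin_swap_right P e Y X, trilin_swap_right P e Y X']

theorem trilin_smul₃ (c : ℂ) (X Y Z : State) :
    P.trilin e Y Z (c • X) = c • P.trilin e Y Z X := by
  rw [trilin_swap_right, trilin_smul₂, trilin_swap_right]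

end Multilinear

/-! ### The pairing with adjoint eigenfunctions -/

section Pairing

variable {P : Params} {lam : ℂ}

theorem radialInt_linear (n : ℤ) (κ a b : ℂ) (R : ℝ) {f g : ℂ → ℂ} (hf : Continuous f)
    (hg : Continuous g) : radialInt n κ R (fun z => a * f z + b * g z) =
      a * radialInt n κ R f + b * radialInt n κ R g := by
  have hc : ∀ {f : ℂ → ℂ}, Continuous f →
      Continuous fun r : ℝ => (r : ℂ) * prof n.natAbs κ r * fint n (fun θ => f (polar r θ)) := by
    intro f hf
    have h1 := continuous_prof n.natAbs κ
    have h2 : Continuous fun r : ℝ => fint n (fun θ => f (polar r θ)) := by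
      refine intervalIntegral.continuous_parametric_intervalIntegral_of_continuous' ?_ _ _
      have he : Continuous fun p : ℝ × ℝ => exp (-(n * p.2 * I)) := by fun_prop
      exact (hf.comp continuous_polar).mul he
    fun_prop
  rw [radialInt, radialInt, radialInt, ← intervalIntegral.integral_const_mul,
    ← intervalIntegral.integral_const_mul, ← intervalIntegral.integral_add]
  rotate_left
  · exact (continuous_const.mul (hc hf)).intervalIntegrable _ _
  · exact (continuous_const.mul (hc hg)).intervalIntegrable _ _
  refine intervalIntegral.integral_congr fun r _ => ?_
  have h1 : Continuous fun θ => f (polar r θ) := hf.comp (continuous_polar_angle r)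
  have h2 : Continuous fun θ => g (polar r θ) := hg.comp (continuous_polar_angle r)
  rw [fint_linear n a b h1 h2]
  ring

/-- Angular orthogonality. The diagonal value is ∫ r y² rather than ∫ r |y|², because the adjoint
mode is built from conj κ and the pairing conjugates it back. -/
theorem radialInt_modeBulk (n k : ℤ) (κ c : ℂ) (R : ℝ) :
    radialInt n κ R (fun z => c * modeBulk k κ z) =
      if k = n then 2 * Real.pi * c * ∫ r in (0 : ℝ)..R, (r : ℂ) * prof n.natAbs κ r ^ 2 else 0 := by
  rw [radialInt]
  simp only [modeBulk_polar, ← mul_assoc, fint_exp]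
  split_ifs with h
  · subst h
    rw [← intervalIntegral.integral_const_mul]
    refine intervalIntegral.integral_congr fun r _ => ?_
    ring
  · simp

theorem inner_adjMode_eq (h : 0 ≤ lam.re) (n : ℤ) (φ : Fin 2 → ℂ) (F : State) [hF : StateCont F] :
    P.inner (P.adjMode n lam φ) F =
      conj (φ 0) * (P.ru n lam * radialInt n (P.κu lam) P.R F.U + P.R * fint n F.u) +
      conj (φ 1) * (P.rv n lam * radialInt n (P.κv lam) P.R F.V + P.R * fint n F.v) :=
  P.inner_adjMode h n φ hF.U.continuousOn hF.V.continuousOn hF.u hF.v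

theorem inner_adjMode_linear (h : 0 ≤ lam.re) (n : ℤ) (φ : Fin 2 → ℂ) (a b : ℂ) (F G : State)
    [hF : StateCont F] [hG : StateCont G] :
    P.inner (P.adjMode n lam φ) (a • F + b • G) =
      a * P.inner (P.adjMode n lam φ) F + b * P.inner (P.adjMode n lam φ) G := by
  rw [inner_adjMode_eq h, inner_adjMode_eq h, inner_adjMode_eq h]
  have e1 := radialInt_linear n (P.κu lam) a b P.R hF.U hG.U
  have e2 := radialInt_linear n (P.κv lam) a b P.R hF.V hG.V
  have e3 := fint_linear n a b hF.u hG.u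
  have e4 := fint_linear n a b hF.v hG.v
  change conj (φ 0) * (P.ru n lam * radialInt n (P.κu lam) P.R (fun z => a * F.U z + b * G.U z) +
    P.R * fint n (fun θ => a * F.u θ + b * G.u θ)) +
    conj (φ 1) * (P.rv n lam * radialInt n (P.κv lam) P.R (fun z => a * F.V z + b * G.V z) +
    P.R * fint n (fun θ => a * F.v θ + b * G.v θ)) = _
  rw [e1, e2, e3, e4]
  ring

theorem inner_adjMode_add (h : 0 ≤ lam.re) (n : ℤ) (φ : Fin 2 → ℂ) (F G : State)
    [StateCont F] [StateCont G] :
    P.inner (P.adjMode n lam φ) (F + G) =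
      P.inner (P.adjMode n lam φ) F + P.inner (P.adjMode n lam φ) G := by
  simpa using inner_adjMode_linear (P := P) h n φ 1 1 F G

theorem inner_adjMode_neg (h : 0 ≤ lam.re) (n : ℤ) (φ : Fin 2 → ℂ) (F : State) [StateCont F] :
    P.inner (P.adjMode n lam φ) (-F) = -P.inner (P.adjMode n lam φ) F := by
  simpa using inner_adjMode_linear (P := P) h n φ (-1) 0 F F

theorem inner_adjMode_surface (h : 0 ≤ lam.re) (n : ℤ) (φ : Fin 2 → ℂ) (F : State)
    [StateCont F] (hU : F.U = 0) (hV : F.V = 0) :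
    P.inner (P.adjMode n lam φ) F = P.R * (star φ ⬝ᵥ fvec n F) := by
  have h0 : ∀ κ, radialInt n κ P.R 0 = 0 := fun κ => by simp [radialInt, fint]
  rw [inner_adjMode_eq h, hU, hV, h0, h0]
  simp [dotProduct, Fin.sum_univ_two, fvec]
  ring

theorem inner_adjMode_mode_ne (h : 0 ≤ lam.re) {n k : ℤ} (hk : k ≠ n) (φs φ : Fin 2 → ℂ) :
    P.inner (P.adjMode n lam φs) (P.mode k lam φ) = 0 := by
  have := P.stateCont_mode h k φ
  rw [inner_adjMode_eq h, P.mode_eq h]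
  simp only [State.U, State.V, State.u, State.v, radialInt_modeBulk, fint_exp, if_neg hk]
  simp

/-- With z = ΩR and m = |n|, the recurrences z I_{m∓1} = z I_m' ± m I_m multiply to z² I_{m-1}
I_{m+1} = (z I_m')² - m² I_m². -/
theorem besselI_product (n : ℤ) {Ω κ : ℂ} (hΩ : Ω ^ 2 = κ) (R : ℝ) :
    besselI (n - 1) (Ω * R) * besselI (n + 1) (Ω * R) * (κ * R ^ 2) =
      ((Ω / 2) ^ n.natAbs) ^ 2 *
        (profDeriv n.natAbs κ R ^ 2 - n.natAbs ^ 2 * prof n.natAbs κ R ^ 2) := by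
  have key : ∀ m : ℕ, besselI ((m : ℤ) - 1) (Ω * R) * besselI (m + 1) (Ω * R) * (κ * R ^ 2) =
      ((Ω / 2) ^ m) ^ 2 * (profDeriv m κ R ^ 2 - m ^ 2 * prof m κ R ^ 2) := by
    intro m
    rw [besselI_eq_hyp, besselI_eq_hyp, prof, profDeriv, ← hΩ, show (Ω * R) ^ 2 = Ω ^ 2 * R ^ 2 by ring]
    -- For m = 0 the lower index is -1, and `natAbs` makes it I_1.
    cases m with
    | zero =>
      simp
      ring
    | succ m =>
      rw [show ((m + 1 : ℕ) : ℤ) - 1 = m by push_cast; ring,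
        show (((m + 1 : ℕ) : ℤ) + 1).natAbs = m + 2 by omega, Int.natAbs_natCast,
        hyp_recurrence m]
      push_cast
      ring
  rcases Int.natAbs_eq n with hn | hn
  · rw [← key, ← hn]
  -- For negative n the two neighbouring orders exchange roles.
  · rw [← key, show n - 1 = -((n.natAbs : ℤ) + 1) by omega,
      show n + 1 = -((n.natAbs : ℤ) - 1) by omega, besselI_neg, besselI_neg]
    ring

/-- The bulk weight in terms of the radial profile. -/
theorem bulkWeight_eq (h : 0 ≤ lam.re) (n : ℤ) :
    P.R * P.bulkWeight n lam = P.rv n lam * P.rv n lam * P.κv lam *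
      ∫ r in (0 : ℝ)..P.R, (r : ℂ) * prof n.natAbs (P.κv lam) r ^ 2 := by
  have hκ := P.re_κv_pos h
  have hκ0 : P.κv lam ≠ 0 := by
    intro h0
    simp [h0] at hκ
  have hΩ : P.Ωv lam ≠ 0 := by
    intro h0
    have := P.Ωv_sq lam
    simp [h0] at this
    exact hκ0 this.symm
  have hp : (P.Ωv lam / 2) ^ n.natAbs ≠ 0 := pow_ne_zero _ (div_ne_zero hΩ two_ne_zero)
  have hprof := prof_ne_zero n.natAbs hκ P.R_pos
  have hR := P.R_ne
  have h1 := integral_prof_sq n.natAbs (P.κv lam) P.R_pos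
  have h2 := besselI_product n (P.Ωv_sq lam) P.R
  rw [Params.bulkWeight, P.coefB_eq h, P.Ωv_sq, besselI_mul_eq_prof n (P.Ωv_sq lam)]
  have h3 : besselI (n - 1) (P.Ωv lam * P.R) * besselI (n + 1) (P.Ωv lam * P.R) =
      ((P.Ωv lam / 2) ^ n.natAbs) ^ 2 * (profDeriv n.natAbs (P.κv lam) P.R ^ 2 -
        n.natAbs ^ 2 * prof n.natAbs (P.κv lam) P.R ^ 2) / (P.κv lam * P.R ^ 2) := by
    rw [eq_div_iff (mul_ne_zero hκ0 (pow_ne_zero _ hR)), h2]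
  have h4 : ∫ r in (0 : ℝ)..P.R, (r : ℂ) * prof n.natAbs (P.κv lam) r ^ 2 =
      ((n.natAbs ^ 2 + P.κv lam * P.R ^ 2) * prof n.natAbs (P.κv lam) P.R ^ 2 -
        profDeriv n.natAbs (P.κv lam) P.R ^ 2) / (2 * P.κv lam) := by
    rw [eq_div_iff (mul_ne_zero two_ne_zero hκ0), ← h1]
    ring
  rw [h3, h4]
  field_simp
  ring

theorem mode_flux (h : 0 ≤ lam.re) (k : ℤ) (φ : Fin 2 → ℂ) (θ : ℝ) :
    (P.mode k lam φ).v θ - (P.mode k lam φ).V (polar P.R θ) =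
      P.q k lam * φ 1 * exp (k * θ * I) := by
  rw [P.mode_eq h, P.q_eq h, P.coefB_eq h]
  simp only [State.v, State.V, modeBulk_polar]
  ring

theorem fint_detuningFlux (h : 0 ≤ lam.re) (n k : ℤ) (μ₁ : Fin 2 → ℝ) (φ : Fin 2 → ℂ) :
    fint n (P.detuningFlux μ₁ (P.mode k lam φ)) =
      if k = n then 2 * Real.pi * (pair P.β μ₁ * P.q k lam * φ 1) else 0 := by
  have e : P.detuningFlux μ₁ (P.mode k lam φ) =
      fun θ : ℝ => pair P.β μ₁ * P.q k lam * φ 1 * exp (k * θ * I) := funext fun θ => by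
    rw [Params.detuningFlux, mode_flux h]
    ring
  rw [e, fint_exp]

/-- Since λ + σ_v = D_v κ_v, the volume term is κ_v V times the second component of μ₁. Its pairing
produces κ_v r_v² ∫ r y², which is R times the bulk weight; the surface term contributes the jump v
- V = q_k φ_2 e^{ikθ}. -/
theorem inner_detuning (h : 0 ≤ lam.re) (n k : ℤ) (μ₁ : Fin 2 → ℝ) (φs φ : Fin 2 → ℂ) :
    P.inner (P.adjMode n lam φs)
      (P.detuning μ₁ (lam • P.mode k lam φ) (P.mode k lam φ)) =
      if k = n then 2 * Real.pi * P.R * conj (φs 1) * φ 1 *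
        (P.bulkWeight k lam * μ₁ 1 - P.q k lam * μ₁ 0) else 0 := by
  have := P.stateCont_mode h k φ
  have := stateCont_detuning P μ₁ (lam • P.mode k lam φ) (P.mode k lam φ)
  rw [inner_adjMode_eq h]
  have e1 : (P.detuning μ₁ (lam • P.mode k lam φ) (P.mode k lam φ)).V =
      fun z => (μ₁ 1 * P.κv lam * P.rv k lam * φ 1) * modeBulk k (P.κv lam) z := by
    funext z
    have hD : (P.Dv : ℂ) ≠ 0 := by exact_mod_cast P.Dv_pos.ne'
    rw [P.mode_eq h]
    simp [Params.detuning, State.V, Params.κv]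
    ring
  have e2 : (P.detuning μ₁ (lam • P.mode k lam φ) (P.mode k lam φ)).v =
      fun θ : ℝ => (-(μ₁ 0 * P.q k lam * φ 1)) * exp (k * θ * I) := by
    funext θ
    have := mode_flux (P := P) h k φ θ
    simp only [Params.detuning, State.v, State.V] at this ⊢
    rw [this]
    ring
  have e3 : (P.detuning μ₁ (lam • P.mode k lam φ) (P.mode k lam φ)).U = fun z => 0 * modeBulk k
      (P.κu lam) z := by
    funext z
    simp [Params.detuning, State.U]
  have e4 : (P.detuning μ₁ (lam • P.mode k lam φ) (P.mode k lam φ)).u =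
      fun θ : ℝ => 0 * exp (k * θ * I) := by
    funext θ
    simp [Params.detuning, State.u]
  rw [e1, e2, e3, e4, radialInt_modeBulk, radialInt_modeBulk, fint_exp, fint_exp]
  split_ifs with hk
  · subst hk
    have hw := bulkWeight_eq (P := P) h k
    linear_combination -(2 * Real.pi * μ₁ 1 * φ 1 * conj (φs 1)) * hw
  · simp

/-- Projection of a solution on an arbitrary adjoint mode. -/
theorem Params.Solves.pairing {e : Fin 2 → ℝ} {X F : State} {η : ℝ → ℂ} (h : 0 ≤ lam.re)
    (hX : P.Solves e lam X F η) [hF : StateCont F] (hη : Continuous η) (n : ℤ) (φs : Fin 2 → ℂ) :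
    P.inner (P.adjMode n lam φs) F + P.R * P.coefB n lam * conj (φs 1) * fint n η =
      -(P.R * (star φs ⬝ᵥ (P.Phi e n lam *ᵥ fvec n X))) := by
  obtain ⟨h1, h2⟩ := hX.projection h hF.U.continuousOn hF.V.continuousOn hη n
  rw [inner_adjMode_eq h]
  simp only [dotProduct, Fin.sum_univ_two, Pi.star_apply, Complex.star_def]
  linear_combination conj (φs 0) * h1 + conj (φs 1) * h2

/-- The pairing identity holds for all vectors φ*, not only critical ones; testing it with the two
unit vectors recovers a vector equation. -/
theorem Params.Solves.surface {e : Fin 2 → ℝ} {X F : State} (h : 0 ≤ lam.re)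
    (hX : P.Solves e lam X F 0) [hF : StateCont F] (hU : F.U = 0) (hV : F.V = 0) (n : ℤ) :
    P.Phi e n lam *ᵥ fvec n X = -fvec n F := by
  have h1 : ∀ φs : Fin 2 → ℂ, star φs ⬝ᵥ (P.Phi e n lam *ᵥ fvec n X) = -(star φs ⬝ᵥ fvec n F) := by
    intro φs
    have h2 := hX.pairing h continuous_const n φs
    rw [inner_adjMode_surface h n φs F hU hV] at h2
    have h3 : fint n 0 = 0 := by simp [fint]
    rw [h3] at h2
    apply mul_left_cancel₀ P.R_ne
    linear_combination h2
  ext i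
  fin_cases i
  · simpa [dotProduct, Fin.sum_univ_two] using h1 ![1, 0]
  · simpa [dotProduct, Fin.sum_univ_two] using h1 ![0, 1]

end Pairing

/-! ### Surface Fourier modes of the second-order fields -/

section SecondOrder

variable {P : Params} {e : Fin 2 → ℝ} {lam : ℂ}

/-- Nonresonance at n can thus be used at -n. -/
theorem Phi_neg (n : ℤ) : P.Phi e (-n) lam = P.Phi e n lam := by
  simp [Params.Phi, Params.p, Params.q, besselI_neg]

theorem eq_inv_mulVec {M : Matrix (Fin 2) (Fin 2) ℂ} (hM : M.det ≠ 0) {x y : Fin 2 → ℂ}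
    (h : M *ᵥ x = y) : x = M⁻¹ *ᵥ y := by
  rw [← h, Matrix.mulVec_mulVec, Matrix.nonsing_inv_mul _ (isUnit_iff_ne_zero.2 hM),
    Matrix.one_mulVec]

/-- The surface Fourier modes of the response to a quadratic forcing. -/
theorem Params.Solves.fvec_bilin {X Y W : State} {k l : ℤ} {φ ψ : Fin 2 → ℂ} {c : ℂ}
    (h : 0 ≤ lam.re) (hX : HasSurf X k φ) (hY : HasSurf Y l ψ) [SurfCont X] [SurfCont Y]
    (hW : P.Solves e lam W (c • P.bilin e X Y) 0) (n : ℤ) (hdet : (P.Phi e n lam).det ≠ 0) :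
    fvec n W = if k + l = n then
      (2 * Real.pi : ℂ) • -(c • ((P.Phi e n lam)⁻¹ *ᵥ P.B e φ ψ)) else 0 := by
  rw [eq_inv_mulVec hdet (hW.surface h (smul_zero c) (smul_zero c) n), fvec_smul,
    BulkSurface.fvec_bilin P e hX, hY.fvec]
  have h1 : l = n - k ↔ k + l = n := ⟨fun h => by omega, fun h => by omega⟩
  simp only [h1]
  split_ifs
  · rw [B_smul_right, Matrix.mulVec_neg, Matrix.mulVec_smul, Matrix.mulVec_smul, smul_neg,
      smul_comm]
  · rw [B_zero_right, smul_zero, neg_zero, Matrix.mulVec_zero]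

theorem continuous_detuningFlux (P : Params) (μ₁ : Fin 2 → ℝ) (W : State) [h : StateCont W] :
    Continuous (P.detuningFlux μ₁ W) :=
  continuous_const.mul (h.v.sub (h.V.comp (continuous_polar_angle P.R)))

/-- Here φ is arbitrary, so the base state, a mode with n = 0 and λ = 0, is covered although it lies
in no kernel of Φ. -/
theorem pairing_detuning {X : State} (h : 0 ≤ lam.re) {k : ℤ} {μ₁ : Fin 2 → ℝ} {φ : Fin 2 → ℂ}
    (hX : P.Solves e lam X (P.detuning μ₁ (lam • P.mode k lam φ) (P.mode k lam φ))
      (P.detuningFlux μ₁ (P.mode k lam φ))) (n : ℤ) (φs : Fin 2 → ℂ) :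
    (if k = n then 2 * Real.pi * conj (φs 1) * φ 1 * (P.bulkWeight k lam * μ₁ 1 -
      P.q k lam * μ₁ 0 + P.coefB k lam * P.q k lam * pair P.β μ₁) else 0) =
      -(star φs ⬝ᵥ (P.Phi e n lam *ᵥ fvec n X)) := by
  have := P.stateCont_mode h k φ
  have := stateCont_detuning P μ₁ (lam • P.mode k lam φ) (P.mode k lam φ)
  have h1 := hX.pairing h (continuous_detuningFlux P μ₁ _) n φs
  rw [inner_detuning h, fint_detuningFlux h] at h1
  apply mul_left_cancel₀ P.R_ne
  split_ifs at h1 ⊢ with hk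
  · subst hk
    linear_combination h1
  · linear_combination h1

/-- The response of the base state in terms of `α`. -/
theorem alpha_identity (μ₁ : Fin 2 → ℝ) : P.bulkWeight 0 0 * μ₁ 1 - P.q 0 0 * μ₁ 0 +
    P.coefB 0 0 * P.q 0 0 * pair P.β μ₁ = -pair P.α μ₁ := by
  have h0 : (0 : ℝ) ≤ (0 : ℂ).re := le_rfl
  have hB := P.q_eq h0 0
  have hder : deriv (besselI 0) (P.Ωv 0 * P.R) = besselI 1 (P.Ωv 0 * P.R) := by
    rw [deriv_besselI, besselI_eq_hyp]
    simp
  have hne := besselI_robin_ne_zero 0 (P.Ωv_sq 0) (P.re_κv_pos h0) P.R_pos P.Dv_pos P.Kv_pos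
  rw [hder] at hne
  have hI0 : besselI 0 (P.Ωv 0 * P.R) ≠ 0 := by
    rw [besselI_mul_eq_prof 0 (P.Ωv_sq 0)]
    exact mul_ne_zero (by simp) (prof_ne_zero _ (P.re_κv_pos h0) P.R_pos)
  have hD : (P.Dv : ℂ) ≠ 0 := by exact_mod_cast P.Dv_pos.ne'
  have hm : besselI (0 - 1) (P.Ωv 0 * P.R) = besselI 1 (P.Ωv 0 * P.R) := by
    rw [zero_sub, besselI_neg]
  rw [Params.bulkWeight, hm, zero_add]
  simp only [pair, Params.β, Params.α, Params.coefB, Params.q, hder, Matrix.cons_val_zero,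
    Matrix.cons_val_one]
  -- The first component amounts to -q₀ + B₀ q₀ = -q₀²; the second combines the bulk weight with -B₀
  -- q₀ K_v/D_v.
  field_simp
  ring

/-- The forcing is radial, so mode n vanishes for n ≠ 0 wherever Φ_n(0) is invertible. The vanishing
at 2n is what the steady problem needs, since 𝓦_{-n} couples to that mode. -/
theorem fvec_baseCorrection {μ₁ : Fin 2 → ℝ} {W : State} (hW : P.IsBaseCorrection e μ₁ W) (n : ℤ)
    (hdet : (P.Phi e n 0).det ≠ 0) :
    fvec n W = if n = 0 then (2 * Real.pi * pair P.α μ₁ : ℂ) • P.u0000 e else 0 := by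
  have h0 : (0 : ℝ) ≤ (0 : ℂ).re := le_rfl
  -- The zero time derivative is rewritten as 0 times the mode, to match the form λ 𝓦 with λ = 0.
  have hW' : P.Solves e 0 W (P.detuning μ₁ ((0 : ℂ) • P.mode 0 0 (toC e)) (P.mode 0 0 (toC e)))
      (P.detuningFlux μ₁ (P.mode 0 0 (toC e))) := by
    rw [zero_smul]
    exact hW
  have h1 : P.Phi e n 0 *ᵥ fvec n W =
      if n = 0 then (2 * Real.pi * pair P.α μ₁ : ℂ) • ![0, (e 1 : ℂ)] else 0 := by
    have h2 := fun φs => pairing_detuning h0 hW' n φs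
    simp only [alpha_identity] at h2
    ext i
    fin_cases i
    · have h3 := h2 ![1, 0]
      by_cases hn : n = 0
      · simp [hn, dotProduct, Fin.sum_univ_two] at h3 ⊢
        linear_combination h3
      · simp [hn, Ne.symm hn, dotProduct, Fin.sum_univ_two] at h3 ⊢
        linear_combination h3
    · have h3 := h2 ![0, 1]
      by_cases hn : n = 0
      · simp [hn, dotProduct, Fin.sum_univ_two, toC] at h3 ⊢
        linear_combination h3
      · simp [hn, Ne.symm hn, dotProduct, Fin.sum_univ_two] at h3 ⊢
        linear_combination h3
  rw [eq_inv_mulVec hdet h1]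
  split_ifs with hn
  · rw [Matrix.mulVec_smul, Params.u0000, hn]
  · rw [Matrix.mulVec_zero]

end SecondOrder

/-! ### Solvability of the third-order problem -/

section Solvability

variable {P : Params} {e : Fin 2 → ℝ} {lam : ℂ} {μ₁ : Fin 2 → ℝ}

theorem smul_mode (c : ℂ) (n : ℤ) (φ : Fin 2 → ℂ) : c • P.mode n lam φ = P.mode n lam (c • φ) := by
  refine Prod.ext (funext fun z => ?_) (Prod.ext (funext fun z => ?_)
    (Prod.ext (funext fun θ => ?_) (funext fun θ => ?_))) <;>
  simp [Params.mode] <;> ring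

theorem detuning_add (X X' Y Y' : State) :
    P.detuning μ₁ (X + X') (Y + Y') = P.detuning μ₁ X Y + P.detuning μ₁ X' Y' := by
  refine Prod.ext (funext fun z => ?_) (Prod.ext (funext fun z => ?_)
    (Prod.ext (funext fun θ => ?_) (funext fun θ => ?_))) <;>
  simp [Params.detuning, State.V, State.v] <;> ring

theorem detuningFlux_add (X Y : State) :
    P.detuningFlux μ₁ (X + Y) = fun θ => P.detuningFlux μ₁ X θ + P.detuningFlux μ₁ Y θ := by
  funext θ
  simp [Params.detuningFlux, State.V, State.v]
  ring

/-- In the pairing identity the right side is zero because φ* is annihilated by the adjoint of Φ,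
and normalization turns the slow derivative into -A'. The second mode m is there because the steady
forcing contains both 𝓦_n and 𝓦_{-n}; it drops out by orthogonality. -/
theorem solvability {n m : ℤ} (hm : m ≠ n) (h : 0 ≤ lam.re) {φ φs : Fin 2 → ℂ}
    (hc : P.CriticalPair e n lam φ φs) {X N : State} [StateCont N] (hU : N.U = 0) (hV : N.V = 0)
    {A A' A₂ A₂' : ℂ} (hX : P.Solves e lam X
      (-(A' • P.mode n lam φ + A₂' • P.mode m lam φ) +
        P.detuning μ₁ (lam • (A • P.mode n lam φ + A₂ • P.mode m lam φ))
          (A • P.mode n lam φ + A₂ • P.mode m lam φ) + N)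
      (P.detuningFlux μ₁ (A • P.mode n lam φ + A₂ • P.mode m lam φ))) :
    -(2 * Real.pi * P.R * P.coefB n lam * P.q n lam * conj (φs 1) * φ 1 * pair P.β μ₁ * A) =
      -A' + 2 * Real.pi * P.R * conj (φs 1) * φ 1 *
        (P.bulkWeight n lam * μ₁ 1 - P.q n lam * μ₁ 0) * A + P.R * (star φs ⬝ᵥ fvec n N) := by
  have i1 := P.stateCont_mode h n φ
  have i2 := P.stateCont_mode h m φ
  have i3 := P.stateCont_mode h n (A • φ)
  have i4 := P.stateCont_mode h m (A₂ • φ)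
  have i5 := stateCont_detuning P μ₁ (lam • P.mode n lam (A • φ)) (P.mode n lam (A • φ))
  have i6 := stateCont_detuning P μ₁ (lam • P.mode m lam (A₂ • φ)) (P.mode m lam (A₂ • φ))
  rw [smul_mode A, smul_mode A₂, smul_add, detuning_add, detuningFlux_add] at hX
  have hp := hX.pairing h ((continuous_detuningFlux P μ₁ _).add (continuous_detuningFlux P μ₁ _))
    n φs
  rw [fint_add n (continuous_detuningFlux P μ₁ _) (continuous_detuningFlux P μ₁ _),
    fint_detuningFlux h, fint_detuningFlux h, inner_adjMode_add h, inner_adjMode_add h,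
    inner_adjMode_neg h, inner_adjMode_linear h, inner_adjMode_add h, inner_detuning h,
    inner_detuning h, inner_adjMode_mode_ne h hm, hc.normalized,
    inner_adjMode_surface h n φs N hU hV, if_pos rfl, if_pos rfl, if_neg hm, if_neg hm] at hp
  have h0 : star φs ⬝ᵥ (P.Phi e n lam *ᵥ fvec n X) = 0 := by
    have h1 := congrArg star hc.adjoint_kernel
    rw [Matrix.star_mulVec, Matrix.conjTranspose_conjTranspose, star_zero] at h1
    rw [Matrix.dotProduct_mulVec, h1, zero_dotProduct]
  rw [h0] at hp
  simp only [Pi.smul_apply, smul_eq_mul] at hp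
  linear_combination -hp

end Solvability

/-! ### Surface Fourier modes of the third-order nonlinearity -/

section Cubic

variable {P : Params} {e : Fin 2 → ℝ} {M Mn Mm : State} {φ ψ : Fin 2 → ℂ} {n : ℤ}

instance (a a' s w b p : State) [SurfCont a] [SurfCont a'] [SurfCont s] [SurfCont w] [SurfCont b]
    [SurfCont p] : StateCont (P.nonlinOne e a a' s w b p) := by
  unfold Params.nonlinOne
  infer_instance

instance (a a' s w b b' : State) [SurfCont a] [SurfCont a'] [SurfCont s] [SurfCont w] [SurfCont b]
    [SurfCont b'] : StateCont (P.nonlinZero e a a' s w b b') := by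
  unfold Params.nonlinZero
  infer_instance

theorem nonlinOne_bulk (a a' s w b p : State) : (P.nonlinOne e a a' s w b p).U = 0 ∧
    (P.nonlinOne e a a' s w b p).V = 0 := by
  constructor <;> simp [Params.nonlinOne, State.U, State.V, Params.bilin, Params.trilin]

theorem nonlinZero_bulk (a a' s w b b' : State) : (P.nonlinZero e a a' s w b b').U = 0 ∧
    (P.nonlinZero e a a' s w b b').V = 0 := by
  constructor <;> simp [Params.nonlinZero, State.U, State.V, Params.bilin, Params.trilin]

theorem fvec_zero_state (n : ℤ) : fvec n 0 = 0 := by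
  ext i
  fin_cases i <;> simp [fvec, fint, State.u, State.v]

instance : SurfCont 0 := ⟨continuous_const, continuous_const⟩

theorem fvec_trilin {X Y Z : State} {k l m : ℤ} {x y z : Fin 2 → ℂ} (hX : HasSurf X k x)
    (hY : HasSurf Y l y) (hZ : HasSurf Z m z) (n : ℤ) : fvec n (P.trilin e X Y Z) =
      if k + l + m = n then (2 * Real.pi : ℂ) • P.C e x y z else 0 :=
  (hasSurf_trilin P e hX hY hZ).fvec n

/-- Wave number 0 selects, from the square of C e^{inθ} + conj C e^{-inθ}, only the two mixed
products, whence the factor 2. The constant 6π is the coefficient 3 of the cubic form times 2π. -/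
theorem fvec_nonlinOne (hn0 : n ≠ 0) (hM : HasSurf M 0 φ) (hn : HasSurf Mn n ψ)
    (hm : HasSurf Mm (-n) ψ) [SurfCont M] [SurfCont Mn] [SurfCont Mm] (A C : ℂ) (w b p : State)
    [SurfCont w] [SurfCont b] [SurfCont p] :
    fvec 0 (P.nonlinOne e (A • M) (conj A • star M) (C • Mn + conj C • Mm) w b p) =
      (2 : ℂ) • (A • P.B e φ (fvec 0 w) + (C • P.B e ψ (fvec (-n) b) +
        conj C • P.B e ψ (fvec n b)) + conj A • P.B e (star φ) (fvec 0 p)) +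
      (6 * Real.pi : ℂ) • ((2 * (A * (C * conj C))) • P.C e φ ψ ψ +
        (A * (A * conj A)) • P.C e φ φ (star φ)) := by
  have hM' : HasSurf (star M) 0 (star φ) := by simpa using hM.star
  have i1 : n + n ≠ 0 := by omega
  have i2 : -n + -n ≠ 0 := by omega
  rw [Params.nonlinOne]
  simp only [trilin_add₂, trilin_add₃, trilin_smul₁, trilin_smul₂, trilin_smul₃,
    bilin_add_left, bilin_smul_left, fvec_add, fvec_smul, fvec_bilin P e hM, fvec_bilin P e hM',
    fvec_bilin P e hn, fvec_bilin P e hm, fvec_trilin hM hn hn, fvec_trilin hM hn hm,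
    fvec_trilin hM hm hn, fvec_trilin hM hm hm, fvec_trilin hM hM hM', if_neg i1, if_neg i2,
    sub_zero, zero_sub, neg_neg, zero_add, add_zero, neg_add_cancel, add_neg_cancel, if_true,
    smul_zero]
  module

/-- Wave number n arises from the three orderings of (n, n, -n) in the cube of the steady part, so
6π = 3 · 2π. The field w is seen at 0 through the mode n and at 2n through the mode -n. -/
theorem fvec_nonlinZero (hn0 : n ≠ 0) (hM : HasSurf M 0 φ) (hn : HasSurf Mn n ψ)
    (hm : HasSurf Mm (-n) ψ) [SurfCont M] [SurfCont Mn] [SurfCont Mm] (A C : ℂ) (w b b' : State)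
    [SurfCont w] [SurfCont b] [SurfCont b'] :
    fvec n (P.nonlinZero e (A • M) (conj A • star M) (C • Mn + conj C • Mm) w b b') =
      (2 : ℂ) • (A • P.B e φ (fvec n b') + conj A • P.B e (star φ) (fvec n b) +
        (C • P.B e ψ (fvec 0 w) + conj C • P.B e ψ (fvec (2 * n) w))) +
      (6 * Real.pi : ℂ) • ((C * (C * conj C)) • P.C e ψ ψ ψ +
        (2 * (C * (A * conj A))) • P.C e φ (star φ) ψ) := by
  have hM' : HasSurf (star M) 0 (star φ) := by simpa using hM.star
  have i1 : n + n + n ≠ n := by omega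
  have i2 : -n + -n + n ≠ n := by omega
  have i3 : -n + n + -n ≠ n := by omega
  have i4 : n + -n + -n ≠ n := by omega
  have i5 : -n + -n + -n ≠ n := by omega
  have i6 : -n ≠ n := by omega
  have i7 : n + n + -n = n := by omega
  have i8 : n + -n + n = n := by omega
  have i9 : -n + n + n = n := by omega
  have j1 : n - -n = 2 * n := by omega
  rw [Params.nonlinZero]
  simp only [trilin_add₁, trilin_add₂, trilin_add₃, trilin_smul₁, trilin_smul₂, trilin_smul₃,
    bilin_add_left, bilin_smul_left, fvec_add, fvec_smul, fvec_bilin P e hM, fvec_bilin P e hM',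
    fvec_bilin P e hn, fvec_bilin P e hm, fvec_trilin hM hM' hn, fvec_trilin hM hM' hm,
    fvec_trilin hn hn hn, fvec_trilin hn hn hm, fvec_trilin hn hm hn, fvec_trilin hn hm hm,
    fvec_trilin hm hn hn, fvec_trilin hm hn hm, fvec_trilin hm hm hn, fvec_trilin hm hm hm,
    if_neg i1, if_neg i2, if_neg i3, if_neg i4, if_neg i5, if_neg i6, if_pos i7, if_pos i8,
    if_pos i9, j1, sub_zero, sub_self, zero_add, add_zero, if_true, smul_zero]
  module

/-- The steady case of the third-order forcing. -/
theorem thirdForcing_steady {μ₁ : Fin 2 → ℝ} {An : ℝ → ℂ} {τ : ℝ} (h : DifferentiableAt ℝ An τ)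
    (W₂ : ℝ → ℝ → State) (N : State) :
    P.thirdForcing e μ₁ (fun s _ => An s • Mn + conj (An s) • Mm) W₂ τ 0 =
      -(deriv An τ • Mn + conj (deriv An τ) • Mm) +
      P.detuning μ₁ ((0 : ℂ) • (An τ • Mn + conj (An τ) • Mm)) (An τ • Mn + conj (An τ) • Mm) +
      P.nonlinZero e ((0 : ℂ) • N) (conj (0 : ℂ) • star N) (An τ • Mn + conj (An τ) • Mm) (W₂ τ 0)
        0 0 := by
  have hd : ∀ a b : ℂ, deriv (fun s => An s * a + conj (An s) * b) τ =
      deriv An τ * a + conj (deriv An τ) * b := fun a b =>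
    ((h.hasDerivAt.mul_const a).add ((hasDerivAt_conj h.hasDerivAt).mul_const b)).deriv
  have e1 : stateDeriv (fun s => An s • Mn + conj (An s) • Mm) τ =
      deriv An τ • Mn + conj (deriv An τ) • Mm :=
    Prod.ext (funext fun z => hd _ _) (Prod.ext (funext fun z => hd _ _)
      (Prod.ext (funext fun θ => hd _ _) (funext fun θ => hd _ _)))
  have e2 : ∀ S : State, stateDeriv (fun _ => S) 0 = 0 := fun S =>
    Prod.ext (funext fun z => deriv_const _ _) (Prod.ext (funext fun z => deriv_const _ _)
      (Prod.ext (funext fun θ => deriv_const _ _) (funext fun θ => deriv_const _ _)))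
  simp only [Params.thirdForcing, Params.nonlinZero, e1, e2, bilin_smul_left, trilin_smul₁]
  simp only [map_zero, zero_smul, smul_zero, zero_add, add_zero]
  abel

end Cubic

/-! ### From solvability to the amplitude equation -/

section Amplitude

variable {P : Params} {e : Fin 2 → ℝ} {lam : ℂ} {μ₁ : Fin 2 → ℝ} {n : ℤ} {φ φs : Fin 2 → ℂ}

theorem inner_bilin_mode (h : 0 ≤ lam.re) {X : State} {k : ℤ} {ψ : Fin 2 → ℂ} (hX : HasSurf X k ψ)
    [SurfCont X] (W : State) [SurfCont W] :
    P.inner (P.adjMode n lam φs) (P.bilin e X W) =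
      P.R * (star φs ⬝ᵥ P.B e ψ (fvec (n - k) W)) := by
  rw [inner_adjMode_surface h n φs _ rfl rfl, fvec_bilin P e hX]

/-- Splits off from the projected nonlinearity the interaction with W0000, which involves only its
mean over the circle; the remainder c is the cubic part. -/
theorem solvabilityCondition_of_fvec {m : ℤ} (hm : m ≠ n) (h : 0 ≤ lam.re)
    (hc : P.CriticalPair e n lam φ φs) {W X N : State} [SurfCont W] [StateCont N] (hU : N.U = 0)
    (hV : N.V = 0) {A A' A₂ A₂' : ℂ} (hX : P.Solves e lam X
      (-(A' • P.mode n lam φ + A₂' • P.mode m lam φ) +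
        P.detuning μ₁ (lam • (A • P.mode n lam φ + A₂ • P.mode m lam φ))
          (A • P.mode n lam φ + A₂ • P.mode m lam φ) + N)
      (P.detuningFlux μ₁ (A • P.mode n lam φ + A₂ • P.mode m lam φ))) {c : ℂ}
    (hN : P.R * (star φs ⬝ᵥ fvec n N) = P.R * (star φs ⬝ᵥ ((2 * A) • P.B e φ (fvec 0 W))) + c) :
    P.SolvabilityCondition e μ₁ n lam φ φs W A A' c := by
  have h1 := solvability hm h hc hU hV hX
  rw [Params.SolvabilityCondition, h1, hN, inner_bilin_mode h (P.hasSurf_mode n lam φ), sub_self,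
    dotProduct_smul, smul_eq_mul]
  ring

theorem solvabilityCondition_of_fvec_single (h : 0 ≤ lam.re) (hc : P.CriticalPair e n lam φ φs)
    {W X N : State} [SurfCont W] [StateCont N] (hU : N.U = 0) (hV : N.V = 0) {A A' : ℂ}
    (hX : P.Solves e lam X
      (-(A' • P.mode n lam φ) + P.detuning μ₁ (lam • (A • P.mode n lam φ)) (A • P.mode n lam φ) + N)
      (P.detuningFlux μ₁ (A • P.mode n lam φ))) {c : ℂ}
    (hN : P.R * (star φs ⬝ᵥ fvec n N) = P.R * (star φs ⬝ᵥ ((2 * A) • P.B e φ (fvec 0 W))) + c) :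
    P.SolvabilityCondition e μ₁ n lam φ φs W A A' c :=
  -- Any index other than n would do, because the second amplitude is zero.
  solvabilityCondition_of_fvec (m := n + 1) (X := X) (A₂ := 0) (A₂' := 0) (by omega) h hc hU hV
    (by simpa only [zero_smul, add_zero] using hX) hN

/-- Inserting the mean surface vector of W0000 into 2⟨𝓦*, 𝓑(𝓦, W0000)⟩ produces the α part of the
linear coefficient vector; the flux term and the detuning make up the rest. -/
theorem hasDerivAt_of_solvabilityCondition (h : 0 ≤ lam.re) {W : State} [SurfCont W]
    (hW : fvec 0 W = (2 * Real.pi * pair P.α μ₁ : ℂ) • P.u0000 e) {A : ℝ → ℂ} {τ : ℝ}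
    (hA : DifferentiableAt ℝ A τ) {c : ℂ}
    (hs : P.SolvabilityCondition e μ₁ n lam φ φs W (A τ) (deriv A τ) c) :
    HasDerivAt A (pair (P.gLinear e n lam φ φs) μ₁ * A τ + c) τ := by
  refine hA.hasDerivAt.congr_deriv ?_
  rw [Params.SolvabilityCondition, inner_bilin_mode h (P.hasSurf_mode n lam φ), sub_self, hW,
    B_smul_right, dotProduct_smul] at hs
  simp only [pair, Params.gLinear, Pi.add_apply, Pi.smul_apply, Pi.sub_apply, smul_eq_mul,
    Matrix.cons_val_zero, Matrix.cons_val_one] at hs ⊢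
  linear_combination hs

end Amplitude

/-! ### The second-order fields -/

section Reductions

variable {P : Params} {e : Fin 2 → ℝ} {μ₁ : Fin 2 → ℝ} {ω : ℝ} {n : ℤ}
  {φ₀ φ₀s φn φns : Fin 2 → ℂ} {W0000 W2000 W1100 W0020 W0011 W1010 W1001 : State}

theorem re_ofReal_mul_I_nonneg (ω : ℝ) : 0 ≤ ((ω : ℂ) * I).re := by simp

theorem hasSurf_star_mode (lam : ℂ) (φ : Fin 2 → ℂ) : HasSurf (star (P.mode 0 lam φ)) 0 (star φ) := by
  simpa using (P.hasSurf_mode 0 lam φ).star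

theorem Params.IsHopfSecond.fvec_W2000 (h : P.IsHopfSecond e ω φ₀ W2000 W1100)
    (hdet : (P.Phi e 0 (2 * (ω * I))).det ≠ 0) :
    fvec 0 W2000 = (2 * Real.pi : ℂ) • P.u2000 e ω φ₀ := by
  have h1 : P.Solves e (2 * (ω * I)) W2000
      ((1 : ℂ) • P.bilin e (P.mode 0 (ω * I) φ₀) (P.mode 0 (ω * I) φ₀)) 0 := by
    rw [one_smul]
    exact h.1
  rw [h1.fvec_bilin (by simp) (P.hasSurf_mode _ _ _) (P.hasSurf_mode _ _ _) 0 hdet, if_pos (add_zero 0),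
    one_smul, Params.u2000]

theorem Params.IsHopfSecond.fvec_W1100 (h : P.IsHopfSecond e ω φ₀ W2000 W1100) (k : ℤ)
    (hdet : (P.Phi e k 0).det ≠ 0) :
    fvec k W1100 = if k = 0 then (2 * Real.pi : ℂ) • P.u1100 e φ₀ else 0 := by
  rw [h.2.fvec_bilin (by simp) (P.hasSurf_mode _ _ _) (hasSurf_star_mode _ _) k hdet, zero_add]
  by_cases hk : k = 0
  · rw [if_pos hk, if_pos hk.symm, hk, Params.u1100]
  · rw [if_neg hk, if_neg (Ne.symm hk)]

theorem Params.IsPitchforkSecond.fvec_W0020 (h : P.IsPitchforkSecond e n φn W0020 W0011) (k : ℤ)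
    (hdet : (P.Phi e k 0).det ≠ 0) :
    fvec k W0020 = if 2 * n = k then (2 * Real.pi : ℂ) • P.u0020 e n φn else 0 := by
  have h1 : P.Solves e 0 W0020 ((1 : ℂ) • P.bilin e (P.mode n 0 φn) (P.mode n 0 φn)) 0 := by
    rw [one_smul]
    exact h.1
  rw [h1.fvec_bilin (by simp) (P.hasSurf_mode _ _ _) (P.hasSurf_mode _ _ _) k hdet, one_smul,
    ← two_mul]
  split_ifs with hk
  · rw [← hk, Params.u0020]
  · rfl

theorem Params.IsPitchforkSecond.fvec_W0011 (h : P.IsPitchforkSecond e n φn W0020 W0011) (k : ℤ)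
    (hdet : (P.Phi e k 0).det ≠ 0) :
    fvec k W0011 = if k = 0 then (2 * Real.pi : ℂ) • P.u0011 e φn else 0 := by
  rw [h.2.fvec_bilin (by simp) (P.hasSurf_mode _ _ _) (P.hasSurf_mode _ _ _) k hdet,
    add_neg_cancel]
  by_cases hk : k = 0
  · rw [if_pos hk, if_pos hk.symm, hk, Params.u0011]
  · rw [if_neg hk, if_neg (Ne.symm hk)]

theorem Params.IsMixedSecond.fvec_W1010 (h : P.IsMixedSecond e ω n φ₀ φn W1010 W1001) (k : ℤ)
    (hdet : (P.Phi e k (ω * I)).det ≠ 0) :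
    fvec k W1010 = if n = k then (2 * Real.pi : ℂ) • P.u1010 e ω n φ₀ φn else 0 := by
  rw [h.1.fvec_bilin (by simp) (P.hasSurf_mode _ _ _) (P.hasSurf_mode _ _ _) k hdet, zero_add]
  split_ifs with hk
  · rw [← hk, Params.u1010]
  · rfl

theorem Params.IsMixedSecond.fvec_W1001 (h : P.IsMixedSecond e ω n φ₀ φn W1010 W1001) (k : ℤ)
    (hdet : (P.Phi e k (ω * I)).det ≠ 0) :
    fvec k W1001 = if -n = k then (2 * Real.pi : ℂ) • P.u1010 e ω n φ₀ φn else 0 := by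
  rw [h.2.fvec_bilin (by simp) (P.hasSurf_mode _ _ _) (P.hasSurf_mode _ _ _) k hdet, zero_add]
  split_ifs with hk
  · rw [← hk, Phi_neg, Params.u1010]
  · rfl

/-! ### The cubic coefficients as inner products -/

/-- Each quadratic term sees the second-order field only at the wave number complementary to its
mode, where Φ is invertible. The 2π carried by the surface integrals, together with R from the
surface measure, is the prefactor of the explicit coefficient. The other three coefficients follow
the same pattern. -/
theorem hopfCubic_eq (h : P.IsHopfSecond e ω φ₀ W2000 W1100) (hΦ₀ : (P.Phi e 0 0).det ≠ 0)
    (hdet : (P.Phi e 0 (2 * (ω * I))).det ≠ 0) :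
    P.hopfCubic e (P.adjMode 0 (ω * I) φ₀s) (P.mode 0 (ω * I) φ₀) W2000 W1100 =
      P.g2100 e ω φ₀ φ₀s := by
  have := h.1.regular.surfCont
  have := h.2.regular.surfCont
  have hM := P.hasSurf_mode 0 (ω * I) φ₀
  have hM' := hasSurf_star_mode (P := P) (ω * I) φ₀
  rw [Params.hopfCubic, inner_adjMode_surface (re_ofReal_mul_I_nonneg ω) 0 φ₀s _
    (by simp [State.U, Params.bilin, Params.trilin]) (by simp [State.V, Params.bilin, Params.trilin])]
  simp only [fvec_add, fvec_smul, fvec_bilin P e hM, fvec_bilin P e hM', fvec_trilin hM hM hM',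
    sub_self, add_zero, if_true, h.fvec_W2000 hdet, h.fvec_W1100 0 hΦ₀, B_smul_right, Params.g2100,
    dotProduct_add, dotProduct_smul, smul_eq_mul]
  ring

theorem pitchforkCubic_eq (h : P.IsPitchforkSecond e n φn W0020 W0011)
    (hΦ₀ : (P.Phi e 0 0).det ≠ 0) (hdet : (P.Phi e (2 * n) 0).det ≠ 0) :
    P.pitchforkCubic e (P.adjMode n 0 φns) (P.mode n 0 φn) (P.mode (-n) 0 φn) W0020 W0011 =
      P.g0021 e n φn φns := by
  have := h.1.regular.surfCont
  have := h.2.regular.surfCont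
  have hn := P.hasSurf_mode n 0 φn
  have hm := P.hasSurf_mode (-n) 0 φn
  have j1 : n - -n = 2 * n := by omega
  rw [Params.pitchforkCubic, inner_adjMode_surface le_rfl n φns _
    (by simp [State.U, Params.bilin, Params.trilin]) (by simp [State.V, Params.bilin, Params.trilin])]
  simp only [fvec_add, fvec_smul, fvec_bilin P e hn, fvec_bilin P e hm, fvec_trilin hn hn hm,
    sub_self, j1, add_neg_cancel_right, if_true, h.fvec_W0020 _ hdet, h.fvec_W0011 0 hΦ₀,
    B_smul_right, Params.g0021, dotProduct_add, dotProduct_smul, smul_eq_mul]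
  ring

theorem hopfMixed_eq (hP : P.IsPitchforkSecond e n φn W0020 W0011)
    (hX : P.IsMixedSecond e ω n φ₀ φn W1010 W1001) (hΦ₀ : (P.Phi e 0 0).det ≠ 0)
    (hdet : (P.Phi e n (ω * I)).det ≠ 0) :
    P.hopfMixed e (P.adjMode 0 (ω * I) φ₀s) (P.mode 0 (ω * I) φ₀) (P.mode n 0 φn)
      (P.mode (-n) 0 φn) W0011 W1010 W1001 = P.g1011 e ω n φ₀ φ₀s φn := by
  have := hP.2.regular.surfCont
  have := hX.1.regular.surfCont
  have := hX.2.regular.surfCont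
  have hM := P.hasSurf_mode 0 (ω * I) φ₀
  have hn := P.hasSurf_mode n 0 φn
  have hm := P.hasSurf_mode (-n) 0 φn
  rw [Params.hopfMixed, inner_adjMode_surface (re_ofReal_mul_I_nonneg ω) 0 φ₀s _
    (by simp [State.U, Params.bilin, Params.trilin]) (by simp [State.V, Params.bilin, Params.trilin])]
  simp only [fvec_add, fvec_smul, fvec_bilin P e hM, fvec_bilin P e hn, fvec_bilin P e hm,
    fvec_trilin hM hn hm, zero_sub, neg_neg, sub_self, zero_add, add_neg_cancel, if_true,
    hP.fvec_W0011 0 hΦ₀, hX.fvec_W1010 n hdet, hX.fvec_W1001 (-n) (by rwa [Phi_neg]),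
    B_smul_right, Params.g1011, dotProduct_add, dotProduct_smul, smul_eq_mul]
  ring

theorem pitchforkMixed_eq (hH : P.IsHopfSecond e ω φ₀ W2000 W1100)
    (hX : P.IsMixedSecond e ω n φ₀ φn W1010 W1001) (hΦ₀ : (P.Phi e 0 0).det ≠ 0)
    (hdet : (P.Phi e n (ω * I)).det ≠ 0) :
    P.pitchforkMixed e (P.adjMode n 0 φns) (P.mode 0 (ω * I) φ₀) (P.mode n 0 φn)
      W1100 W1010 (star W1001) = P.g1110 e ω n φ₀ φn φns := by
  have := hH.2.regular.surfCont
  have := hX.1.regular.surfCont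
  have := hX.2.regular.surfCont
  have hM := P.hasSurf_mode 0 (ω * I) φ₀
  have hM' := hasSurf_star_mode (P := P) (ω * I) φ₀
  have hn := P.hasSurf_mode n 0 φn
  have hpi : star (2 * Real.pi : ℂ) = 2 * Real.pi := by simp
  rw [Params.pitchforkMixed, inner_adjMode_surface le_rfl n φns _
    (by simp [State.U, Params.bilin, Params.trilin]) (by simp [State.V, Params.bilin, Params.trilin])]
  simp only [fvec_add, fvec_smul, fvec_bilin P e hM, fvec_bilin P e hM', fvec_bilin P e hn,
    fvec_trilin hM hM' hn, sub_zero, sub_self, zero_add, if_true, fvec_star, star_smul, hpi,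
    hH.fvec_W1100 0 hΦ₀, hX.fvec_W1010 n hdet, hX.fvec_W1001 (-n) (by rwa [Phi_neg]),
    B_smul_right, Params.g1110, dotProduct_add, dotProduct_smul, smul_eq_mul]
  ring

end Reductions

/-! ### Reality of the steady coefficients -/

section Reality

variable {P : Params} {e : Fin 2 → ℝ}

theorem cpow_half_ofReal {x : ℝ} (hx : 0 ≤ x) : (x : ℂ) ^ (1 / 2 : ℂ) = ((x ^ (1 / 2 : ℝ) : ℝ) : ℂ) := by
  rw [Complex.ofReal_cpow hx]
  norm_num

/-- The radicand is positive at λ = 0, so its principal root is real; here the root itself matters,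
not just its square. -/
theorem conj_Ωv_zero : conj (P.Ωv 0) = P.Ωv 0 := by
  have h : P.Ωv 0 = (((P.σv / P.Dv) ^ (1 / 2 : ℝ) : ℝ) : ℂ) := by
    rw [← cpow_half_ofReal (div_pos P.σv_pos P.Dv_pos).le, Params.Ωv]
    simp
  rw [h, Complex.conj_ofReal]

theorem conj_coefA_zero (n : ℤ) : conj (P.coefA n 0) = P.coefA n 0 := by
  have h : conj (P.κu 0) = P.κu 0 := by simp [Params.κu]
  rw [P.coefA_eq le_rfl, map_mul, conj_prof, Params.ru, conj_resp, h]

theorem conj_coefB_zero (n : ℤ) : conj (P.coefB n 0) = P.coefB n 0 := by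
  have h : conj (P.κv 0) = P.κv 0 := by simp [Params.κv]
  rw [P.coefB_eq le_rfl, map_mul, conj_prof, Params.rv, conj_resp, h]

theorem conj_p_zero (n : ℤ) : conj (P.p n 0) = P.p n 0 := by
  rw [P.p_eq le_rfl, map_sub, map_one, conj_coefA_zero]

theorem conj_q_zero (n : ℤ) : conj (P.q n 0) = P.q n 0 := by
  rw [P.q_eq le_rfl, map_sub, map_one, conj_coefB_zero]

theorem conj_besselI_zero (n : ℤ) :
    conj (besselI n (P.Ωv 0 * P.R)) = besselI n (P.Ωv 0 * P.R) := by
  rw [conj_besselI, map_mul, conj_Ωv_zero, Complex.conj_ofReal]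

theorem conj_bulkWeight_zero (n : ℤ) : conj (P.bulkWeight n 0) = P.bulkWeight n 0 := by
  simp only [Params.bulkWeight, map_mul, map_sub, map_div₀, map_pow, map_one, map_ofNat,
    Complex.conj_ofReal, conj_besselI_zero, conj_Ωv_zero, conj_coefB_zero]

theorem star_α : star P.α = P.α := by
  ext i
  fin_cases i <;> simp [Params.α, conj_besselI_zero, conj_Ωv_zero, conj_q_zero]

theorem star_β : star P.β = P.β := by
  ext i
  fin_cases i <;> simp [Params.β]

theorem star_Phi_zero_mulVec (n : ℤ) (x : Fin 2 → ℂ) :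
    star (P.Phi e n 0 *ᵥ x) = P.Phi e n 0 *ᵥ star x := by
  ext i
  fin_cases i <;>
  simp [Matrix.mulVec, dotProduct, Fin.sum_univ_two, Params.Phi, Params.jac, conj_p_zero,
    conj_q_zero]

/-- Conjugation commutes with Φ_n(0), hence with its inverse by uniqueness of solutions. -/
theorem star_Phi_zero_inv_mulVec {n : ℤ} (h : (P.Phi e n 0).det ≠ 0) (x : Fin 2 → ℂ) :
    star ((P.Phi e n 0)⁻¹ *ᵥ x) = (P.Phi e n 0)⁻¹ *ᵥ star x := by
  refine eq_inv_mulVec h ?_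
  rw [← star_Phi_zero_mulVec, Matrix.mulVec_mulVec,
    Matrix.mul_nonsing_inv _ (isUnit_iff_ne_zero.2 h), Matrix.one_mulVec]

theorem star_toC (x : Fin 2 → ℝ) : star (toC x) = toC x := by
  ext i
  simp [toC]

theorem star_u0000 (h : (P.Phi e 0 0).det ≠ 0) : star (P.u0000 e) = P.u0000 e := by
  rw [Params.u0000, star_Phi_zero_inv_mulVec h]
  congr 1
  ext i
  fin_cases i <;> simp

/-- Conjugation swaps φ₀ and conj φ₀, which the symmetric form does not notice. -/
theorem star_u1100 (h : (P.Phi e 0 0).det ≠ 0) (φ₀ : Fin 2 → ℂ) :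
    star (P.u1100 e φ₀) = P.u1100 e φ₀ := by
  rw [Params.u1100, star_neg, star_smul, star_ofNat, star_Phi_zero_inv_mulVec h, B_star, star_star,
    B_comm]

theorem star_u0011 (h : (P.Phi e 0 0).det ≠ 0) (φ : Fin 2 → ℝ) :
    star (P.u0011 e (toC φ)) = P.u0011 e (toC φ) := by
  rw [Params.u0011, star_neg, star_smul, star_ofNat, star_Phi_zero_inv_mulVec h, B_star, star_toC]

theorem star_u0020 {n : ℤ} (h : (P.Phi e (2 * n) 0).det ≠ 0) (φ : Fin 2 → ℝ) :
    star (P.u0020 e n (toC φ)) = P.u0020 e n (toC φ) := by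
  rw [Params.u0020, star_neg, star_Phi_zero_inv_mulVec h, B_star, star_toC]

theorem conj_dotProduct (x : Fin 2 → ℝ) {y : Fin 2 → ℂ} (hy : star y = y) :
    conj (star (toC x) ⬝ᵥ y) = star (toC x) ⬝ᵥ y := by
  have h0 := congrFun hy 0
  have h1 := congrFun hy 1
  simp only [Pi.star_apply, Complex.star_def] at h0 h1
  simp [dotProduct, Fin.sum_univ_two, toC, h0, h1]

theorem im_real_mul_dotProduct (x : Fin 2 → ℝ) {y : Fin 2 → ℂ} (hy : star y = y) :
    (2 * Real.pi * P.R * (star (toC x) ⬝ᵥ y) : ℂ).im = 0 := by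
  rw [← Complex.conj_eq_iff_im]
  simp only [map_mul, conj_dotProduct x hy, Complex.conj_ofReal, map_ofNat]

theorem im_g0021 {n : ℤ} (h : (P.Phi e 0 0).det ≠ 0) (h2 : (P.Phi e (2 * n) 0).det ≠ 0)
    (φn φns : Fin 2 → ℝ) : (P.g0021 e n (toC φn) (toC φns)).im = 0 := by
  refine im_real_mul_dotProduct φns ?_
  simp only [star_add, star_smul, star_ofNat, B_star, C_star, star_toC, star_u0011 h, star_u0020 h2]

/-- Conjugation exchanges the two terms pairing φ₀ and conj φ₀ with conj u₁₀₁₀ and u₁₀₁₀, and fixes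
the others. -/
theorem im_g1110 {n : ℤ} (h : (P.Phi e 0 0).det ≠ 0) (ω : ℝ) (φ₀ : Fin 2 → ℂ)
    (φn φns : Fin 2 → ℝ) : (P.g1110 e ω n φ₀ (toC φn) (toC φns)).im = 0 := by
  refine im_real_mul_dotProduct φns ?_
  simp only [star_add, star_smul, star_ofNat, B_star, C_star, star_toC, star_u1100 h, star_star]
  rw [C_swap_left P e (star φ₀)]
  abel

theorem im_gLinear {n : ℤ} (h : (P.Phi e 0 0).det ≠ 0) (φn φns : Fin 2 → ℝ) (j : Fin 2) :
    (P.gLinear e n 0 (toC φn) (toC φns) j).im = 0 := by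
  have hB : star (P.B e (toC φn) (P.u0000 e)) = P.B e (toC φn) (P.u0000 e) := by
    rw [B_star, star_toC, star_u0000 h]
  have hd := conj_dotProduct φns hB
  have hα := congrFun (star_α (P := P)) j
  have hβ := congrFun (star_β (P := P)) j
  simp only [Pi.star_apply, Complex.star_def] at hα hβ
  have hE1 : conj ((![1, 0] : Fin 2 → ℂ) j) = (![1, 0] : Fin 2 → ℂ) j := by
    fin_cases j <;> simp
  have hE2 : conj ((![0, 1] : Fin 2 → ℂ) j) = (![0, 1] : Fin 2 → ℂ) j := by
    fin_cases j <;> simp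
  rw [← Complex.conj_eq_iff_im]
  simp only [Params.gLinear, Pi.add_apply, Pi.sub_apply, Pi.smul_apply, smul_eq_mul, map_add,
    map_sub, map_mul, hd, hα, hβ, hE1, hE2, conj_coefB_zero, conj_q_zero, conj_bulkWeight_zero,
    Complex.conj_ofReal, map_ofNat, toC]

end Reality

/-! ### The three reductions -/

section Main

variable {P : Params} {e : Fin 2 → ℝ} {μ₁ : Fin 2 → ℝ} {ω : ℝ} {n : ℤ}
  {φ₀ φ₀s φn φns : Fin 2 → ℂ} {W0000 W2000 W1100 W0020 W0011 W1010 W1001 : State}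
  {A₀ An : ℝ → ℂ} {τ : ℝ}

theorem isAdjointEigen_hopf (hc : P.CriticalPair e 0 (ω * I) φ₀ φ₀s) :
    P.IsAdjointEigen e (-(ω * I)) (P.adjMode 0 (ω * I) φ₀s) := by
  simpa using P.isAdjointEigen_adjMode (re_ofReal_mul_I_nonneg ω) hc.adjoint_kernel

theorem isAdjointEigen_pitchfork (hc : P.CriticalPair e n 0 φn φns) :
    P.IsAdjointEigen e 0 (P.adjMode n 0 φns) := by
  simpa using P.isAdjointEigen_adjMode le_rfl hc.adjoint_kernel

theorem exp_two_mul (ω t : ℝ) : exp (2 * ω * t * I) = exp (ω * t * I) ^ 2 := by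
  rw [← Complex.exp_nat_mul]
  push_cast
  ring_nf

theorem exp_neg_two_mul (ω t : ℝ) : exp (-(2 * ω * t * I)) = exp (-(ω * t * I)) ^ 2 := by
  rw [← Complex.exp_nat_mul]
  push_cast
  ring_nf

theorem hopf_solvability (hW : P.IsBaseCorrection e μ₁ W0000) (hΦ₀ : (P.Phi e 0 0).det ≠ 0)
    (hω : 0 < ω) (hc : P.CriticalPair e 0 (ω * I) φ₀ φ₀s)
    (hΦ₂ : (P.Phi e 0 (2 * (ω * I))).det ≠ 0) (hH : P.IsHopfSecond e ω φ₀ W2000 W1100)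
    (hA : DifferentiableAt ℝ A₀ τ) {X : State}
    (hX : P.Solves e (ω * I) X
      (stateHarmonic ω 1 (P.thirdForcing e μ₁ (P.hopfFirst ω φ₀ A₀)
        (fun s t => W0000 + hopfSecond ω W2000 W1100 A₀ s t) τ))
      (fun θ => harmonic ω 1 (fun t => P.detuningFlux μ₁ (P.hopfFirst ω φ₀ A₀ τ t) θ))) :
    P.SolvabilityCondition e μ₁ 0 (ω * I) φ₀ φ₀s W0000 (A₀ τ) (deriv A₀ τ)
      (P.g2100 e ω φ₀ φ₀s * (‖A₀ τ‖ : ℂ) ^ 2 * A₀ τ) := by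
  have := hW.regular.surfCont
  have := hH.1.regular.surfCont
  have := hH.2.regular.surfCont
  have hre := re_ofReal_mul_I_nonneg ω
  have hM := P.hasSurf_mode 0 (ω * I) φ₀
  have hn := P.hasSurf_mode 1 0 0
  have hm := P.hasSurf_mode (-1) 0 0
  -- The modes ±1 with zero vector and zero amplitude are placeholders, so that the formulas for the
  -- mixed ansatz apply with a nonzero index.
  have e1 : P.hopfFirst ω φ₀ A₀ = firstOrder ω (P.mode 0 (ω * I) φ₀) (P.mode 1 0 0)
      (P.mode (-1) 0 0) A₀ (fun _ => 0) := by
    funext s t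
    simp [Params.hopfFirst, firstOrder]
  have e2 : ∀ t : ℝ, W0000 + hopfSecond ω W2000 W1100 A₀ τ t =
      (W0000 + ((‖A₀ τ‖ : ℂ) ^ 2) • W1100) + exp (ω * t * I) • (0 : State) +
        exp (-(ω * t * I)) • (0 : State) + exp (ω * t * I) ^ 2 • (A₀ τ ^ 2) • W2000 +
        exp (-(ω * t * I)) ^ 2 • (conj (A₀ τ) ^ 2) • star W2000 := by
    intro t
    rw [hopfSecond, exp_two_mul, exp_neg_two_mul]
    module
  rw [e1, (thirdForcing_harmonics hω hA (differentiableAt_const 0) e2).2,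
    (detuningFlux_harmonics hω).2] at hX
  refine solvabilityCondition_of_fvec_single hre hc (nonlinOne_bulk _ _ _ _ _ _).1
    (nonlinOne_bulk _ _ _ _ _ _).2 hX ?_
  rw [fvec_nonlinOne one_ne_zero hM hn hm]
  simp only [fvec_add, fvec_smul, fvec_zero_state, hH.fvec_W2000 hΦ₂, hH.fvec_W1100 0 hΦ₀, if_true,
    B_add_right, B_smul_right, Params.g2100, dotProduct_add, dotProduct_smul, smul_eq_mul,
    ← Complex.mul_conj', map_zero]
  ring

instance [SurfCont W0020] [SurfCont W0011] : SurfCont (pitchforkSecond W0020 W0011 An τ) := by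
  unfold pitchforkSecond
  infer_instance

/-- The second-order field is read at 0, where W0000 and W0011 contribute, and at 2n, where only
W0020 does: conj W0020 has wave number -2n, and invertibility of Φ_{2n}(0) rules out stray 2n
components of W0000 and W0011. -/
theorem pitchfork_solvability (hW : P.IsBaseCorrection e μ₁ W0000) (hΦ₀ : (P.Phi e 0 0).det ≠ 0)
    (hn0 : n ≠ 0) (hc : P.CriticalPair e n 0 φn φns) (hΦ₂ : (P.Phi e (2 * n) 0).det ≠ 0)
    (hP : P.IsPitchforkSecond e n φn W0020 W0011) (hA : DifferentiableAt ℝ An τ) {Y : State}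
    (hY : P.Solves e 0 Y (P.thirdForcing e μ₁ (fun s _ => P.pitchforkFirst n φn An s)
      (fun s _ => W0000 + pitchforkSecond W0020 W0011 An s) τ 0)
      (P.detuningFlux μ₁ (P.pitchforkFirst n φn An τ))) :
    P.SolvabilityCondition e μ₁ n 0 φn φns W0000 (An τ) (deriv An τ)
      (P.g0021 e n φn φns * (‖An τ‖ : ℂ) ^ 2 * An τ) := by
  have := hW.regular.surfCont
  have := hP.1.regular.surfCont
  have := hP.2.regular.surfCont
  have hM := P.hasSurf_mode 0 0 0
  have hn := P.hasSurf_mode n 0 φn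
  have hm := P.hasSurf_mode (-n) 0 φn
  have i1 : 2 * n ≠ 0 := by omega
  have i2 : 2 * n ≠ -(2 * n) := by omega
  have hΦ₂' : (P.Phi e (-(2 * n)) 0).det ≠ 0 := by rwa [Phi_neg]
  unfold Params.pitchforkFirst at hY
  rw [thirdForcing_steady hA _ (P.mode 0 0 0)] at hY
  refine solvabilityCondition_of_fvec (m := -n) (by omega) le_rfl hc
    (nonlinZero_bulk _ _ _ _ _ _).1 (nonlinZero_bulk _ _ _ _ _ _).2 hY ?_
  simp only [pitchforkSecond]
  rw [fvec_nonlinZero hn0 hM hn hm]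
  simp only [fvec_add, fvec_smul, fvec_zero_state, fvec_star, neg_zero,
    fvec_baseCorrection hW _ hΦ₂, hP.fvec_W0020 _ hΦ₂, hP.fvec_W0020 _ hΦ₀, hP.fvec_W0020 _ hΦ₂',
    hP.fvec_W0011 _ hΦ₀, hP.fvec_W0011 _ hΦ₂, if_true, if_neg i1, if_neg i2, star_zero,
    B_add_right, B_smul_right, B_zero_right, Params.g0021, dotProduct_add, dotProduct_smul,
    dotProduct_zero, smul_eq_mul, ← Complex.mul_conj', map_zero]
  ring

/-- The part of the second-order field at a pitchfork-Hopf point that is constant in time. -/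
def meanSecond (W0000 W1100 W0020 W0011 : State) (a c : ℂ) : State :=
  W0000 + ((‖a‖ : ℂ) ^ 2) • W1100 + pitchforkSecond W0020 W0011 (fun _ => c) 0

/-- Sorting by powers of e^{iωt} brings the second-order field into the shape that
`thirdForcing_harmonics` takes. -/
theorem mixed_second_eq (t : ℝ) :
    W0000 + hopfSecond ω W2000 W1100 A₀ τ t + pitchforkSecond W0020 W0011 An τ +
      mixedSecond ω W1010 W1001 A₀ An τ t =
      meanSecond W0000 W1100 W0020 W0011 (A₀ τ) (An τ) +
        exp (ω * t * I) • ((A₀ τ * An τ) • W1010 + (A₀ τ * conj (An τ)) • W1001) +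
        exp (-(ω * t * I)) • ((conj (A₀ τ) * An τ) • star W1001 +
          (conj (A₀ τ) * conj (An τ)) • star W1010) +
        exp (ω * t * I) ^ 2 • (A₀ τ ^ 2) • W2000 +
        exp (-(ω * t * I)) ^ 2 • (conj (A₀ τ) ^ 2) • star W2000 := by
  rw [hopfSecond, mixedSecond, meanSecond, exp_two_mul, exp_neg_two_mul]
  simp only [pitchforkSecond]
  module

instance [SurfCont W0000] [SurfCont W1100] [SurfCont W0020] [SurfCont W0011] (a c : ℂ) :
    SurfCont (meanSecond W0000 W1100 W0020 W0011 a c) := by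
  unfold meanSecond
  infer_instance

/-- At frequency 1 and wave number 0 the terms A₀|A_n|² come from 𝓦₀ with W0011, 𝓦_n with W1001 and
𝓦_{-n} with W1010. The last two have the same surface vector because Φ_{-n} = Φ_n. -/
theorem mixed_hopf_solvability (hW : P.IsBaseCorrection e μ₁ W0000)
    (hΦ₀ : (P.Phi e 0 0).det ≠ 0) (hω : 0 < ω) (hn0 : n ≠ 0)
    (hc : P.CriticalPair e 0 (ω * I) φ₀ φ₀s) (hΦω : (P.Phi e 0 (2 * (ω * I))).det ≠ 0)
    (hΦn : (P.Phi e n (ω * I)).det ≠ 0) (hH : P.IsHopfSecond e ω φ₀ W2000 W1100)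
    (hP : P.IsPitchforkSecond e n φn W0020 W0011) (hX : P.IsMixedSecond e ω n φ₀ φn W1010 W1001)
    (hA₀ : DifferentiableAt ℝ A₀ τ) (hAn : DifferentiableAt ℝ An τ) {X : State}
    (hS : P.Solves e (ω * I) X
      (stateHarmonic ω 1 (P.thirdForcing e μ₁
        (fun s t => P.hopfFirst ω φ₀ A₀ s t + P.pitchforkFirst n φn An s)
        (fun s t => W0000 + hopfSecond ω W2000 W1100 A₀ s t + pitchforkSecond W0020 W0011 An s +
          mixedSecond ω W1010 W1001 A₀ An s t) τ))
      (fun θ => harmonic ω 1 (fun t => P.detuningFlux μ₁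
        (P.hopfFirst ω φ₀ A₀ τ t + P.pitchforkFirst n φn An τ) θ))) :
    P.SolvabilityCondition e μ₁ 0 (ω * I) φ₀ φ₀s W0000 (A₀ τ) (deriv A₀ τ)
      (P.g2100 e ω φ₀ φ₀s * (‖A₀ τ‖ : ℂ) ^ 2 * A₀ τ +
        P.g1011 e ω n φ₀ φ₀s φn * (‖An τ‖ : ℂ) ^ 2 * A₀ τ) := by
  have := hW.regular.surfCont
  have := hH.1.regular.surfCont
  have := hH.2.regular.surfCont
  have := hP.1.regular.surfCont
  have := hP.2.regular.surfCont
  have := hX.1.regular.surfCont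
  have := hX.2.regular.surfCont
  have hM := P.hasSurf_mode 0 (ω * I) φ₀
  have hn := P.hasSurf_mode n 0 φn
  have hm := P.hasSurf_mode (-n) 0 φn
  have hΦn' : (P.Phi e (-n) (ω * I)).det ≠ 0 := by rwa [Phi_neg]
  have i1 : 2 * n ≠ 0 := by omega
  have i2 : n ≠ -n := by omega
  have i3 : -n ≠ n := by omega
  have e1 : (fun s t => P.hopfFirst ω φ₀ A₀ s t + P.pitchforkFirst n φn An s) =
      firstOrder ω (P.mode 0 (ω * I) φ₀) (P.mode n 0 φn) (P.mode (-n) 0 φn) A₀ An := rfl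
  have hF := (thirdForcing_harmonics (P := P) (e := e) (μ₁ := μ₁) (M := P.mode 0 (ω * I) φ₀)
    (Mn := P.mode n 0 φn) (Mm := P.mode (-n) 0 φn) hω hA₀ hAn
    (W₂ := fun s t => W0000 + hopfSecond ω W2000 W1100 A₀ s t + pitchforkSecond W0020 W0011 An s +
      mixedSecond ω W1010 W1001 A₀ An s t)
    (fun t => mixed_second_eq (W0000 := W0000) (W2000 := W2000) (W1100 := W1100) (W0020 := W0020)
      (W0011 := W0011) (W1010 := W1010) (W1001 := W1001) t)).2
  have hη := (detuningFlux_harmonics (P := P) (μ₁ := μ₁) (M := P.mode 0 (ω * I) φ₀)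
    (Mn := P.mode n 0 φn) (Mm := P.mode (-n) 0 φn) (A₀ := A₀) (An := An) (τ := τ) hω).2
  replace hS := hη ▸ hF ▸ e1 ▸ hS
  refine solvabilityCondition_of_fvec_single (re_ofReal_mul_I_nonneg ω) hc
    (nonlinOne_bulk _ _ _ _ _ _).1 (nonlinOne_bulk _ _ _ _ _ _).2 hS ?_
  rw [fvec_nonlinOne hn0 hM hn hm]
  simp only [meanSecond, pitchforkSecond, fvec_add, fvec_smul, fvec_star, neg_zero,
    hH.fvec_W2000 hΦω, hH.fvec_W1100 0 hΦ₀, hP.fvec_W0020 0 hΦ₀, hP.fvec_W0011 0 hΦ₀,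
    hX.fvec_W1010 n hΦn, hX.fvec_W1010 (-n) hΦn', hX.fvec_W1001 n hΦn, hX.fvec_W1001 (-n) hΦn',
    if_true, if_neg i1, if_neg i2, if_neg i3, star_zero, smul_zero, add_zero, zero_add,
    B_add_right, B_smul_right, Params.g2100, Params.g1011, dotProduct_add,
    dotProduct_smul, smul_eq_mul, ← Complex.mul_conj']
  ring

/-- At frequency 0 and wave number n the terms A_n|A₀|² come from 𝓦_n with W1100 and from products
of opposite frequency: conj 𝓦₀ with W1010, and 𝓦₀ with conj W1001, whose wave number is n since that
of W1001 is -n. -/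
theorem mixed_pitchfork_solvability (hW : P.IsBaseCorrection e μ₁ W0000)
    (hΦ₀ : (P.Phi e 0 0).det ≠ 0) (hω : 0 < ω) (hn0 : n ≠ 0)
    (hc : P.CriticalPair e n 0 φn φns) (hΦ₂ : (P.Phi e (2 * n) 0).det ≠ 0)
    (hΦn : (P.Phi e n (ω * I)).det ≠ 0) (hH : P.IsHopfSecond e ω φ₀ W2000 W1100)
    (hP : P.IsPitchforkSecond e n φn W0020 W0011) (hX : P.IsMixedSecond e ω n φ₀ φn W1010 W1001)
    (hA₀ : DifferentiableAt ℝ A₀ τ) (hAn : DifferentiableAt ℝ An τ) {Y : State}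
    (hS : P.Solves e 0 Y
      (stateHarmonic ω 0 (P.thirdForcing e μ₁
        (fun s t => P.hopfFirst ω φ₀ A₀ s t + P.pitchforkFirst n φn An s)
        (fun s t => W0000 + hopfSecond ω W2000 W1100 A₀ s t + pitchforkSecond W0020 W0011 An s +
          mixedSecond ω W1010 W1001 A₀ An s t) τ))
      (fun θ => harmonic ω 0 (fun t => P.detuningFlux μ₁
        (P.hopfFirst ω φ₀ A₀ τ t + P.pitchforkFirst n φn An τ) θ))) :
    P.SolvabilityCondition e μ₁ n 0 φn φns W0000 (An τ) (deriv An τ)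
      (P.g0021 e n φn φns * (‖An τ‖ : ℂ) ^ 2 * An τ +
        P.g1110 e ω n φ₀ φn φns * (‖A₀ τ‖ : ℂ) ^ 2 * An τ) := by
  have := hW.regular.surfCont
  have := hH.1.regular.surfCont
  have := hH.2.regular.surfCont
  have := hP.1.regular.surfCont
  have := hP.2.regular.surfCont
  have := hX.1.regular.surfCont
  have := hX.2.regular.surfCont
  have hM := P.hasSurf_mode 0 (ω * I) φ₀
  have hn := P.hasSurf_mode n 0 φn
  have hm := P.hasSurf_mode (-n) 0 φn
  have hΦn' : (P.Phi e (-n) (ω * I)).det ≠ 0 := by rwa [Phi_neg]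
  have hΦ₂' : (P.Phi e (-(2 * n)) 0).det ≠ 0 := by rwa [Phi_neg]
  have i1 : 2 * n ≠ 0 := by omega
  have i2 : n ≠ -n := by omega
  have i3 : -n ≠ n := by omega
  have i4 : 2 * n ≠ -(2 * n) := by omega
  have hpi : star (2 * Real.pi : ℂ) = 2 * Real.pi := by simp
  have e1 : (fun s t => P.hopfFirst ω φ₀ A₀ s t + P.pitchforkFirst n φn An s) =
      firstOrder ω (P.mode 0 (ω * I) φ₀) (P.mode n 0 φn) (P.mode (-n) 0 φn) A₀ An := rfl
  have hF := (thirdForcing_harmonics (P := P) (e := e) (μ₁ := μ₁) (M := P.mode 0 (ω * I) φ₀)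
    (Mn := P.mode n 0 φn) (Mm := P.mode (-n) 0 φn) hω hA₀ hAn
    (W₂ := fun s t => W0000 + hopfSecond ω W2000 W1100 A₀ s t + pitchforkSecond W0020 W0011 An s +
      mixedSecond ω W1010 W1001 A₀ An s t)
    (fun t => mixed_second_eq (W0000 := W0000) (W2000 := W2000) (W1100 := W1100) (W0020 := W0020)
      (W0011 := W0011) (W1010 := W1010) (W1001 := W1001) t)).1
  have hη := (detuningFlux_harmonics (P := P) (μ₁ := μ₁) (M := P.mode 0 (ω * I) φ₀)
    (Mn := P.mode n 0 φn) (Mm := P.mode (-n) 0 φn) (A₀ := A₀) (An := An) (τ := τ) hω).1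
  replace hS := hη ▸ hF ▸ e1 ▸ hS
  refine solvabilityCondition_of_fvec (m := -n) (by omega) le_rfl hc
    (nonlinZero_bulk _ _ _ _ _ _).1 (nonlinZero_bulk _ _ _ _ _ _).2 hS ?_
  rw [fvec_nonlinZero hn0 hM hn hm]
  simp only [meanSecond, pitchforkSecond, fvec_add, fvec_smul, fvec_star, neg_zero,
    fvec_baseCorrection hW _ hΦ₂, hH.fvec_W1100 0 hΦ₀, hH.fvec_W1100 _ hΦ₂, hP.fvec_W0020 0 hΦ₀,
    hP.fvec_W0020 _ hΦ₂, hP.fvec_W0020 _ hΦ₂', hP.fvec_W0011 0 hΦ₀, hP.fvec_W0011 _ hΦ₂,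
    hX.fvec_W1010 n hΦn, hX.fvec_W1010 (-n) hΦn', hX.fvec_W1001 n hΦn, hX.fvec_W1001 (-n) hΦn',
    if_true, if_neg i1, if_neg i2, if_neg i3, if_neg i4, star_zero, star_smul, hpi, smul_zero,
    add_zero, zero_add, B_add_right, B_smul_right, Params.g0021, Params.g1110,
    dotProduct_add, dotProduct_smul, smul_eq_mul, ← Complex.mul_conj']
  ring

end Main

end BulkSurface

end

/-! ### Assembly of the three bifurcation cases -/

theorem mainTheorem1 (P : Params) (e : Fin 2 → ℝ)
    (hfg : ContDiffAt ℝ 3 (fun x : ℝ × ℝ => P.f x.1 x.2) (e 0, e 1) ∧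
      ContDiffAt ℝ 3 (fun x : ℝ × ℝ => P.g x.1 x.2) (e 0, e 1))
    (he : P.IsSteady e) (μ₁ : Fin 2 → ℝ) (hμ₁ : μ₁ 0 ^ 2 + μ₁ 1 ^ 2 = 1)
    (W0000 : State) (hW0000 : P.IsBaseCorrection e μ₁ W0000)
    (hΦ₀ : (P.Phi e 0 0).det ≠ 0) :
    -- Hopf bifurcation
    (∀ (ω : ℝ) (φ₀ φ₀s : Fin 2 → ℂ) (W2000 W1100 : State), 0 < ω →
      P.CriticalPair e 0 (ω * Complex.I) φ₀ φ₀s →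
      (P.Phi e 0 (2 * (ω * Complex.I))).det ≠ 0 →
      P.IsHopfSecond e ω φ₀ W2000 W1100 →
      let W₀ := P.mode 0 (ω * Complex.I) φ₀
      let W₀s := P.adjMode 0 (ω * Complex.I) φ₀s
      P.IsAdjointEigen e (-(ω * Complex.I)) W₀s ∧
      P.hopfCubic e W₀s W₀ W2000 W1100 = P.g2100 e ω φ₀ φ₀s ∧
      ∀ (A₀ : ℝ → ℂ) (τ : ℝ), DifferentiableAt ℝ A₀ τ →
        let W₁ : ℝ → ℝ → State := P.hopfFirst ω φ₀ A₀
        let W₂ : ℝ → ℝ → State := fun s t => W0000 + hopfSecond ω W2000 W1100 A₀ s t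
        (∃ X : State, P.Solves e (ω * Complex.I) X
          (stateHarmonic ω 1 (P.thirdForcing e μ₁ W₁ W₂ τ))
          (fun θ => harmonic ω 1 (fun t => P.detuningFlux μ₁ (W₁ τ t) θ))) →
        P.SolvabilityCondition e μ₁ 0 (ω * Complex.I) φ₀ φ₀s W0000 (A₀ τ) (deriv A₀ τ)
          (P.hopfCubic e W₀s W₀ W2000 W1100 * (‖A₀ τ‖ : ℂ) ^ 2 * A₀ τ) ∧
        HasDerivAt A₀ (pair (P.gLinear e 0 (ω * Complex.I) φ₀ φ₀s) μ₁ * A₀ τ +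
          P.g2100 e ω φ₀ φ₀s * (‖A₀ τ‖ : ℂ) ^ 2 * A₀ τ) τ) ∧
    -- Pitchfork bifurcation
    (∀ (n : ℤ) (φn φns : Fin 2 → ℝ) (W0020 W0011 : State), n ≠ 0 →
      P.CriticalPair e n 0 (toC φn) (toC φns) →
      (P.Phi e (2 * n) 0).det ≠ 0 →
      P.IsPitchforkSecond e n (toC φn) W0020 W0011 →
      let Wn := P.mode n 0 (toC φn)
      let Wm := P.mode (-n) 0 (toC φn)
      let Wns := P.adjMode n 0 (toC φns)
      P.IsAdjointEigen e 0 Wns ∧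
      P.pitchforkCubic e Wns Wn Wm W0020 W0011 = P.g0021 e n (toC φn) (toC φns) ∧
      (P.g0021 e n (toC φn) (toC φns)).im = 0 ∧
      (∀ j, (P.gLinear e n 0 (toC φn) (toC φns) j).im = 0) ∧
      ∀ (An : ℝ → ℂ) (τ : ℝ), DifferentiableAt ℝ An τ →
        let W₁ : ℝ → ℝ → State := fun s _ => P.pitchforkFirst n (toC φn) An s
        let W₂ : ℝ → ℝ → State := fun s _ => W0000 + pitchforkSecond W0020 W0011 An s
        (∃ Y : State, P.Solves e 0 Y (P.thirdForcing e μ₁ W₁ W₂ τ 0)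
          (P.detuningFlux μ₁ (W₁ τ 0))) →
        P.SolvabilityCondition e μ₁ n 0 (toC φn) (toC φns) W0000 (An τ) (deriv An τ)
          (P.pitchforkCubic e Wns Wn Wm W0020 W0011 * (‖An τ‖ : ℂ) ^ 2 * An τ) ∧
        HasDerivAt An (pair (P.gLinear e n 0 (toC φn) (toC φns)) μ₁ * An τ +
          P.g0021 e n (toC φn) (toC φns) * (‖An τ‖ : ℂ) ^ 2 * An τ) τ) ∧
    -- Pitchfork-Hopf bifurcation
    (∀ (ω : ℝ) (n : ℤ) (φ₀ φ₀s : Fin 2 → ℂ) (φn φns : Fin 2 → ℝ)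
      (W2000 W1100 W0020 W0011 W1010 W1001 : State), 0 < ω → n ≠ 0 →
      P.CriticalPair e 0 (ω * Complex.I) φ₀ φ₀s →
      P.CriticalPair e n 0 (toC φn) (toC φns) →
      (P.Phi e 0 (2 * (ω * Complex.I))).det ≠ 0 →
      (P.Phi e (2 * n) 0).det ≠ 0 →
      (P.Phi e n (ω * Complex.I)).det ≠ 0 →
      P.IsHopfSecond e ω φ₀ W2000 W1100 →
      P.IsPitchforkSecond e n (toC φn) W0020 W0011 →
      P.IsMixedSecond e ω n φ₀ (toC φn) W1010 W1001 →
      let W₀ := P.mode 0 (ω * Complex.I) φ₀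
      let W₀s := P.adjMode 0 (ω * Complex.I) φ₀s
      let Wn := P.mode n 0 (toC φn)
      let Wm := P.mode (-n) 0 (toC φn)
      let Wns := P.adjMode n 0 (toC φns)
      P.IsAdjointEigen e (-(ω * Complex.I)) W₀s ∧
      P.IsAdjointEigen e 0 Wns ∧
      P.hopfCubic e W₀s W₀ W2000 W1100 = P.g2100 e ω φ₀ φ₀s ∧
      P.hopfMixed e W₀s W₀ Wn Wm W0011 W1010 W1001 = P.g1011 e ω n φ₀ φ₀s (toC φn) ∧
      P.pitchforkCubic e Wns Wn Wm W0020 W0011 = P.g0021 e n (toC φn) (toC φns) ∧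
      P.pitchforkMixed e Wns W₀ Wn W1100 W1010 (star W1001) =
        P.g1110 e ω n φ₀ (toC φn) (toC φns) ∧
      (P.g0021 e n (toC φn) (toC φns)).im = 0 ∧
      (P.g1110 e ω n φ₀ (toC φn) (toC φns)).im = 0 ∧
      (∀ j, (P.gLinear e n 0 (toC φn) (toC φns) j).im = 0) ∧
      ∀ (A₀ An : ℝ → ℂ) (τ : ℝ), DifferentiableAt ℝ A₀ τ → DifferentiableAt ℝ An τ →
        let W₁ : ℝ → ℝ → State := fun s t =>
          P.hopfFirst ω φ₀ A₀ s t + P.pitchforkFirst n (toC φn) An s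
        let W₂ : ℝ → ℝ → State := fun s t =>
          W0000 + hopfSecond ω W2000 W1100 A₀ s t + pitchforkSecond W0020 W0011 An s +
            mixedSecond ω W1010 W1001 A₀ An s t
        (∃ X : State, P.Solves e (ω * Complex.I) X
          (stateHarmonic ω 1 (P.thirdForcing e μ₁ W₁ W₂ τ))
          (fun θ => harmonic ω 1 (fun t => P.detuningFlux μ₁ (W₁ τ t) θ))) →
        (∃ Y : State, P.Solves e 0 Y
          (stateHarmonic ω 0 (P.thirdForcing e μ₁ W₁ W₂ τ))
          (fun θ => harmonic ω 0 (fun t => P.detuningFlux μ₁ (W₁ τ t) θ))) →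
        P.SolvabilityCondition e μ₁ 0 (ω * Complex.I) φ₀ φ₀s W0000 (A₀ τ) (deriv A₀ τ)
          (P.hopfCubic e W₀s W₀ W2000 W1100 * (‖A₀ τ‖ : ℂ) ^ 2 * A₀ τ +
            P.hopfMixed e W₀s W₀ Wn Wm W0011 W1010 W1001 * (‖An τ‖ : ℂ) ^ 2 * A₀ τ) ∧
        P.SolvabilityCondition e μ₁ n 0 (toC φn) (toC φns) W0000 (An τ) (deriv An τ)
          (P.pitchforkCubic e Wns Wn Wm W0020 W0011 * (‖An τ‖ : ℂ) ^ 2 * An τ +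
            P.pitchforkMixed e Wns W₀ Wn W1100 W1010 (star W1001) *
              (‖A₀ τ‖ : ℂ) ^ 2 * An τ) ∧
        HasDerivAt A₀ (pair (P.gLinear e 0 (ω * Complex.I) φ₀ φ₀s) μ₁ * A₀ τ +
          P.g2100 e ω φ₀ φ₀s * (‖A₀ τ‖ : ℂ) ^ 2 * A₀ τ +
          P.g1011 e ω n φ₀ φ₀s (toC φn) * (‖An τ‖ : ℂ) ^ 2 * A₀ τ) τ ∧
        HasDerivAt An (pair (P.gLinear e n 0 (toC φn) (toC φns)) μ₁ * An τ +
          P.g0021 e n (toC φn) (toC φns) * (‖An τ‖ : ℂ) ^ 2 * An τ +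
          P.g1110 e ω n φ₀ (toC φn) (toC φns) * (‖A₀ τ‖ : ℂ) ^ 2 * An τ) τ) := by
  have h0 : (0 : ℝ) ≤ (0 : ℂ).re := le_rfl
  have := hW0000.regular.surfCont
  have hw : fvec 0 W0000 = (2 * Real.pi * pair P.α μ₁ : ℂ) • P.u0000 e := by
    rw [fvec_baseCorrection hW0000 0 hΦ₀, if_pos rfl]
  refine ⟨?_, ?_, ?_⟩
  · intro ω φ₀ φ₀s W2000 W1100 hω hc hΦ₂ hH
    have hre := re_ofReal_mul_I_nonneg ω
    refine ⟨isAdjointEigen_hopf hc, hopfCubic_eq hH hΦ₀ hΦ₂, fun A₀ τ hA => ?_⟩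
    rintro W₁ W₂ ⟨X, hX⟩
    rw [hopfCubic_eq hH hΦ₀ hΦ₂]
    have hs := hopf_solvability hW0000 hΦ₀ hω hc hΦ₂ hH hA hX
    exact ⟨hs, hasDerivAt_of_solvabilityCondition hre hw hA hs⟩
  · intro n φn φns W0020 W0011 hn hc hΦ₂ hP
    refine ⟨isAdjointEigen_pitchfork hc, pitchforkCubic_eq hP hΦ₀ hΦ₂, im_g0021 hΦ₀ hΦ₂ φn φns,
      im_gLinear hΦ₀ φn φns, fun An τ hA => ?_⟩
    rintro W₁ W₂ ⟨Y, hY⟩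
    rw [pitchforkCubic_eq hP hΦ₀ hΦ₂]
    have hs := pitchfork_solvability hW0000 hΦ₀ hn hc hΦ₂ hP hA hY
    exact ⟨hs, hasDerivAt_of_solvabilityCondition h0 hw hA hs⟩
  · intro ω n φ₀ φ₀s φn φns W2000 W1100 W0020 W0011 W1010 W1001 hω hn hc₀ hcn hΦω hΦ₂ hΦn hH hP hM
    have hre := re_ofReal_mul_I_nonneg ω
    refine ⟨isAdjointEigen_hopf hc₀, isAdjointEigen_pitchfork hcn, hopfCubic_eq hH hΦ₀ hΦω,
      hopfMixed_eq hP hM hΦ₀ hΦn, pitchforkCubic_eq hP hΦ₀ hΦ₂, pitchforkMixed_eq hH hM hΦ₀ hΦn,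
      im_g0021 hΦ₀ hΦ₂ φn φns, im_g1110 hΦ₀ ω φ₀ φn φns, im_gLinear hΦ₀ φn φns,
      fun A₀ An τ hA₀ hAn => ?_⟩
    rintro W₁ W₂ ⟨X, hX⟩ ⟨Y, hY⟩
    rw [hopfCubic_eq hH hΦ₀ hΦω, hopfMixed_eq hP hM hΦ₀ hΦn, pitchforkCubic_eq hP hΦ₀ hΦ₂,
      pitchforkMixed_eq hH hM hΦ₀ hΦn]
    have hs₀ := mixed_hopf_solvability hW0000 hΦ₀ hω hn hc₀ hΦω hΦn hH hP hM hA₀ hAn hX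
    have hsn := mixed_pitchfork_solvability hW0000 hΦ₀ hω hn hcn hΦ₂ hΦn hH hP hM hA₀ hAn hY
    refine ⟨hs₀, hsn, ?_, ?_⟩
    -- Groups the two cubic terms into the single cubic part N of the solvability equation.
    · rw [add_assoc]
      exact hasDerivAt_of_solvabilityCondition hre hw hA₀ hs₀
    · rw [add_assoc]
      exact hasDerivAt_of_solvabilityCondition h0 hw hAn hsn
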